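/- **Notation.** For a $\mathbb Z$-graded complex Lie algebra $\mathfrak g=\bigoplus_j\mathfrak g_j$ put $\mathfrak g_+=\bigoplus_{j>0}\mathfrak g_j$. A graded $\mathfrak g$-module $V=\bigoplus_{j\in\mathbb Z} V_j$ (with $\mathfrak g_iV_j\subset V_{i+j}$) is *quasifinite* if $\dim V_j<\infty$ for all $j$. For $\lambda\in\mathfrak g_0^*$, $L(\mathfrak g,\lambda)$ is the quotient of the Verma module $\mathcal U(\mathfrak g)\otimes_{\mathcal U(\mathfrak g_0\oplus\mathfrak g_+)}\mathbb C_\lambda$ by its maximal proper graded submodule. With $D=t\,\frac{d}{dt}$, let $W_{1+\infty}$ be the Lie algebra with underlying space $\bigoplus_{k\in\mathbb Z}\{t^kf(D): f\in\mathbb C[w]\}\oplus\mathbb C C$, $C$ central and $$[t^rf(D),t^ug(D)]=t^{r+u}\bigl(f(D+u)g(D)-f(D)g(D+r)\bigr)+\Psi(t^rf(D),t^ug(D))\,C,$$ where $\Psi$ is skew-symmetric, zero if $r+u\ne0$, and equal to $\sum_{-r\le m\le-1}f(m)g(m+r)$ if $r=-u\ge0$. Let $W_\infty\subset W_{1+\infty}$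 be the subalgebra spanned by $C$ and all $t^kf(D)D$, graded by $\deg t^kf(D)D=k$, $\deg C=0$. For $\lambda\in(W_\infty)_0^*$ write $L(\lambda)=L(W_\infty,\lambda)$ and $\Delta_\lambda(x)=-\sum_{l\ge0}\lambda(D^{l}D)\,x^l/l!$; if $L(\lambda)$ is quasifinite, $\phi_\lambda$ denotes a quasipolynomial with $\phi_\lambda(0)=0$ and $\Delta_\lambda(x)=\frac{d}{dx}\bigl(\phi_\lambda(x)/(e^x-1)\bigr)$ (it is unique up to adding a multiple of $e^x-1$). Let $\widehat{gl}_\infty=gl_\infty\oplus\mathbb C C$ be the central extension of the Lie algebra of matrices $(a_{ij})_{i,j\in\mathbb Z}$ with finitely many non-zero diagonals given by the cocycle $\operatorname{tr}([J,A]B)$, $J=\sum_{i\le0}E_{ii}$, graded by $\deg E_{ij}=j-i$, $\deg C=0$. For $s\in\mathbb C$ let $\mathfrak g_s=\widehat{gl}_\infty$ if $s\notin\mathbb Z$, and if $s\in\mathbb Z$ let $\mathfrak g_s\subset\widehat{gl}_\infty$ be the graded subalgebra spanned by $C$ and the matrices whose $s$-th row and $s$-th column vanish. Let $\widehat\varphi_s:W_\infty\to\mathfrak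 g_s$ be the homomorphism with $\widehat\varphi_s(C)=C$, $$\widehat\varphi_s(t^kf(D)D)=p_s\Bigl(\sum_{j\in\mathbb Z}f(s-j)(s-j)E_{j-k,j}\Bigr)\quad(k\ne0),$$ $$\widehat\varphi_s(De^{xD})=p_s\Bigl(\sum_{j\in\mathbb Z}(s-j)e^{(s-j)x}E_{jj}\Bigr)-\Bigl(\frac{e^{sx}-1}{e^x-1}\Bigr)'C,$$ where the last identity is one of formal power series in $x$ and $p_s$ erases the $s$-th row and column if $s\in\mathbb Z$ and is the identity otherwise. For $\vec s=(s_1,\dots,s_m)\in\mathbb C^m$ put $\mathfrak g_{\vec s}=\bigoplus_i\mathfrak g_{s_i}$, $\widehat\varphi_{\vec s}=\bigoplus_i\widehat\varphi_{s_i}:W_\infty\to\mathfrak g_{\vec s}$, and for $\lambda_i\in(\mathfrak g_{s_i})_0^*$ put $L(\mathfrak g_{\vec s},\vec\lambda)=\bigotimes_iL(\mathfrak g_{s_i},\lambda_i)$. Call $\vec s$ *admissible* if $s_i-s_j\notin\mathbb Z$ for $i\ne j$ and $0\le\operatorname{Re}s_i<1$ for all $i$. **Theorem 6.7.** (1) Let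 $\vec s$ be admissible and let $V$ be a quasifinite $\mathfrak g_{\vec s}$-module, viewed as a $W_\infty$-module through $\widehat\varphi_{\vec s}$. Then every $W_\infty$-submodule of $V$ is a $\mathfrak g_{\vec s}$-submodule. (2) Let $\vec s$ be admissible and let all $L(\mathfrak g_{s_i},\lambda_i)$ be quasifinite. Then $L(\mathfrak g_{\vec s},\vec\lambda)$ is irreducible as a $W_\infty$-module, and it is isomorphic to a quasifinite $W_\infty$-module $L(\lambda)$ with $\phi_\lambda(x)=\sum_in_ie^{r_ix}$ (a finite sum with $n_i,r_i\in\mathbb C$). (3) Conversely, every quasifinite $W_\infty$-module $L(\lambda)$ with $\phi_\lambda(x)=\sum_in_ie^{r_ix}$ (a finite sum with $n_i,r_i\in\mathbb C$) is isomorphic, as a $W_\infty$-module, to $L(\mathfrak g_{\vec s},\vec\lambda)$ for some admissible $\vec s$ and some $\vec\lambda$ such that all $L(\mathfrak g_{s_i},\lambda_i)$ are quasifinite. -/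

import Mathlib

open Polynomial

noncomputable section

namespace WInfty

/-! ### Infinite matrices with finitely many non-zero diagonals -/

/-- Matrices `(a_{ij})`, `i, j ∈ ℤ`, whose non-zero entries lie in finitely many diagonals. -/
def finDiag : Submodule ℂ (Matrix ℤ ℤ ℂ) where
  carrier := {A | ∃ N : ℕ, ∀ i j : ℤ, (N : ℤ) < |j - i| → A i j = 0}
  zero_mem' := ⟨0, fun _ _ _ => rfl⟩
  add_mem' := by
    rintro A B ⟨N, hN⟩ ⟨M, hM⟩
    refine ⟨max N M, fun i j h => ?_⟩
    have h1 : (N : ℤ) < |j - i| := lt_of_le_of_lt (by simp) h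
    have h2 : (M : ℤ) < |j - i| := lt_of_le_of_lt (by simp) h
    simp [hN i j h1, hM i j h2]
  smul_mem' := by
    rintro c A ⟨N, hN⟩
    exact ⟨N, fun i j h => by simp [hN i j h]⟩

/-- The space `gl_∞`. -/
abbrev GlInf : Type := ↥finDiag

namespace GlInf

lemma ext' {A B : GlInf} (h : ∀ i j, A.1 i j = B.1 i j) : A = B :=
  Subtype.ext (funext fun i => funext fun j => h i j)

lemma finsum_left {A : Matrix ℤ ℤ ℂ} {N : ℕ} (hN : ∀ i j : ℤ, (N : ℤ) < |j - i| → A i j = 0)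
    (b : ℤ → ℂ) (i : ℤ) :
    ∑ᶠ k, A i k * b k = ∑ k ∈ Finset.Icc (i - N) (i + N), A i k * b k := by
  apply finsum_eq_sum_of_support_subset
  intro k hk
  simp only [Finset.coe_Icc, Set.mem_Icc]
  by_contra hcon
  apply hk
  have : (N : ℤ) < |k - i| := by
    rw [lt_abs]; omega
  simp [hN i k this]

lemma finsum_right {B : Matrix ℤ ℤ ℂ} {N : ℕ} (hN : ∀ i j : ℤ, (N : ℤ) < |j - i| → B i j = 0)
    (a : ℤ → ℂ) (j : ℤ) :
    ∑ᶠ k, a k * B k j = ∑ k ∈ Finset.Icc (j - N) (j + N), a k * B k j := by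
  apply finsum_eq_sum_of_support_subset
  intro k hk
  simp only [Finset.coe_Icc, Set.mem_Icc]
  by_contra hcon
  apply hk
  have : (N : ℤ) < |j - k| := by
    rw [lt_abs]; omega
  simp [hN k j this]

/-- Matrix multiplication on `gl_∞`; in every entry only finitely many summands are non-zero. -/
instance : Mul GlInf where
  mul A B := ⟨fun i j => ∑ᶠ k, A.1 i k * B.1 k j, by
    obtain ⟨N, hN⟩ := A.2
    obtain ⟨M, hM⟩ := B.2
    refine ⟨N + M, fun i j h => ?_⟩
    have h0 : ∀ k, A.1 i k * B.1 k j = 0 := by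
      intro k
      by_cases h1 : (N : ℤ) < |k - i|
      · simp [hN i k h1]
      · have : (M : ℤ) < |j - k| := by
          have := abs_add_le (j - k) (k - i)
          rw [sub_add_sub_cancel] at this
          push_cast at h
          omega
        simp [hM k j this]
    simp [h0]⟩

lemma mul_apply (A B : GlInf) (i j : ℤ) : (A * B).1 i j = ∑ᶠ k, A.1 i k * B.1 k j := rfl

@[simp] lemma add_apply (A B : GlInf) (i j : ℤ) : (A + B).1 i j = A.1 i j + B.1 i j := rfl
@[simp] lemma sub_apply (A B : GlInf) (i j : ℤ) : (A - B).1 i j = A.1 i j - B.1 i j := rfl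
@[simp] lemma zero_apply (i j : ℤ) : (0 : GlInf).1 i j = 0 := rfl
@[simp] lemma smul_apply (c : ℂ) (A : GlInf) (i j : ℤ) : (c • A).1 i j = c * A.1 i j := rfl

instance : NonUnitalRing GlInf where
  left_distrib A B C := by
    obtain ⟨N, hN⟩ := A.2
    refine ext' fun i j => ?_
    simp only [mul_apply, add_apply, finsum_left hN]
    rw [← Finset.sum_add_distrib]
    exact Finset.sum_congr rfl fun k _ => mul_add _ _ _
  right_distrib A B C := by
    obtain ⟨N, hN⟩ := C.2
    refine ext' fun i j => ?_
    simp only [mul_apply, add_apply, finsum_right hN]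
    rw [← Finset.sum_add_distrib]
    exact Finset.sum_congr rfl fun k _ => add_mul _ _ _
  zero_mul A := ext' fun i j => by simp [mul_apply]
  mul_zero A := ext' fun i j => by simp [mul_apply]
  mul_assoc A B C := by
    obtain ⟨N, hN⟩ := A.2
    obtain ⟨M, hM⟩ := C.2
    refine ext' fun i j => ?_
    rw [mul_apply, mul_apply, finsum_right hM, finsum_left hN]
    simp only [mul_apply, finsum_left hN, finsum_right hM, Finset.sum_mul, Finset.mul_sum]
    rw [Finset.sum_comm]
    exact Finset.sum_congr rfl fun k _ => Finset.sum_congr rfl fun l _ => mul_assoc _ _ _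

lemma smul_mul' (c : ℂ) (A B : GlInf) : (c • A) * B = c • (A * B) := by
  obtain ⟨N, hN⟩ := B.2
  refine ext' fun i j => ?_
  simp only [mul_apply, smul_apply, finsum_right hN, Finset.mul_sum]
  exact Finset.sum_congr rfl fun k _ => mul_assoc _ _ _

lemma mul_smul' (c : ℂ) (A B : GlInf) : A * (c • B) = c • (A * B) := by
  obtain ⟨N, hN⟩ := A.2
  refine ext' fun i j => ?_
  simp only [mul_apply, smul_apply, finsum_left hN, Finset.mul_sum]
  exact Finset.sum_congr rfl fun k _ => by ring

/-- `gl_∞` is a Lie algebra under the commutator `AB - BA`. -/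
instance : LieRing GlInf where
  add_lie _ _ _ := by simp only [Ring.lie_def, right_distrib, left_distrib]; abel
  lie_add _ _ _ := by simp only [Ring.lie_def, right_distrib, left_distrib]; abel
  lie_self := by simp only [Ring.lie_def, forall_const, sub_self]
  leibniz_lie _ _ _ := by
    simp only [Ring.lie_def, mul_sub_left_distrib, mul_sub_right_distrib, mul_assoc]; abel

lemma lie_eq (A B : GlInf) : ⁅A, B⁆ = A * B - B * A := rfl

instance : LieAlgebra ℂ GlInf where
  lie_smul c A B := by simp only [lie_eq, smul_mul', mul_smul', smul_sub]

/-- The trace (used only for matrices with finitely many non-zero diagonal entries). -/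
def trace (A : GlInf) : ℂ := ∑ᶠ i, A.1 i i

/-- The matrix `J = ∑_{i ≤ 0} E_{ii}`. -/
def J : GlInf :=
  ⟨Matrix.diagonal fun i => if i ≤ 0 then 1 else 0, 0, fun i j h => by
    refine Matrix.diagonal_apply_ne _ ?_
    rintro rfl
    simp at h⟩

lemma J_mul_apply (A : GlInf) (i j : ℤ) :
    (J * A).1 i j = (if i ≤ 0 then 1 else 0) * A.1 i j := by
  rw [mul_apply, finsum_eq_single _ i]
  · simp [J]
  · intro k hk
    simp [J, Matrix.diagonal_apply_ne _ (Ne.symm hk)]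

lemma mul_J_apply (A : GlInf) (i j : ℤ) :
    (A * J).1 i j = A.1 i j * (if j ≤ 0 then 1 else 0) := by
  rw [mul_apply, finsum_eq_single _ j]
  · simp [J]
  · intro k hk
    simp [J, Matrix.diagonal_apply_ne _ hk]

lemma lie_J_apply (A : GlInf) (i j : ℤ) :
    ⁅J, A⁆.1 i j = ((if i ≤ 0 then 1 else 0) - (if j ≤ 0 then 1 else 0)) * A.1 i j := by
  rw [lie_eq, sub_apply, J_mul_apply, mul_J_apply]; ring

/-- Matrices with finitely many non-zero rows. -/
def FinRows (F : GlInf) : Prop := ∃ M : ℕ, ∀ i j : ℤ, (M : ℤ) < |i| → F.1 i j = 0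

lemma FinRows.lie_J (A : GlInf) : FinRows ⁅J, A⁆ := by
  obtain ⟨N, hN⟩ := A.2
  refine ⟨N, fun i j h => ?_⟩
  rw [lie_J_apply]
  by_cases h1 : (N : ℤ) < |j - i|
  · simp [hN i j h1]
  · rw [not_lt, abs_le] at h1
    rw [lt_abs] at h
    split_ifs <;> first | (exfalso; omega) | simp

lemma FinRows.mul_right {F : GlInf} (hF : FinRows F) (A : GlInf) : FinRows (F * A) := by
  obtain ⟨M, hM⟩ := hF
  exact ⟨M, fun i j h => by simp [mul_apply, hM i _ h]⟩

lemma FinRows.mul_left {F : GlInf} (hF : FinRows F) (A : GlInf) : FinRows (A * F) := by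
  obtain ⟨M, hM⟩ := hF
  obtain ⟨N, hN⟩ := A.2
  refine ⟨M + N, fun i j h => ?_⟩
  have h0 : ∀ k, A.1 i k * F.1 k j = 0 := by
    intro k
    by_cases h1 : (N : ℤ) < |k - i|
    · simp [hN i k h1]
    · have : (M : ℤ) < |k| := by
        rw [not_lt, abs_le] at h1
        rw [lt_abs] at h ⊢
        push_cast at h
        omega
      simp [hM k j this]
  simp [mul_apply, h0]

lemma FinRows.trace_eq {F : GlInf} {M : ℕ} (hM : ∀ i j : ℤ, (M : ℤ) < |i| → F.1 i j = 0) :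
    trace F = ∑ i ∈ Finset.Icc (-(M : ℤ)) M, F.1 i i := by
  apply finsum_eq_sum_of_support_subset
  intro k hk
  simp only [Finset.coe_Icc, Set.mem_Icc]
  by_contra hcon
  apply hk
  have : (M : ℤ) < |k| := by
    rw [lt_abs]; omega
  exact hM k k this

lemma trace_add {F G : GlInf} (hF : FinRows F) (hG : FinRows G) :
    trace (F + G) = trace F + trace G := by
  obtain ⟨M, hM⟩ := hF
  obtain ⟨N, hN⟩ := hG
  have hM' : ∀ i j : ℤ, ((M + N : ℕ) : ℤ) < |i| → F.1 i j = 0 := fun i j h =>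
    hM i j (by push_cast at h; omega)
  have hN' : ∀ i j : ℤ, ((M + N : ℕ) : ℤ) < |i| → G.1 i j = 0 := fun i j h =>
    hN i j (by push_cast at h; omega)
  rw [FinRows.trace_eq hM', FinRows.trace_eq hN', FinRows.trace_eq (M := M + N),
    ← Finset.sum_add_distrib]
  · rfl
  · intro i j h
    simp [hM' i j h, hN' i j h]

lemma trace_smul (c : ℂ) (F : GlInf) : trace (c • F) = c * trace F := by
  simp only [trace, smul_apply]
  exact (smul_finsum c fun i => F.1 i i).symm

lemma trace_mul_comm {F : GlInf} (hF : FinRows F) (A : GlInf) :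
    trace (A * F) = trace (F * A) := by
  obtain ⟨M, hM⟩ := hF
  obtain ⟨N, hN⟩ := A.2
  have key : ∀ i k : ℤ, A.1 i k * F.1 k i ≠ 0 → |i| ≤ (M + N : ℕ) ∧ |k| ≤ (M + N : ℕ) := by
    intro i k h
    have h1 : ¬ ((N : ℤ) < |k - i|) := fun h1 => h (by simp [hN i k h1])
    have h2 : ¬ ((M : ℤ) < |k|) := fun h2 => h (by simp [hM k i h2])
    rw [not_lt, abs_le] at h1 h2
    rw [abs_le, abs_le]
    push_cast
    omega
  have hl : ∀ i, (A * F).1 i i = ∑ k ∈ Finset.Icc (-((M + N : ℕ) : ℤ)) (M + N : ℕ),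
      A.1 i k * F.1 k i := fun i => by
    rw [mul_apply]
    apply finsum_eq_sum_of_support_subset
    intro k hk
    simpa [abs_le] using (key i k hk).2
  have hr : ∀ k, (F * A).1 k k = ∑ i ∈ Finset.Icc (-((M + N : ℕ) : ℤ)) (M + N : ℕ),
      A.1 i k * F.1 k i := fun k => by
    rw [mul_apply]
    simp only [mul_comm (F.1 k _)]
    apply finsum_eq_sum_of_support_subset
    intro i hi
    simpa [abs_le] using (key i k hi).1
  have tl : trace (A * F) = ∑ i ∈ Finset.Icc (-((M + N : ℕ) : ℤ)) (M + N : ℕ), (A * F).1 i i := by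
    apply finsum_eq_sum_of_support_subset
    intro i hi
    rw [Function.mem_support, hl] at hi
    obtain ⟨k, -, hk⟩ := Finset.exists_ne_zero_of_sum_ne_zero hi
    simpa [abs_le] using (key i k hk).1
  have tr : trace (F * A) = ∑ k ∈ Finset.Icc (-((M + N : ℕ) : ℤ)) (M + N : ℕ), (F * A).1 k k := by
    apply finsum_eq_sum_of_support_subset
    intro k hk
    rw [Function.mem_support, hr] at hk
    obtain ⟨i, -, hi⟩ := Finset.exists_ne_zero_of_sum_ne_zero hk
    simpa [abs_le] using (key i k hi).2
  rw [tl, tr]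
  simp only [hl, hr]
  exact Finset.sum_comm

/-- The cocycle `Φ(A, B) = tr([J, A] B)`, as a bilinear form. -/
def cocycle : GlInf →ₗ[ℂ] GlInf →ₗ[ℂ] ℂ :=
  LinearMap.mk₂ ℂ (fun A B => trace (⁅J, A⁆ * B))
    (fun A A' B => by
      rw [lie_add, add_mul, trace_add ((FinRows.lie_J _).mul_right _) ((FinRows.lie_J _).mul_right _)])
    (fun c A B => by rw [lie_smul, smul_mul', trace_smul, smul_eq_mul])
    (fun A B B' => by
      rw [mul_add, trace_add ((FinRows.lie_J _).mul_right _) ((FinRows.lie_J _).mul_right _)])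
    (fun c A B => by rw [mul_smul', trace_smul, smul_eq_mul])

lemma cocycle_apply (A B : GlInf) : cocycle A B = trace (⁅J, A⁆ * B) := rfl

lemma lie_J_mul (A B : GlInf) : ⁅J, A * B⁆ = ⁅J, A⁆ * B + A * ⁅J, B⁆ := by
  simp only [lie_eq, mul_sub, sub_mul, mul_assoc]; abel

lemma cocycle_self (A : GlInf) : cocycle A A = 0 := by
  have h1 : trace ⁅J, A * A⁆ = 0 := by
    have h0 : ∀ i, ⁅J, A * A⁆.1 i i = 0 := fun i => by rw [lie_J_apply]; simp
    simp [trace, h0]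
  rw [lie_J_mul, trace_add ((FinRows.lie_J _).mul_right _) ((FinRows.lie_J _).mul_left _),
    trace_mul_comm (FinRows.lie_J _), ← two_mul] at h1
  rw [cocycle_apply]
  simpa using h1

lemma cocycle_mul (A B C : GlInf) : cocycle (A * B) C = cocycle A (B * C) + cocycle B (C * A) := by
  simp only [cocycle_apply]
  rw [lie_J_mul, add_mul, trace_add (((FinRows.lie_J _).mul_right _).mul_right _)
    (((FinRows.lie_J _).mul_left _).mul_right _), mul_assoc, mul_assoc,
    trace_mul_comm ((FinRows.lie_J _).mul_right _), mul_assoc]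

lemma cocycle_lie (A B C : GlInf) :
    cocycle A ⁅B, C⁆ = cocycle ⁅A, B⁆ C + cocycle B ⁅A, C⁆ := by
  simp only [lie_eq, map_sub, LinearMap.sub_apply, cocycle_mul]
  ring

open LieModule.Cohomology in
/-- `Φ` as a 2-cocycle of `gl_∞` with values in the trivial module `ℂ`. -/
def twoCocycle : twoCocycle ℂ GlInf (TrivialLieModule ℂ GlInf ℂ) :=
  ⟨⟨cocycle.compr₂ (TrivialLieModule.equiv ℂ GlInf ℂ).symm.toLinearMap, fun A => by
      simp [cocycle_self]⟩,
    (mem_twoCocycle_iff_of_trivial ℂ GlInf _ _).2 fun A B C => cocycle_lie A B C⟩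

end GlInf

/-- The central extension of `gl_∞` by `ℂ C` defined by the cocycle `Φ`. -/
abbrev GlHat : Type := LieAlgebra.ofTwoCocycle GlInf.twoCocycle

/-- The matrix component of an element of the central extension. -/
def GlHat.mat (x : GlHat) : GlInf := ((LieAlgebra.ofProd _).symm x).1

/-- The coefficient of the central element `C`. -/
def GlHat.cen (x : GlHat) : ℂ := ((LieAlgebra.ofProd _).symm x).2

/-- The element `A + z C`. -/
def GlHat.mk (A : GlInf) (z : ℂ) : GlHat := LieAlgebra.ofProd _ (A, z)

lemma GlHat.lie_mat (x y : GlHat) : ⁅x, y⁆.mat = ⁅x.mat, y.mat⁆ := rfl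

lemma GlHat.lie_cen (x y : GlHat) : ⁅x, y⁆.cen = GlInf.cocycle x.mat y.mat := by
  have : ⁅x, y⁆.cen = GlInf.cocycle x.mat y.mat + 0 - 0 := rfl
  simpa using this

/-! ### Differential operators on the circle and `W_∞` -/

/-- The algebra of regular differential operators on the circle: the operator
`∑_k t^k f_k(D)`, `D = t d/dt`, is represented by the finitely supported family `k ↦ f_k`. -/
def DiffOp : Type := ℤ →₀ ℂ[X]

namespace DiffOp

instance : AddCommGroup DiffOp := inferInstanceAs (AddCommGroup (ℤ →₀ ℂ[X]))
instance : Module ℂ DiffOp := inferInstanceAs (Module ℂ (ℤ →₀ ℂ[X]))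

/-- The coefficient `f_k` of `∑_k t^k f_k(D)`. -/
def coeff (P : DiffOp) (k : ℤ) : ℂ[X] := (show ℤ →₀ ℂ[X] from P) k

/-- The operator `t^k f(D)`. -/
def single (k : ℤ) (f : ℂ[X]) : DiffOp := (Finsupp.single k f : ℤ →₀ ℂ[X])

lemma ext' {P Q : DiffOp} (h : ∀ k, P.coeff k = Q.coeff k) : P = Q := Finsupp.ext h

@[simp] lemma coeff_add (P Q : DiffOp) (k : ℤ) : (P + Q).coeff k = P.coeff k + Q.coeff k := rfl
@[simp] lemma coeff_sub (P Q : DiffOp) (k : ℤ) : (P - Q).coeff k = P.coeff k - Q.coeff k := rfl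
@[simp] lemma coeff_zero (k : ℤ) : (0 : DiffOp).coeff k = 0 := rfl
@[simp] lemma coeff_smul (c : ℂ) (P : DiffOp) (k : ℤ) : (c • P).coeff k = c • P.coeff k := rfl

lemma coeff_single (k l : ℤ) (f : ℂ[X]) : (single k f).coeff l = if k = l then f else 0 :=
  Finsupp.single_apply

lemma single_add (k : ℤ) (f g : ℂ[X]) : single k (f + g) = single k f + single k g :=
  Finsupp.single_add k f g

lemma single_zero (k : ℤ) : single k 0 = 0 := Finsupp.single_zero k

lemma single_smul (k : ℤ) (c : ℂ) (f : ℂ[X]) : single k (c • f) = c • single k f :=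
  (Finsupp.smul_single c k f).symm

lemma induction {p : DiffOp → Prop} (P : DiffOp) (h0 : p 0)
    (hadd : ∀ P Q, p P → p Q → p (P + Q)) (hs : ∀ k f, p (single k f)) : p P :=
  Finsupp.induction_linear (show ℤ →₀ ℂ[X] from P) h0 hadd hs

/-- Composition of differential operators, determined by
`t^k f(D) · t^l g(D) = t^(k+l) f(D+l) g(D)`. -/
instance : Mul DiffOp where
  mul P Q := Finsupp.sum (show ℤ →₀ ℂ[X] from P) fun k f =>
    Finsupp.sum (show ℤ →₀ ℂ[X] from Q) fun l g => single (k + l) (taylor (l : ℂ) f * g)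

lemma mul_def (P Q : DiffOp) : P * Q = Finsupp.sum (show ℤ →₀ ℂ[X] from P) fun k f =>
    Finsupp.sum (show ℤ →₀ ℂ[X] from Q) fun l g => single (k + l) (taylor (l : ℂ) f * g) := rfl

lemma single_mul_single (k l : ℤ) (f g : ℂ[X]) :
    single k f * single l g = single (k + l) (taylor (l : ℂ) f * g) := by
  rw [mul_def, single, single]
  erw [Finsupp.sum_single_index, Finsupp.sum_single_index]
  · simp [single_zero]
  · simp [single_zero]

lemma add_mul' (P P' Q : DiffOp) : (P + P') * Q = P * Q + P' * Q := by
  rw [mul_def, mul_def, mul_def]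
  refine Finsupp.sum_add_index' ?_ ?_
  · intro k
    simp only [map_zero, zero_mul, single_zero]
    exact Finset.sum_const_zero
  · intro k f f'
    simp only [map_add, add_mul, single_add]
    exact Finsupp.sum_add

lemma mul_add' (P Q Q' : DiffOp) : P * (Q + Q') = P * Q + P * Q' := by
  rw [mul_def, mul_def, mul_def]
  refine Eq.trans ?_ Finsupp.sum_add
  refine Finsupp.sum_congr fun k _ => ?_
  refine Finsupp.sum_add_index' ?_ ?_
  · intro k; simp [single_zero]
  · intro k f f'
    simp only [mul_add, single_add]

lemma zero_mul' (Q : DiffOp) : 0 * Q = 0 := by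
  have := add_mul' 0 0 Q
  simpa using this

lemma mul_zero' (Q : DiffOp) : Q * 0 = 0 := by
  have := mul_add' Q 0 0
  simpa using this

/-- The action of differential operators on `t^s ℂ[t, t⁻¹]` in the basis `v_j = t^(-j+s)`, as
a matrix: `φ_s(t^k f(D)) = ∑_j f(-j+s) E_{j-k,j}`. -/
def toGl (s : ℂ) : DiffOp →ₗ[ℂ] GlInf where
  toFun P := ⟨fun i j => (P.coeff (j - i)).eval (-j + s), by
    obtain ⟨N, hN⟩ := (((show ℤ →₀ ℂ[X] from P).support.image Int.natAbs).bddAbove)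
    refine ⟨N, fun i j h => ?_⟩
    have : P.coeff (j - i) = 0 := by
      by_contra hne
      have h1 := hN (Finset.mem_coe.2 (Finset.mem_image_of_mem Int.natAbs
        (Finsupp.mem_support_iff.2 hne)))
      rw [Int.abs_eq_natAbs] at h
      omega
    simp [this]⟩
  map_add' P Q := GlInf.ext' fun i j => by simp
  map_smul' c P := GlInf.ext' fun i j => by simp

lemma toGl_apply (s : ℂ) (P : DiffOp) (i j : ℤ) :
    (toGl s P).1 i j = (P.coeff (j - i)).eval (-j + s) := rfl

lemma toGl_single (s : ℂ) (k : ℤ) (f : ℂ[X]) (i j : ℤ) :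
    (toGl s (single k f)).1 i j = if j = i + k then f.eval (-j + s) else 0 := by
  rw [toGl_apply, coeff_single]
  by_cases h : j = i + k
  · rw [if_pos h, if_pos (by omega)]
  · rw [if_neg h, if_neg (by omega)]; simp

lemma toGl_mul (s : ℂ) (P Q : DiffOp) : toGl s (P * Q) = toGl s P * toGl s Q := by
  induction P using DiffOp.induction with
  | h0 => simp [zero_mul']
  | hadd P P' h h' => simp [add_mul', add_mul, h, h']
  | hs k f =>
    induction Q using DiffOp.induction with
    | h0 => simp [mul_zero']
    | hadd Q Q' h h' => simp [mul_add', mul_add, h, h']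
    | hs l g =>
      refine GlInf.ext' fun i j => ?_
      rw [single_mul_single, GlInf.mul_apply, finsum_eq_single _ (i + k), toGl_single, toGl_single,
        toGl_single, if_pos rfl]
      · by_cases h : j = i + k + l
        · rw [if_pos h, if_pos (by omega), eval_mul, taylor_eval, h]
          push_cast
          congr 2
          ring
        · rw [if_neg h, if_neg (by omega), mul_zero]
      · intro m hm
        rw [toGl_single, if_neg hm, zero_mul]

lemma toGl_injective : Function.Injective (toGl 0) := by
  intro P Q h
  refine ext' fun k => ?_
  refine Polynomial.eq_of_infinite_eval_eq _ _ ?_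
  refine Set.Infinite.mono ?_ (Set.infinite_range_of_injective
    (f := fun j : ℤ => (-j + 0 : ℂ)) fun a b hab => by simpa using hab)
  rintro _ ⟨j, rfl⟩
  have := congrArg (fun A : GlInf => A.1 (j - k) j) h
  simpa [toGl_apply] using this

instance : NonUnitalRing DiffOp where
  left_distrib := mul_add'
  right_distrib := add_mul'
  zero_mul := zero_mul'
  mul_zero := mul_zero'
  mul_assoc P Q R := toGl_injective (by simp only [toGl_mul, mul_assoc])

lemma smul_mul' (c : ℂ) (P Q : DiffOp) : (c • P) * Q = c • (P * Q) :=
  toGl_injective (by simp only [toGl_mul, map_smul, GlInf.smul_mul'])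

lemma mul_smul' (c : ℂ) (P Q : DiffOp) : P * (c • Q) = c • (P * Q) :=
  toGl_injective (by simp only [toGl_mul, map_smul, GlInf.mul_smul'])

/-- Differential operators form a Lie algebra under the commutator. -/
instance : LieRing DiffOp where
  add_lie _ _ _ := by simp only [Ring.lie_def, right_distrib, left_distrib]; abel
  lie_add _ _ _ := by simp only [Ring.lie_def, right_distrib, left_distrib]; abel
  lie_self := by simp only [Ring.lie_def, forall_const, sub_self]
  leibniz_lie _ _ _ := by
    simp only [Ring.lie_def, mul_sub_left_distrib, mul_sub_right_distrib, mul_assoc]; abel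

lemma lie_eq (P Q : DiffOp) : ⁅P, Q⁆ = P * Q - Q * P := rfl

instance : LieAlgebra ℂ DiffOp where
  lie_smul c P Q := by simp only [lie_eq, smul_mul', mul_smul', smul_sub]

lemma toGl_lie (s : ℂ) (P Q : DiffOp) : toGl s ⁅P, Q⁆ = ⁅toGl s P, toGl s Q⁆ := by
  simp only [lie_eq, GlInf.lie_eq, map_sub, toGl_mul]

/-- `Ψ(t^r f(D), t^(-r) g(D))`: for `r ≥ 0` only the first sum is non-empty, and it is
`∑_{-r ≤ m ≤ -1} f(m) g(m+r)`; for `r ≤ 0` only the second one is, as skew-symmetry demands. -/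
def psi (r : ℤ) (f g : ℂ[X]) : ℂ :=
  ∑ m ∈ Finset.Ico (-r) 0, f.eval (m : ℂ) * g.eval ((m : ℂ) + r) -
    ∑ m ∈ Finset.Ico r 0, g.eval (m : ℂ) * f.eval ((m : ℂ) - r)

/-- The cocycle `Ψ` on differential operators, as a bilinear form;
`Ψ(t^r f(D), t^k g(D)) = 0` if `r + k ≠ 0`. -/
def cocycle : DiffOp →ₗ[ℂ] DiffOp →ₗ[ℂ] ℂ :=
  LinearMap.mk₂ ℂ
    (fun P Q => Finsupp.sum (show ℤ →₀ ℂ[X] from P) fun r f => psi r f (Q.coeff (-r)))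
    (fun P P' Q => Finsupp.sum_add_index' (fun r => by simp [psi]) (fun r f f' => by
      simp only [psi, eval_add, add_mul, mul_add, Finset.sum_add_distrib]; ring))
    (fun c P Q => by
      refine (Finsupp.sum_smul_index' (fun r => by simp [psi])).trans ?_
      rw [Finsupp.smul_sum]
      refine Finsupp.sum_congr fun r _ => ?_
      simp only [psi, eval_smul, smul_eq_mul, mul_sub, Finset.mul_sum]
      congr 1 <;> exact Finset.sum_congr rfl fun m _ => by ring)
    (fun P Q Q' => by
      rw [← Finsupp.sum_add]
      refine Finsupp.sum_congr fun r _ => ?_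
      simp only [psi, coeff_add, eval_add, add_mul, mul_add, Finset.sum_add_distrib]; ring)
    (fun c P Q => by
      rw [Finsupp.smul_sum]
      refine Finsupp.sum_congr fun r _ => ?_
      simp only [psi, coeff_smul, eval_smul, smul_eq_mul, mul_sub, Finset.mul_sum]
      congr 1 <;> exact Finset.sum_congr rfl fun m _ => by ring)

lemma cocycle_single (r k : ℤ) (f g : ℂ[X]) :
    cocycle (single r f) (single k g) = if k = -r then psi r f g else 0 := by
  have h : cocycle (single r f) (single k g) = psi r f ((single k g).coeff (-r)) :=
    Finsupp.sum_single_index (a := r) (b := f)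
      (h := fun r f => psi r f ((single k g).coeff (-r))) (by simp [psi])
  rw [h, coeff_single]
  split_ifs with h1
  · rfl
  · simp [psi]

lemma gl_cocycle_single (s : ℂ) (r k : ℤ) (f g : ℂ[X]) :
    GlInf.cocycle (toGl s (single r f)) (toGl s (single k g)) =
      if k = -r then psi r (taylor s f) (taylor s g) else 0 := by
  have hd : ∀ i, (⁅GlInf.J, toGl s (single r f)⁆ * toGl s (single k g)).1 i i =
      if k = -r then ((if i ≤ 0 then 1 else 0) - (if i + r ≤ 0 then 1 else 0)) *
        (f.eval (-(i + r) + s) * g.eval (-i + s)) else 0 := by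
    intro i
    rw [GlInf.mul_apply, finsum_eq_single _ (i + r)]
    · rw [GlInf.lie_J_apply, toGl_single, toGl_single, if_pos rfl]
      by_cases h : k = -r
      · rw [if_pos (show i = i + r + k by omega), if_pos h]; push_cast; ring
      · rw [if_neg (show ¬ i = i + r + k by omega), if_neg h, mul_zero]
    · intro m hm
      rw [GlInf.lie_J_apply, toGl_single, if_neg hm, mul_zero, zero_mul]
  rw [GlInf.cocycle_apply, GlInf.trace]
  simp only [hd]
  split_ifs with h
  · rw [psi]
    rcases le_total 0 r with hr | hr
    · rw [Finset.Ico_eq_empty (a := r) (by omega), Finset.sum_empty, sub_zero]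
      rw [finsum_eq_sum_of_support_subset (s := Finset.Ioc (-r) 0)]
      · refine Finset.sum_bij' (fun i _ => -r - i) (fun m _ => -r - m) ?_ ?_ ?_ ?_ ?_
        · intro i hi; simp at hi ⊢; omega
        · intro i hi; simp at hi ⊢; omega
        · intro i _; simp
        · intro i _; simp
        · intro i hi
          simp only [Finset.mem_Ioc] at hi
          rw [if_pos (by omega), if_neg (by omega), taylor_eval, taylor_eval]
          push_cast
          rw [sub_zero, one_mul]
          congr 2 <;> ring
      · intro i hi
        rw [Function.mem_support] at hi
        simp only [Finset.coe_Ioc, Set.mem_Ioc]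
        by_contra hc
        apply hi
        split_ifs <;> first | (exfalso; omega) | simp
    · rw [Finset.Ico_eq_empty (a := -r) (by omega), Finset.sum_empty, zero_sub,
        ← Finset.sum_neg_distrib]
      rw [finsum_eq_sum_of_support_subset (s := Finset.Ioc 0 (-r))]
      · refine Finset.sum_bij' (fun i _ => -i) (fun m _ => -m) ?_ ?_ ?_ ?_ ?_
        · intro i hi; simp at hi ⊢; omega
        · intro i hi; simp at hi ⊢; omega
        · intro i _; simp
        · intro i _; simp
        · intro i hi
          simp only [Finset.mem_Ioc] at hi
          rw [if_neg (by omega), if_pos (by omega), taylor_eval, taylor_eval]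
          push_cast
          rw [show -((i : ℂ) + r) + s = s + (-i - r) by ring, show -(i : ℂ) + s = s + -i by ring]
          ring_nf
      · intro i hi
        rw [Function.mem_support] at hi
        simp only [Finset.coe_Ioc, Set.mem_Ioc]
        by_contra hc
        apply hi
        split_ifs <;> first | (exfalso; omega) | simp
  · simp

lemma cocycle_eq (P Q : DiffOp) : cocycle P Q = GlInf.cocycle (toGl 0 P) (toGl 0 Q) := by
  induction P using DiffOp.induction with
  | h0 => simp
  | hadd P P' h h' => simp [h, h']
  | hs k f =>
    induction Q using DiffOp.induction with
    | h0 => simp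
    | hadd Q Q' h h' => simp [h, h']
    | hs l g => rw [cocycle_single, gl_cocycle_single, taylor_zero, taylor_zero]

open LieModule.Cohomology in
/-- `Ψ` as a 2-cocycle with values in the trivial module `ℂ`. -/
def twoCocycle : twoCocycle ℂ DiffOp (TrivialLieModule ℂ DiffOp ℂ) :=
  ⟨⟨cocycle.compr₂ (TrivialLieModule.equiv ℂ DiffOp ℂ).symm.toLinearMap, fun A => by
      simp [cocycle_eq, GlInf.cocycle_self]⟩,
    (mem_twoCocycle_iff_of_trivial ℂ DiffOp _ _).2 fun A B C => by
      change cocycle A ⁅B, C⁆ = cocycle ⁅A, B⁆ C + cocycle B ⁅A, C⁆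
      simp only [cocycle_eq, toGl_lie]
      exact GlInf.cocycle_lie _ _ _⟩

end DiffOp

/-- The central extension `W_{1+∞}` of the Lie algebra of differential operators by `ℂ C`,
defined by the cocycle `Ψ`. -/
abbrev W1Inf : Type := LieAlgebra.ofTwoCocycle DiffOp.twoCocycle

namespace W1Inf

/-- The differential operator component. -/
def op (x : W1Inf) : DiffOp := ((LieAlgebra.ofProd _).symm x).1

/-- The coefficient of the central element `C`. -/
def cen (x : W1Inf) : ℂ := ((LieAlgebra.ofProd _).symm x).2

/-- The element `P + z C`. -/
def mk (P : DiffOp) (z : ℂ) : W1Inf := LieAlgebra.ofProd _ (P, z)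

lemma lie_op (x y : W1Inf) : ⁅x, y⁆.op = ⁅x.op, y.op⁆ := rfl

lemma lie_cen (x y : W1Inf) : ⁅x, y⁆.cen = DiffOp.cocycle x.op y.op := by
  have : ⁅x, y⁆.cen = DiffOp.cocycle x.op y.op + 0 - 0 := rfl
  simpa using this

end W1Inf

lemma DiffOp.X_dvd_coeff_iff (P : DiffOp) :
    (∀ k, (X : ℂ[X]) ∣ P.coeff k) ↔ ∀ i, (DiffOp.toGl 0 P).1 i 0 = 0 := by
  constructor
  · intro h i
    have := h (0 - i)
    rw [X_dvd_iff, coeff_zero_eq_eval_zero] at this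
    simpa [DiffOp.toGl_apply] using this
  · intro h k
    rw [X_dvd_iff, coeff_zero_eq_eval_zero]
    simpa [DiffOp.toGl_apply] using h (-k)

lemma DiffOp.X_dvd_mul (P Q : DiffOp) (hQ : ∀ k, (X : ℂ[X]) ∣ Q.coeff k) (k : ℤ) :
    (X : ℂ[X]) ∣ (P * Q).coeff k := by
  revert k
  rw [DiffOp.X_dvd_coeff_iff] at hQ ⊢
  intro i
  simp [DiffOp.toGl_mul, GlInf.mul_apply, hQ]

/-- `W_∞`: the subalgebra of `W_{1+∞}` spanned by `C` and the operators `t^k f(D) D`. -/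
def WInf : LieSubalgebra ℂ W1Inf where
  carrier := {x | ∀ k, (X : ℂ[X]) ∣ x.op.coeff k}
  zero_mem' := fun k => dvd_zero _
  add_mem' := fun {x y} hx hy k => dvd_add (hx k) (hy k)
  smul_mem' := fun c x hx k => by
    change X ∣ c • x.op.coeff k
    rw [smul_eq_C_mul]
    exact dvd_mul_of_dvd_right (hx k) _
  lie_mem' := fun {x y} hx hy k => by
    rw [W1Inf.lie_op, DiffOp.lie_eq, DiffOp.coeff_sub]
    exact dvd_sub (DiffOp.X_dvd_mul _ _ hy k) (DiffOp.X_dvd_mul _ _ hx k)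

/-! ### The algebras `𝔤_s` and the homomorphisms from `W_∞` -/

/-- The subalgebra `𝔤_s`: all of the central extension of `gl_∞` if `s ∉ ℤ`; if `s ∈ ℤ`, the
elements whose matrix has zero `s`-th row and zero `s`-th column (`v_s = t^0` spans the constants,
which are killed by `W_∞`). -/
def gs (s : ℂ) : LieSubalgebra ℂ GlHat where
  carrier := {x | ∀ i j : ℤ, (i : ℂ) = s ∨ (j : ℂ) = s → x.mat.1 i j = 0}
  zero_mem' := fun i j _ => rfl
  add_mem' := fun {x y} hx hy i j h => by
    change x.mat.1 i j + y.mat.1 i j = 0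
    rw [hx i j h, hy i j h, add_zero]
  smul_mem' := fun c x hx i j h => by
    change c * x.mat.1 i j = 0
    rw [hx i j h, mul_zero]
  lie_mem' := fun {x y} hx hy i j h => by
    rw [GlHat.lie_mat, GlInf.lie_eq, GlInf.sub_apply, GlInf.mul_apply, GlInf.mul_apply]
    rcases h with h | h
    · simp [hx i _ (Or.inl h), hy i _ (Or.inl h)]
    · simp [hx _ j (Or.inr h), hy _ j (Or.inr h)]

open Classical in
/-- The projection `p_s` which erases the `s`-th row and the `s`-th column (the identity if
`s ∉ ℤ`). -/
def projGl (s : ℂ) : GlInf →ₗ[ℂ] GlInf where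
  toFun A := ⟨fun i j => if (i : ℂ) = s ∨ (j : ℂ) = s then 0 else A.1 i j, by
    obtain ⟨N, hN⟩ := A.2
    exact ⟨N, fun i j h => by simp [hN i j h]⟩⟩
  map_add' A B := GlInf.ext' fun i j => by
    simp only [GlInf.add_apply]; split_ifs <;> simp
  map_smul' c A := GlInf.ext' fun i j => by
    simp only [GlInf.smul_apply, RingHom.id_apply]; split_ifs <;> simp

open Classical in
lemma projGl_apply (s : ℂ) (A : GlInf) (i j : ℤ) :
    (projGl s A).1 i j = if (i : ℂ) = s ∨ (j : ℂ) = s then 0 else A.1 i j := rfl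

lemma projGl_mul (s : ℂ) (A B : GlInf) (hA : ∀ i j : ℤ, (j : ℂ) = s → A.1 i j = 0) :
    projGl s (A * B) = projGl s A * projGl s B := by
  refine GlInf.ext' fun i j => ?_
  rw [projGl_apply, GlInf.mul_apply, GlInf.mul_apply]
  split_ifs with h
  · rcases h with h | h
    · simp [projGl_apply, h]
    · simp [projGl_apply, h]
  · refine finsum_congr fun k => ?_
    rw [projGl_apply, projGl_apply]
    by_cases hk : (k : ℂ) = s
    · simp [hk, hA i k hk]
    · rw [if_neg (by tauto), if_neg (by tauto)]

lemma cocycle_projGl (s : ℂ) (A B : GlInf) (hA : ∀ i j : ℤ, (j : ℂ) = s → A.1 i j = 0)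
    (hB : ∀ i j : ℤ, (j : ℂ) = s → B.1 i j = 0) :
    GlInf.cocycle (projGl s A) (projGl s B) = GlInf.cocycle A B := by
  rw [GlInf.cocycle_apply, GlInf.cocycle_apply, GlInf.trace, GlInf.trace]
  refine finsum_congr fun i => ?_
  rw [GlInf.mul_apply, GlInf.mul_apply]
  refine finsum_congr fun k => ?_
  rw [GlInf.lie_J_apply, GlInf.lie_J_apply, projGl_apply, projGl_apply]
  by_cases hi : (i : ℂ) = s
  · simp [hi, hB k i hi]
  · by_cases hk : (k : ℂ) = s
    · simp [hk, hA i k hk]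
    · rw [if_neg (show ¬((i : ℂ) = s ∨ (k : ℂ) = s) by tauto),
        if_neg (show ¬((k : ℂ) = s ∨ (i : ℂ) = s) by tauto)]

/-- The formal power series `F(x)/x`, for `F(0) = 0`. -/
def divX (F : PowerSeries ℂ) : PowerSeries ℂ := PowerSeries.mk fun n => PowerSeries.coeff (n + 1) F

/-- The formal power series `F(x)/(e^x - 1)`, for `F(0) = 0`. -/
def divExpSubOne (F : PowerSeries ℂ) : PowerSeries ℂ :=
  divX F * (divX (PowerSeries.exp ℂ - 1))⁻¹

/-- The formal power series `e^{rx}`. -/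
def expSeries (r : ℂ) : PowerSeries ℂ := PowerSeries.rescale r (PowerSeries.exp ℂ)

lemma X_mul_divX (F : PowerSeries ℂ) (hF : PowerSeries.constantCoeff F = 0) :
    PowerSeries.X * divX F = F := by
  ext n
  cases n with
  | zero => simpa using hF.symm
  | succ n => simp [divX]

lemma divExpSubOne_mul (F : PowerSeries ℂ) (hF : PowerSeries.constantCoeff F = 0) :
    divExpSubOne F * (PowerSeries.exp ℂ - 1) = F := by
  have h : divX (PowerSeries.exp ℂ - 1) ≠ 0 := by
    intro h
    have := congrArg (PowerSeries.coeff 0) h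
    simp [divX, PowerSeries.coeff_exp, PowerSeries.coeff_one] at this
  have h' : PowerSeries.constantCoeff (divX (PowerSeries.exp ℂ - 1)) ≠ 0 := by
    simp [divX, ← PowerSeries.coeff_zero_eq_constantCoeff_apply, PowerSeries.coeff_exp,
      PowerSeries.coeff_one]
  calc divExpSubOne F * (PowerSeries.exp ℂ - 1)
      = divX F * (divX (PowerSeries.exp ℂ - 1))⁻¹ *
        (PowerSeries.X * divX (PowerSeries.exp ℂ - 1)) := by
        rw [X_mul_divX (PowerSeries.exp ℂ - 1) (by simp), divExpSubOne]
    _ = PowerSeries.X * divX F *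
        (divX (PowerSeries.exp ℂ - 1) * (divX (PowerSeries.exp ℂ - 1))⁻¹) := by ring
    _ = F := by rw [PowerSeries.mul_inv_cancel _ h', mul_one, X_mul_divX F hF]

/-- The linear functional on `ℂ[w]` with generating series `F`: it sends `e^{xw}` to `F(x)`, i.e.
`w^n` to `n!` times the `n`-th coefficient of `F`. -/
def genFunctional (F : PowerSeries ℂ) : ℂ[X] →ₗ[ℂ] ℂ :=
  Polynomial.lsum fun n => LinearMap.mulRight ℂ ((n.factorial : ℂ) * PowerSeries.coeff n F)

lemma genFunctional_monomial (F : PowerSeries ℂ) (n : ℕ) (a : ℂ) :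
    genFunctional F (monomial n a) = a * (n.factorial * PowerSeries.coeff n F) := by
  simp [genFunctional, Polynomial.sum_monomial_index, mul_assoc]

lemma genFunctional_exp (s : ℂ) (q : ℂ[X]) : genFunctional (expSeries s) q = q.eval s := by
  induction q using Polynomial.induction_on' with
  | add p q hp hq => simp [hp, hq]
  | monomial n a =>
    rw [genFunctional_monomial, eval_monomial, expSeries, PowerSeries.coeff_rescale,
      PowerSeries.coeff_exp]
    have : (n.factorial : ℂ) ≠ 0 := by exact_mod_cast n.factorial_ne_zero
    rw [map_div₀, map_one, map_natCast]
    field_simp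

lemma genFunctional_sub (F G : PowerSeries ℂ) (q : ℂ[X]) :
    genFunctional (F - G) q = genFunctional F q - genFunctional G q := by
  induction q using Polynomial.induction_on' with
  | add p q hp hq => simp only [map_add, hp, hq]; ring
  | monomial n a => simp only [genFunctional_monomial, map_sub]; ring

lemma genFunctional_mul_exp (F : PowerSeries ℂ) (q : ℂ[X]) :
    genFunctional (F * PowerSeries.exp ℂ) q = genFunctional F (taylor 1 q) := by
  induction q using Polynomial.induction_on' with
  | add p q hp hq => simp [hp, hq]
  | monomial n a =>
    rw [genFunctional_monomial, taylor_monomial, map_one, add_pow, PowerSeries.coeff_mul,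
      Finset.Nat.sum_antidiagonal_eq_sum_range_succ_mk, Finset.mul_sum, Finset.mul_sum,
      Finset.mul_sum, map_sum]
    refine Finset.sum_congr rfl fun k hk => ?_
    have hk' : k ≤ n := by simpa [Nat.lt_succ_iff] using hk
    have e : C a * (X ^ k * 1 ^ (n - k) * ((n.choose k : ℕ) : ℂ[X])) =
        monomial k (a * n.choose k) := by
      rw [← C_mul_X_pow_eq_monomial, one_pow, mul_one, C_mul, ← C_eq_natCast]
      simp
      ring
    rw [e, genFunctional_monomial, PowerSeries.coeff_exp, Nat.cast_choose ℂ hk']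
    have h1 : (k.factorial : ℂ) ≠ 0 := by exact_mod_cast k.factorial_ne_zero
    have h2 : ((n - k).factorial : ℂ) ≠ 0 := by exact_mod_cast (n - k).factorial_ne_zero
    simp
    field_simp

/-- The central correction: `κ_s(e^{xD}) = -(e^{sx} - 1)/(e^x - 1)`, so that
`κ_s(D e^{xD}) = -((e^{sx} - 1)/(e^x - 1))'`. -/
def kappa (s : ℂ) : ℂ[X] →ₗ[ℂ] ℂ := -genFunctional (divExpSubOne (expSeries s - 1))

lemma kappa_taylor_one (s : ℂ) (q : ℂ[X]) :
    kappa s (taylor 1 q) - kappa s q = q.eval 0 - q.eval s := by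
  have h0 : PowerSeries.constantCoeff (expSeries s - 1) = 0 := by
    rw [← PowerSeries.coeff_zero_eq_constantCoeff_apply, map_sub, expSeries,
      PowerSeries.coeff_rescale]
    simp
  have h1 : (1 : PowerSeries ℂ) = expSeries 0 := by
    simp [expSeries]
  have h := congrArg (fun F => genFunctional F q) (divExpSubOne_mul (expSeries s - 1) h0)
  rw [mul_sub, mul_one, genFunctional_sub, genFunctional_mul_exp, genFunctional_sub,
    genFunctional_exp] at h
  have h2 := genFunctional_exp 0 q
  rw [← h1] at h2
  rw [h2] at h
  simp only [kappa, LinearMap.neg_apply]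
  linear_combination -h

lemma sum_Ico_neg (n : ℕ) (h : ℤ → ℂ) :
    ∑ m ∈ Finset.Ico (-(n : ℤ)) 0, h m = ∑ i ∈ Finset.range n, h (-(i + 1 : ℤ)) := by
  refine Finset.sum_bij' (fun m _ => (-m - 1).toNat) (fun i _ => -(i + 1 : ℤ)) ?_ ?_ ?_ ?_ ?_
  · intro m hm; simp at hm ⊢; omega
  · intro i hi; simp at hi ⊢; omega
  · intro m hm; simp at hm ⊢; omega
  · intro i hi; simp
  · intro m hm
    simp at hm
    congr 1
    omega

lemma kappa_taylor_neg_nat (s : ℂ) (n : ℕ) (q : ℂ[X]) :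
    kappa s (taylor (-n : ℂ) q) - kappa s q =
      ∑ i ∈ Finset.range n, (q.eval (s - (i + 1)) - q.eval (-(i + 1 : ℂ))) := by
  induction n with
  | zero => simp
  | succ n ih =>
    rw [Finset.sum_range_succ, ← ih]
    have h := kappa_taylor_one s (taylor (-(n + 1 : ℕ) : ℂ) q)
    rw [taylor_taylor, taylor_eval, taylor_eval] at h
    push_cast at h ⊢
    rw [show (1 : ℂ) + -(n + 1) = -n by ring, show (0 : ℂ) + -(n + 1) = -(n + 1) by ring,
      show s + -(n + 1 : ℂ) = s - (n + 1) by ring] at h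
    linear_combination -h

lemma kappa_taylor (s : ℂ) (r : ℤ) (f g : ℂ[X]) :
    kappa s (taylor (-r : ℂ) f * g - taylor (r : ℂ) g * f) =
      DiffOp.psi r (taylor s f) (taylor s g) - DiffOp.psi r f g := by
  obtain ⟨n, rfl | rfl⟩ := r.eq_nat_or_neg
  · have h := kappa_taylor_neg_nat s n (f * taylor (n : ℂ) g)
    rw [taylor_mul, taylor_taylor, neg_add_cancel, taylor_zero] at h
    simp only [DiffOp.psi, Int.cast_natCast]
    rw [map_sub, mul_comm (taylor (n : ℂ) g) f, h,
      Finset.Ico_eq_empty (a := (n : ℤ)) (by omega), Finset.sum_empty, sub_zero, Finset.sum_empty, sub_zero,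
      sum_Ico_neg, sum_Ico_neg, Finset.sum_sub_distrib]
    congr 1 <;> refine Finset.sum_congr rfl fun i _ => ?_
    · simp only [eval_mul, taylor_eval]
      push_cast
      congr 2 <;> ring
    · simp only [eval_mul, taylor_eval]
      push_cast
      congr 2
  · have h := kappa_taylor_neg_nat s n (g * taylor (n : ℂ) f)
    rw [taylor_mul, taylor_taylor, neg_add_cancel, taylor_zero] at h
    simp only [DiffOp.psi, Int.cast_neg, Int.cast_natCast, neg_neg]
    rw [map_sub, mul_comm (taylor (n : ℂ) f) g, ← neg_sub, h,
      Finset.Ico_eq_empty (a := (n : ℤ)) (by omega), Finset.sum_empty, zero_sub, Finset.sum_empty,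
      zero_sub, sum_Ico_neg, sum_Ico_neg, Finset.sum_sub_distrib, neg_sub, neg_sub_neg]
    congr 1 <;> refine Finset.sum_congr rfl fun i _ => ?_
    · simp only [eval_mul, taylor_eval]
      push_cast
      congr 2
      ring
    · simp only [eval_mul, taylor_eval]
      push_cast
      congr 2 <;> ring

lemma cocycle_toGl (s : ℂ) (P Q : DiffOp) :
    GlInf.cocycle (DiffOp.toGl s P) (DiffOp.toGl s Q) =
      DiffOp.cocycle P Q + kappa s (⁅P, Q⁆.coeff 0) := by
  induction P using DiffOp.induction with
  | h0 => simp
  | hadd P P' h h' => simp [h, h', add_lie]; ring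
  | hs k f =>
    induction Q using DiffOp.induction with
    | h0 => simp
    | hadd Q Q' h h' => simp [h, h', lie_add]; ring
    | hs l g =>
      rw [DiffOp.gl_cocycle_single, DiffOp.cocycle_single, DiffOp.lie_eq, DiffOp.coeff_sub,
        DiffOp.single_mul_single, DiffOp.single_mul_single, DiffOp.coeff_single,
        DiffOp.coeff_single]
      by_cases h : l = -k
      · subst h
        have := kappa_taylor s k f g
        simp only [add_neg_cancel, neg_add_cancel, if_true, Int.cast_neg]
        rw [this]; ring
      · rw [if_neg h, if_neg h, if_neg (by omega), if_neg (by omega)]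
        simp

lemma toGl_column (s : ℂ) (w : WInf) (i j : ℤ) (hj : (j : ℂ) = s) :
    (DiffOp.toGl s w.1.op).1 i j = 0 := by
  have := w.2 (j - i)
  rw [X_dvd_iff, coeff_zero_eq_eval_zero] at this
  rw [DiffOp.toGl_apply, hj, neg_add_cancel, this]

/-- The homomorphism `φ̂_s : W_∞ → 𝔤_s`; it sends `t^k f(D) D` to
`p_s (∑_j f(-j+s) (-j+s) E_{j-k,j})`, plus for `k = 0` the central correction, and `C` to `C`. -/
def phiHat (s : ℂ) : WInf →ₗ⁅ℂ⁆ gs s where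
  toFun w := ⟨GlHat.mk (projGl s (DiffOp.toGl s w.1.op)) (w.1.cen + kappa s (w.1.op.coeff 0)),
    fun i j h => if_pos h⟩
  map_add' w w' := by
    have h : w.1.cen + w'.1.cen + kappa s (w.1.op.coeff 0 + w'.1.op.coeff 0) =
        w.1.cen + kappa s (w.1.op.coeff 0) + (w'.1.cen + kappa s (w'.1.op.coeff 0)) := by
      rw [map_add]; ring
    have h' : projGl s (DiffOp.toGl s (w.1.op + w'.1.op)) =
        projGl s (DiffOp.toGl s w.1.op) + projGl s (DiffOp.toGl s w'.1.op) := by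
      rw [map_add, map_add]
    exact Subtype.ext (congrArg₂ GlHat.mk h' h)
  map_smul' c w := by
    have h : c * w.1.cen + kappa s (c • w.1.op.coeff 0) =
        c * (w.1.cen + kappa s (w.1.op.coeff 0)) := by
      rw [map_smul, smul_eq_mul]; ring
    have h' : projGl s (DiffOp.toGl s (c • w.1.op)) = c • projGl s (DiffOp.toGl s w.1.op) := by
      rw [map_smul, map_smul]
    exact Subtype.ext (congrArg₂ GlHat.mk h' h)
  map_lie' {w w'} := by
    have hc := toGl_column s w
    have hc' := toGl_column s w'
    have h' : projGl s (DiffOp.toGl s ⁅w.1.op, w'.1.op⁆) =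
        ⁅projGl s (DiffOp.toGl s w.1.op), projGl s (DiffOp.toGl s w'.1.op)⁆ := by
      rw [DiffOp.toGl_lie, GlInf.lie_eq, GlInf.lie_eq, map_sub, projGl_mul s _ _ hc,
        projGl_mul s _ _ hc']
    have h : ⁅w.1, w'.1⁆.cen + kappa s (⁅w.1.op, w'.1.op⁆.coeff 0) =
        (⁅GlHat.mk (projGl s (DiffOp.toGl s w.1.op)) (w.1.cen + kappa s (w.1.op.coeff 0)),
          GlHat.mk (projGl s (DiffOp.toGl s w'.1.op))
            (w'.1.cen + kappa s (w'.1.op.coeff 0))⁆ : GlHat).cen := by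
      rw [W1Inf.lie_cen, GlHat.lie_cen, ← cocycle_toGl]
      exact (cocycle_projGl s _ _ hc hc').symm
    exact Subtype.ext (congrArg₂ GlHat.mk h' h)

section Pi

variable {ι : Type*} (g : ι → Type*) [∀ i, LieRing (g i)] [∀ i, LieAlgebra ℂ (g i)]

/-- The direct sum of a finite family of Lie algebras: families with the componentwise bracket. -/
instance piLieRing : LieRing (∀ i, g i) where
  bracket x y i := ⁅x i, y i⁆
  add_lie x y z := funext fun i => add_lie (x i) (y i) (z i)
  lie_add x y z := funext fun i => lie_add (x i) (y i) (z i)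
  lie_self x := funext fun i => lie_self (x i)
  leibniz_lie x y z := funext fun i => leibniz_lie (x i) (y i) (z i)

instance piLieAlgebra : LieAlgebra ℂ (∀ i, g i) where
  lie_smul c x y := funext fun i => lie_smul c (x i) (y i)

end Pi

/-- The Lie algebra `𝔤_{s⃗} = ⊕_i 𝔤_{s_i}`. -/
abbrev gsVec {m : ℕ} (s : Fin m → ℂ) : Type := ∀ i, gs (s i)

/-- The homomorphism `φ̂_{s⃗} = ⊕_i φ̂_{s_i} : W_∞ → 𝔤_{s⃗}`. -/
def phiHatVec {m : ℕ} (s : Fin m → ℂ) : WInf →ₗ⁅ℂ⁆ gsVec s where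
  toFun w i := phiHat (s i) w
  map_add' w w' := funext fun i => map_add (phiHat (s i)) w w'
  map_smul' c w := funext fun i => map_smul (phiHat (s i)) c w
  map_lie' {w w'} := funext fun i => LieHom.map_lie (phiHat (s i)) w w'

/-! ### Principal gradations -/

/-- The principal gradation of `W_∞`: `wt t^k f(D) = k`, `wt C = 0`. -/
def wGrading (k : ℤ) : Submodule ℂ WInf where
  carrier := {w | (∀ l, l ≠ k → w.1.op.coeff l = 0) ∧ (k ≠ 0 → w.1.cen = 0)}
  zero_mem' := ⟨fun _ _ => rfl, fun _ => rfl⟩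
  add_mem' := fun {x y} hx hy => ⟨fun l hl => by
    change x.1.op.coeff l + y.1.op.coeff l = 0
    rw [hx.1 l hl, hy.1 l hl, add_zero], fun hk => by
    change x.1.cen + y.1.cen = 0
    rw [hx.2 hk, hy.2 hk, add_zero]⟩
  smul_mem' := fun c x hx => ⟨fun l hl => by
    change c • x.1.op.coeff l = 0
    rw [hx.1 l hl, smul_zero], fun hk => by
    change c * x.1.cen = 0
    rw [hx.2 hk, mul_zero]⟩

/-- The gradation of `𝔤_s`: `deg E_{ij} = j - i`, `deg C = 0`. -/
def gsGrading (s : ℂ) (k : ℤ) : Submodule ℂ (gs s) where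
  carrier := {x | (∀ i j, j - i ≠ k → x.1.mat.1 i j = 0) ∧ (k ≠ 0 → x.1.cen = 0)}
  zero_mem' := ⟨fun _ _ _ => rfl, fun _ => rfl⟩
  add_mem' := fun {x y} hx hy => ⟨fun i j h => by
    change x.1.mat.1 i j + y.1.mat.1 i j = 0
    rw [hx.1 i j h, hy.1 i j h, add_zero], fun hk => by
    change x.1.cen + y.1.cen = 0
    rw [hx.2 hk, hy.2 hk, add_zero]⟩
  smul_mem' := fun c x hx => ⟨fun i j h => by
    change c * x.1.mat.1 i j = 0
    rw [hx.1 i j h, mul_zero], fun hk => by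
    change c * x.1.cen = 0
    rw [hx.2 hk, mul_zero]⟩

/-- The gradation of `𝔤_{s⃗}`. -/
def gsVecGrading {m : ℕ} (s : Fin m → ℂ) (k : ℤ) : Submodule ℂ (gsVec s) :=
  Submodule.pi Set.univ fun i => gsGrading (s i) k

/-! ### Graded modules and highest weight modules over a graded Lie algebra -/

section Graded

attribute [local instance] LieRing.ofAssociativeRing

variable {L : Type*} [LieRing L] [LieAlgebra ℂ L]

/-- `V = ⊕_j V_j` is a quasifinite (graded) module over the graded Lie algebra `L = ⊕_i L_i`:
`L_i V_j ⊆ V_{i+j}` and every `V_j` is finite-dimensional. -/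
structure IsQuasifinite (gr : ℤ → Submodule ℂ L) {V : Type*} [AddCommGroup V] [Module ℂ V]
    [LieRingModule L V] (grV : ℤ → Submodule ℂ V) : Prop where
  internal : DirectSum.IsInternal grV
  lie_mem : ∀ (i j : ℤ) (x : L) (v : V), x ∈ gr i → v ∈ grV j → ⁅x, v⁆ ∈ grV (i + j)
  finite : ∀ j, FiniteDimensional ℂ (grV j)

variable (gr : ℤ → Submodule ℂ L) (lam : Module.Dual ℂ (gr 0))

/-- The left ideal of `U(L)` generated by `L_+` and by `h - λ(h)`, `h ∈ L_0`. -/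
def vermaIdeal : Submodule (UniversalEnvelopingAlgebra ℂ L) (UniversalEnvelopingAlgebra ℂ L) :=
  Submodule.span _
    ({u | ∃ j : ℤ, 0 < j ∧ ∃ x ∈ gr j, u = UniversalEnvelopingAlgebra.ι ℂ x} ∪
     {u | ∃ h : gr 0, u = UniversalEnvelopingAlgebra.ι ℂ (h : L) -
        algebraMap ℂ (UniversalEnvelopingAlgebra ℂ L) (lam h)})

/-- The Verma module `M(L, λ) = U(L) ⊗_{U(L_0 ⊕ L_+)} ℂ_λ`, as the quotient of `U(L)` by the left
ideal generated by the kernel of the character of `L_0 ⊕ L_+`. -/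
def Verma : Type _ := UniversalEnvelopingAlgebra ℂ L ⧸ vermaIdeal gr lam

namespace Verma

instance : AddCommGroup (Verma gr lam) :=
  inferInstanceAs (AddCommGroup (UniversalEnvelopingAlgebra ℂ L ⧸ vermaIdeal gr lam))
instance : Module (UniversalEnvelopingAlgebra ℂ L) (Verma gr lam) :=
  inferInstanceAs (Module _ (UniversalEnvelopingAlgebra ℂ L ⧸ vermaIdeal gr lam))
instance : Module ℂ (Verma gr lam) :=
  inferInstanceAs (Module ℂ (UniversalEnvelopingAlgebra ℂ L ⧸ vermaIdeal gr lam))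
instance : IsScalarTower ℂ (UniversalEnvelopingAlgebra ℂ L) (Verma gr lam) :=
  inferInstanceAs (IsScalarTower ℂ (UniversalEnvelopingAlgebra ℂ L)
    (UniversalEnvelopingAlgebra ℂ L ⧸ vermaIdeal gr lam))

/-- The action of `L` is induced by left multiplication in `U(L)`. -/
instance : LieRingModule L (Verma gr lam) where
  bracket x v := UniversalEnvelopingAlgebra.ι ℂ x • v
  add_lie x y v := by
    rw [map_add, add_smul]
  lie_add x v w := smul_add _ v w
  leibniz_lie x y v := by
    change UniversalEnvelopingAlgebra.ι ℂ x • UniversalEnvelopingAlgebra.ι ℂ y • v =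
      UniversalEnvelopingAlgebra.ι ℂ ⁅x, y⁆ • v +
        UniversalEnvelopingAlgebra.ι ℂ y • UniversalEnvelopingAlgebra.ι ℂ x • v
    rw [LieHom.map_lie, LieRing.of_associative_ring_bracket, sub_smul, mul_smul, mul_smul,
      sub_add_cancel]

instance : LieModule ℂ L (Verma gr lam) where
  smul_lie c x v := by
    change UniversalEnvelopingAlgebra.ι ℂ (c • x) • v = c • (UniversalEnvelopingAlgebra.ι ℂ x • v)
    rw [map_smul, smul_assoc]
  lie_smul c x v := by
    change UniversalEnvelopingAlgebra.ι ℂ x • c • v = c • (UniversalEnvelopingAlgebra.ι ℂ x • v)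
    rw [← algebraMap_smul (UniversalEnvelopingAlgebra ℂ L) c v,
      ← algebraMap_smul (UniversalEnvelopingAlgebra ℂ L) c, ← mul_smul, ← mul_smul,
      Algebra.commutes]

/-- The component `M(L, λ)_j`, spanned by the classes of the products `x_1 ⋯ x_n` with
`x_i ∈ L_{d_i}` and `d_1 + ⋯ + d_n = j`. -/
def grading (j : ℤ) : Submodule ℂ (Verma gr lam) :=
  Submodule.span ℂ {v | ∃ l : List (ℤ × L), (∀ p ∈ l, p.2 ∈ gr p.1) ∧
    (l.map Prod.fst).sum = j ∧
    v = (vermaIdeal gr lam).mkQ (l.map fun p => UniversalEnvelopingAlgebra.ι ℂ p.2).prod}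

/-- A submodule `N` of the Verma module is graded if `N = ⊕_j (N ∩ M_j)`. -/
def IsGraded (N : LieSubmodule ℂ L (Verma gr lam)) : Prop :=
  N.toSubmodule ≤ ⨆ j, N.toSubmodule ⊓ grading gr lam j

/-- The maximal proper graded submodule: the sum of all proper graded submodules. -/
def maxGraded : LieSubmodule ℂ L (Verma gr lam) :=
  sSup {N | IsGraded gr lam N ∧ N ≠ ⊤}

end Verma

/-- The irreducible highest weight module `L(L, λ)`: the quotient of the Verma module by its maximal
proper graded submodule. -/
abbrev IrrHW : Type _ := Verma gr lam ⧸ Verma.maxGraded gr lam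

/-- The induced gradation of the irreducible highest weight module. -/
def IrrHW.grading (j : ℤ) : Submodule ℂ (IrrHW gr lam) :=
  (Verma.grading gr lam j).map (LieSubmodule.Quotient.mk' (Verma.maxGraded gr lam)).toLinearMap

/-- `L(L, λ)` is quasifinite. -/
def QuasifiniteWeight : Prop := IsQuasifinite gr (IrrHW.grading gr lam)

end Graded

/-! ### Restriction along a homomorphism and outer tensor products -/

section Restrict

variable {L L' : Type*} [LieRing L] [LieAlgebra ℂ L] [LieRing L'] [LieAlgebra ℂ L']

/-- An `L'`-module viewed as an `L`-module through a homomorphism `L → L'`. -/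
def Restrict (_f : L →ₗ⁅ℂ⁆ L') (V : Type*) : Type _ := V

variable (f : L →ₗ⁅ℂ⁆ L') (V : Type*) [AddCommGroup V] [Module ℂ V] [LieRingModule L' V]

instance : AddCommGroup (Restrict f V) := inferInstanceAs (AddCommGroup V)
instance : Module ℂ (Restrict f V) := inferInstanceAs (Module ℂ V)
instance : LieRingModule L (Restrict f V) := LieRingModule.compLieHom V f
instance [LieModule ℂ L' V] : LieModule ℂ L (Restrict f V) := LieModule.compLieHom V f

/-- The identity map, from an `L'`-module to its restriction. -/
def Restrict.of : V ≃ₗ[ℂ] Restrict f V := LinearEquiv.refl ℂ V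

lemma Restrict.lie_of (x : L) (v : V) : ⁅x, Restrict.of f V v⁆ = Restrict.of f V ⁅f x, v⁆ := rfl

end Restrict

section Tensor

open scoped TensorProduct

attribute [local instance] LieRing.ofAssociativeRing

variable {ι : Type*} [DecidableEq ι] (g : ι → Type*) [∀ i, LieRing (g i)]
  [∀ i, LieAlgebra ℂ (g i)] (V : ι → Type*) [∀ i, AddCommGroup (V i)] [∀ i, Module ℂ (V i)]
  [∀ i, LieRingModule (g i) (V i)] [∀ i, LieModule ℂ (g i) (V i)]

/-- The endomorphism `1 ⊗ ⋯ ⊗ a ⊗ ⋯ ⊗ 1`, with `a` in the `i`-th slot. -/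
def slot (i : ι) : Module.End ℂ (V i) →ₗ[ℂ] Module.End ℂ (⨂[ℂ] i, V i) where
  toFun a := PiTensorProduct.map (Function.update (fun _ => LinearMap.id) i a)
  map_add' a b := PiTensorProduct.map_update_add _ i a b
  map_smul' c a := PiTensorProduct.map_update_smul _ i c a

lemma slot_mul (i : ι) (a b : Module.End ℂ (V i)) : slot V i (a * b) = slot V i a * slot V i b := by
  have h := map_mul (PiTensorProduct.mapMonoidHom (R := ℂ) (s := V)) (Pi.mulSingle i a)
    (Pi.mulSingle i b)
  rw [← Pi.mulSingle_mul] at h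
  exact h

lemma slot_commute {i j : ι} (h : i ≠ j) (a : Module.End ℂ (V i)) (b : Module.End ℂ (V j)) :
    slot V i a * slot V j b = slot V j b * slot V i a :=
  ((Pi.mulSingle_commute (f := fun i => Module.End ℂ (V i)) h a b).map
    (PiTensorProduct.mapMonoidHom (R := ℂ) (s := V))).eq

variable [Fintype ι]

/-- The action of `⊕ g_i` on `⊗ V_i`: `x` acts by `∑_i 1 ⊗ ⋯ ⊗ x_i ⊗ ⋯ ⊗ 1`. -/
def tensorAction : (∀ i, g i) →ₗ[ℂ] Module.End ℂ (⨂[ℂ] i, V i) :=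
  ∑ i, (slot V i) ∘ₗ (LieModule.toEnd ℂ (g i) (V i)).toLinearMap ∘ₗ LinearMap.proj i

lemma tensorAction_apply (x : ∀ i, g i) :
    tensorAction g V x = ∑ i, slot V i (LieModule.toEnd ℂ (g i) (V i) (x i)) := by
  simp [tensorAction]

lemma tensorAction_lie (x y : ∀ i, g i) :
    tensorAction g V ⁅x, y⁆ =
      tensorAction g V x * tensorAction g V y - tensorAction g V y * tensorAction g V x := by
  simp only [tensorAction_apply, Finset.sum_mul_sum]
  rw [Finset.sum_comm (f := fun i j => slot V i (LieModule.toEnd ℂ (g i) (V i) (y i)) *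
    slot V j (LieModule.toEnd ℂ (g j) (V j) (x j))), ← Finset.sum_sub_distrib]
  refine Finset.sum_congr rfl fun i _ => ?_
  rw [← Finset.sum_sub_distrib, Finset.sum_eq_single i]
  · rw [← slot_mul, ← slot_mul, ← map_sub]
    exact congrArg _ (LieHom.map_lie (LieModule.toEnd ℂ (g i) (V i)) (x i) (y i))
  · intro j _ hj
    rw [slot_commute V hj.symm, sub_self]
  · simp

instance : LieRingModule (∀ i, g i) (⨂[ℂ] i, V i) where
  bracket x v := tensorAction g V x v
  add_lie x y v := by
    change tensorAction g V (x + y) v = _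
    rw [map_add]; rfl
  lie_add x v w := map_add _ v w
  leibniz_lie x y v := by
    change tensorAction g V x (tensorAction g V y v) = tensorAction g V ⁅x, y⁆ v +
      tensorAction g V y (tensorAction g V x v)
    rw [tensorAction_lie, LinearMap.sub_apply, Module.End.mul_apply, Module.End.mul_apply,
      sub_add_cancel]

instance : LieModule ℂ (∀ i, g i) (⨂[ℂ] i, V i) where
  smul_lie c x v := by
    change tensorAction g V (c • x) v = c • tensorAction g V x v
    rw [map_smul]; rfl
  lie_smul c x v := map_smul (tensorAction g V x) c v

end Tensor

open scoped TensorProduct in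
/-- The `𝔤_{s⃗}`-module `L(𝔤_{s⃗}, λ⃗) = ⊗_i L(𝔤_{s_i}, λ_i)`. -/
abbrev TensorHW {m : ℕ} (s : Fin m → ℂ) (lam : ∀ i, Module.Dual ℂ (gsGrading (s i) 0)) : Type :=
  ⨂[ℂ] i, IrrHW (gsGrading (s i)) (lam i)

/-- The conditions on `s⃗`: `s_i - s_j ∉ ℤ` for `i ≠ j`, and `0 ≤ Re s_i < 1`. -/
def Admissible {m : ℕ} (s : Fin m → ℂ) : Prop :=
  (∀ i j, i ≠ j → ∀ k : ℤ, s i - s j ≠ k) ∧ ∀ i, 0 ≤ (s i).re ∧ (s i).re < 1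

/-! ### Labels of highest weights of `W_∞` -/

/-- The element `D^l D` of the degree zero part of `W_∞`. -/
def diagElt (l : ℕ) : wGrading 0 :=
  ⟨⟨W1Inf.mk (DiffOp.single 0 (X ^ l * X)) 0, fun k => by
      change X ∣ (DiffOp.single 0 (X ^ l * X)).coeff k
      rw [DiffOp.coeff_single]
      split_ifs
      · exact dvd_mul_left _ _
      · exact dvd_zero _⟩,
    fun k hk => by
      change (DiffOp.single 0 (X ^ l * X)).coeff k = 0
      rw [DiffOp.coeff_single, if_neg (Ne.symm hk)],
    fun _ => rfl⟩

/-- The generating series `Δ_λ(x) = ∑_l Δ_l x^l / l!` of the labels `Δ_l = -λ(D^l D)`. -/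
def deltaSeries (lam : Module.Dual ℂ (wGrading 0)) : PowerSeries ℂ :=
  PowerSeries.mk fun l => -lam (diagElt l) / (l.factorial : ℂ)

/-- `φ` is a series `φ_λ` attached to `λ`: `φ(0) = 0` and `Δ_λ(x) = d/dx (φ(x)/(e^x - 1))`. -/
def IsPhi (lam : Module.Dual ℂ (wGrading 0)) (phi : PowerSeries ℂ) : Prop :=
  PowerSeries.constantCoeff phi = 0 ∧
    deltaSeries lam = PowerSeries.derivative ℂ (divExpSubOne phi)

/-- `φ_λ(x) = ∑_i n_i e^{r_i x}` for some complex `n_i`, `r_i`. -/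
def HasExponentialPhi (lam : Module.Dual ℂ (wGrading 0)) : Prop :=
  ∃ (p : ℕ) (n r : Fin p → ℂ), IsPhi lam (∑ i, n i • expSeries (r i))

end WInfty

end

open WInfty

noncomputable section

namespace WInfty

/-! ### Subspaces stable under a diagonalizable operator -/

section Eigen

variable {V : Type*} [AddCommGroup V] [Module ℂ V]

/-! Both gradations are inner: the degree is, up to a shift, the eigenvalue of `D` or of its image.
Hence submodules split into homogeneous components, and in a highest weight module the top component
is spanned by the highest weight vector. The needed part of the triangular decomposition is
`InnerGraded.exists_lieSubmodule_le`; only the non-vanishing of Verma modules requires building an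
induced module, on `U(n)` (`one_notMem_span`).

Submodules. A homogeneous element of `𝔤_s⃗` of degree `k ≠ 0` is a family of arbitrary sequences
`ξ_i(j)`, while `W_∞` supplies only the sequences `q(s_i - j)` with one polynomial `q` vanishing at
0. On a quasifinite module the difference is invisible to any given vector. A finite-dimensional
component is killed by some non-zero polynomial band, and bracketing with diagonal elements
multiplies that band by any sequence. So the action on a vector depends only on the values of `ξ` at
the finitely many places where a certain polynomial vanishes, and these values can be interpolated,
since admissibility makes the relevant points `s_i - j` distinct (`exists_phiHatVec_lie_eq`).
Finally `𝔤_s` is generated by its elements of non-zero degree (`eq_top_of_gsGrading_le`).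

Tensor products. A homogeneous vector of maximal degree in a non-zero submodule is singular in every
slot, hence a multiple of the tensor product of the highest weight vectors (`tensor_isIrreducible`).
Together with the statement on submodules this gives irreducibility over `W_∞`, and
`IsHighestWeight.nonempty_equiv` identifies the module.

Weights. On degree zero everything is expressed by the functionals `κ_r`, which satisfy `κ_r(q) -
κ_{r+1}(q) = q(r)`: an exponential `φ_λ` means that `λ(q(D))` is a finite combination of values
`κ_r(q)`. If `L(𝔤_s, λ)` is quasifinite, almost all lowering matrix units kill the highest weight
vector, and writing `φ̂_s(q(D))` as a bracket of a raising and a lowering band yields such a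
combination (`QuasifiniteWeight.exists_kappa`). Conversely `κ_{s-j}` is the pullback of the weight
`gsChi s j`, which involves finitely many diagonal entries and `C`; combinations of such weights are
quasifinite (`quasifiniteWeight_of_gsOff`), and grouping the exponents modulo `ℤ` gives an
admissible `s⃗`. -/

lemma aeval_eigenspace (T : Module.End ℂ V) {μ : ℂ} {u : V} (hu : u ∈ T.eigenspace μ) (q : ℂ[X]) :
    aeval T q u = q.eval μ • u := by
  by_cases h : u = 0
  · simp [h]
  · exact Module.End.aeval_apply_of_hasEigenvector ⟨hu, h⟩

lemma aeval_mem_of_stable (T : Module.End ℂ V) (N : Submodule ℂ V) (hN : ∀ u ∈ N, T u ∈ N)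
    (q : ℂ[X]) {u : V} (hu : u ∈ N) : aeval T q u ∈ N := by
  induction q using Polynomial.induction_on' with
  | add p q hp hq => simpa using N.add_mem hp hq
  | monomial n a =>
    rw [aeval_monomial]
    have : ∀ n : ℕ, (T ^ n) u ∈ N := by
      intro n
      induction n with
      | zero => simpa using hu
      | succ n ih => rw [pow_succ']; exact hN _ ih
    simpa using N.smul_mem a (this n)

lemma iSupIndep_of_le_eigenspace (T : Module.End ℂ V) (μ : ℂ) (e : ℤ → Submodule ℂ V)
    (he : ∀ j, e j ≤ T.eigenspace (μ + j)) : iSupIndep e :=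
  ((Module.End.eigenspaces_iSupIndep T).comp (f := fun j : ℤ => μ + (j : ℂ))
    fun a b h => by simpa using h).mono he

lemma isInternal_of_le_eigenspace (T : Module.End ℂ V) (μ : ℂ) (e : ℤ → Submodule ℂ V)
    (he : ∀ j, e j ≤ T.eigenspace (μ + j)) (hs : ⨆ j, e j = ⊤) : DirectSum.IsInternal e :=
  DirectSum.isInternal_submodule_of_iSupIndep_of_iSup_eq_top
    (iSupIndep_of_le_eigenspace T μ e he) hs

/-- A stable subspace contains the homogeneous components of its elements. -/
lemma le_iSup_inf_of_stable (T : Module.End ℂ V) (μ : ℂ) (e : ℤ → Submodule ℂ V)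
    (he : ∀ j, e j ≤ T.eigenspace (μ + j)) (hs : ⨆ j, e j = ⊤) (N : Submodule ℂ V)
    (hN : ∀ u ∈ N, T u ∈ N) : N ≤ ⨆ j, N ⊓ e j := by
  intro u hu
  have hu' : u ∈ ⨆ j, e j := hs ▸ Submodule.mem_top
  obtain ⟨f, hf, rfl⟩ := (Submodule.mem_iSup_iff_exists_finsupp _ _).1 hu'
  refine Submodule.sum_mem _ fun j hj => Submodule.mem_iSup_of_mem j ⟨?_, hf j⟩
  -- The projection to the `j`-th component acts on `u` as a polynomial in `T`, namely the Lagrange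
  -- polynomial that is 1 at the `j`-th eigenvalue and 0 at the others that occur.
  let q : ℂ[X] := Lagrange.basis f.support (fun i : ℤ => μ + (i : ℂ)) j
  have hinj : Set.InjOn (fun i : ℤ => μ + (i : ℂ)) f.support := fun a _ b _ h => by simpa using h
  have hq1 : q.eval (μ + (j : ℂ)) = 1 := Lagrange.eval_basis_self hinj hj
  have hq0 : ∀ i ∈ f.support, i ≠ j → q.eval (μ + (i : ℂ)) = 0 := fun i hi hij =>
    Lagrange.eval_basis_of_ne (v := fun i : ℤ => μ + (i : ℂ)) hij.symm hi
  have hq : aeval T q (∑ i ∈ f.support, f i) = f j := by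
    rw [map_sum, Finset.sum_eq_single j]
    · rw [aeval_eigenspace T (he j (hf j)), hq1, one_smul]
    · intro i hi hij
      rw [aeval_eigenspace T (he i (hf i)), hq0 i hi hij, zero_smul]
    · intro h; exact absurd hj h
  have h := aeval_mem_of_stable T N hN q hu
  rwa [Finsupp.sum, hq] at h

/-- A family of subspaces of the eigenspaces which spans exhausts them. -/
lemma eq_eigenspace_of_iSup_eq_top (T : Module.End ℂ V) (μ : ℂ) (e : ℤ → Submodule ℂ V)
    (he : ∀ j, e j ≤ T.eigenspace (μ + j)) (hs : ⨆ j, e j = ⊤) (j : ℤ) :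
    e j = T.eigenspace (μ + j) := by
  refine le_antisymm (he j) fun u hu => ?_
  have hu' : u ∈ ⨆ i, e i := hs ▸ Submodule.mem_top
  have hsplit : (⨆ i, e i) ≤ e j ⊔ ⨆ (i : ℤ) (_ : i ≠ j), e i := by
    refine iSup_le fun i => ?_
    by_cases h : i = j
    · exact h ▸ le_sup_left
    · exact le_sup_of_le_right (le_iSup₂_of_le i h le_rfl)
  replace hu' := hsplit hu'
  obtain ⟨a, ha, b, hb, rfl⟩ := Submodule.mem_sup.1 hu'
  -- The remainder `b` lies in the `j`-th eigenspace and also in the sum of the others, so it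
  -- vanishes.
  have hb1 : b ∈ T.eigenspace (μ + j) := by
    have := Submodule.sub_mem _ hu (he j ha)
    simpa using this
  have hb2 : b ∈ ⨆ (i : ℤ) (_ : i ≠ j), T.eigenspace (μ + i) :=
    (iSup₂_mono fun i _ => he i) hb
  have hi := iSupIndep_of_le_eigenspace T μ (fun j : ℤ => T.eigenspace (μ + (j : ℂ)))
    (fun _ => le_rfl) j
  have : b = 0 := by
    have := hi.le_bot ⟨hb1, hb2⟩
    simpa using this
  simpa [this] using ha

end Eigen


/-! ### Graded Lie algebras with an inner gradation and their highest weight modules -/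

section HighestWeight

variable {L : Type*} [LieRing L] [LieAlgebra ℂ L]

/-- A gradation with commutative degree zero part which is given by the adjoint action of an
element `d`. -/
structure InnerGraded (gr : ℤ → Submodule ℂ L) (d : L) : Prop where
  iSup_eq_top : ⨆ j, gr j = ⊤
  lie_mem : ∀ i j x y, x ∈ gr i → y ∈ gr j → ⁅x, y⁆ ∈ gr (i + j)
  comm : ∀ x y, x ∈ gr 0 → y ∈ gr 0 → ⁅x, y⁆ = 0
  mem_zero : d ∈ gr 0
  lie_eq : ∀ j x, x ∈ gr j → ⁅d, x⁆ = (j : ℂ) • x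

variable {V : Type*} [AddCommGroup V] [Module ℂ V] [LieRingModule L V]

lemma lie_mem_of_homogeneous {gr : ℤ → Submodule ℂ L} (hg : ⨆ j, gr j = ⊤) (P : Submodule ℂ V)
    {u : V} (h : ∀ j, ∀ x ∈ gr j, ⁅x, u⁆ ∈ P) (x : L) : ⁅x, u⁆ ∈ P := by
  have hx : x ∈ ⨆ j, gr j := hg ▸ Submodule.mem_top
  induction hx using Submodule.iSup_induction' with
  | mem j x hx => exact h j x hx
  | zero => simp
  | add x y _ _ hx hy => rw [add_lie]; exact P.add_mem hx hy

variable [LieModule ℂ L V]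

/-- The vector `v` generates `V` and is a highest weight vector of weight `lam`. -/
structure IsHighestWeight (gr : ℤ → Submodule ℂ L) (lam : Module.Dual ℂ (gr 0)) (v : V) :
    Prop where
  lie_zero : ∀ h : gr 0, ⁅(h : L), v⁆ = lam h • v
  lie_pos : ∀ j : ℤ, 0 < j → ∀ x ∈ gr j, ⁅x, v⁆ = 0
  generates : ∀ N : LieSubmodule ℂ L V, v ∈ N → N = ⊤

variable (V) in
/-- The eigenspace of `d` for the eigenvalue `μ + j`. -/
def wt (d : L) (μ : ℂ) (j : ℤ) : Submodule ℂ V :=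
  (LieModule.toEnd ℂ L V d).eigenspace (μ + j)

lemma mem_wt {d : L} {μ : ℂ} {j : ℤ} {u : V} : u ∈ wt V d μ j ↔ ⁅d, u⁆ = (μ + j) • u := by
  rw [wt, Module.End.mem_eigenspace_iff, LieModule.toEnd_apply_apply]

variable {gr : ℤ → Submodule ℂ L} {d : L}

lemma InnerGraded.lie_mem_wt (hg : InnerGraded gr d) {μ : ℂ} {i j : ℤ} {x : L} {u : V}
    (hx : x ∈ gr i) (hu : u ∈ wt V d μ j) : ⁅x, u⁆ ∈ wt V d μ (i + j) := by
  rw [mem_wt] at hu ⊢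
  rw [leibniz_lie, hg.lie_eq i x hx, hu, smul_lie, lie_smul, ← add_smul]
  congr 1
  push_cast
  ring

lemma wt_iSupIndep (d : L) (μ : ℂ) : iSupIndep (wt V d μ) :=
  iSupIndep_of_le_eigenspace (LieModule.toEnd ℂ L V d) μ _ fun _ => le_rfl

/-- Let `S` be a subspace stable under the degree zero part and killed by the positive part. If `Q`
contains `S` and is stable under the negative part, then `Q` contains a submodule containing `S`. -/
lemma InnerGraded.exists_lieSubmodule_le (hg : InnerGraded gr d) (S Q : Submodule ℂ V)
    (h0 : ∀ x ∈ gr 0, ∀ u ∈ S, ⁅x, u⁆ ∈ S) (hp : ∀ j : ℤ, 0 < j → ∀ x ∈ gr j, ∀ u ∈ S, ⁅x, u⁆ = 0)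
    (hSQ : S ≤ Q) (hQ : ∀ j : ℤ, j < 0 → ∀ x ∈ gr j, ∀ u ∈ Q, ⁅x, u⁆ ∈ Q) :
    ∃ N : LieSubmodule ℂ L V, S ≤ N.toSubmodule ∧ N.toSubmodule ≤ Q := by
  let F : Set (Submodule ℂ V) :=
    {P | S ≤ P ∧ ∀ j : ℤ, j < 0 → ∀ x ∈ gr j, ∀ u ∈ P, ⁅x, u⁆ ∈ P}
  let N : Submodule ℂ V := sInf F
  have hSN : S ≤ N := le_sInf fun P hP => hP.1
  have hneg : ∀ j : ℤ, j < 0 → ∀ x ∈ gr j, ∀ u ∈ N, ⁅x, u⁆ ∈ N := by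
    intro j hj x hx u hu
    rw [Submodule.mem_sInf] at hu ⊢
    exact fun P hP => hP.2 j hj x hx u (hu P hP)
  -- `N` is the least subspace containing `S` and stable under the negative part. By minimality it
  -- suffices that `N'`, the vectors whose images under non-negative degrees stay in `N`, belongs to
  -- the same family.
  let N' : Submodule ℂ V :=
    { carrier := {u | u ∈ N ∧ ∀ j : ℤ, 0 ≤ j → ∀ x ∈ gr j, ⁅x, u⁆ ∈ N}
      zero_mem' := ⟨N.zero_mem, fun j _ x _ => by simp⟩
      add_mem' := fun {a b} ha hb => ⟨N.add_mem ha.1 hb.1, fun j hj x hx => by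
        rw [lie_add]; exact N.add_mem (ha.2 j hj x hx) (hb.2 j hj x hx)⟩
      smul_mem' := fun c a ha => ⟨N.smul_mem c ha.1, fun j hj x hx => by
        rw [lie_smul]; exact N.smul_mem c (ha.2 j hj x hx)⟩ }
  have hN' : N ≤ N' := by
    refine sInf_le ⟨fun u hu => ⟨hSN hu, fun j hj x hx => ?_⟩, fun j hj y hy u hu => ?_⟩
    · rcases hj.eq_or_lt with rfl | hj
      · exact hSN (h0 x hx u hu)
      · rw [hp j hj x hx u hu]; exact N.zero_mem
    · refine ⟨hneg j hj y hy u hu.1, fun i hi x hx => ?_⟩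
      rw [leibniz_lie]
      refine N.add_mem ?_ (hneg j hj y hy _ (hu.2 i hi x hx))
      -- Moving `x` past `y` leaves `⁅x, y⁆`, of degree `i + j`; either sign is covered, by the
      -- stability of `N` or by the defining property of `N'`.
      rcases lt_or_ge (i + j) 0 with h | h
      · exact hneg _ h _ (hg.lie_mem i j x y hx hy) u hu.1
      · exact hu.2 _ h _ (hg.lie_mem i j x y hx hy)
  refine ⟨{ N with lie_mem := fun {x u} hu => ?_ }, hSN, sInf_le ⟨hSQ, hQ⟩⟩
  refine lie_mem_of_homogeneous hg.iSup_eq_top N (fun j x hx => ?_) x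
  rcases lt_or_ge j 0 with h | h
  · exact hneg j h x hx u hu
  · exact (hN' hu).2 j h x hx

namespace IsHighestWeight

variable {lam : Module.Dual ℂ (gr 0)} {v : V}

lemma mem_wt_zero (hv : IsHighestWeight gr lam v) (hd : d ∈ gr 0) : v ∈ wt V d (lam ⟨d, hd⟩) 0 := by
  rw [mem_wt]
  simpa using hv.lie_zero ⟨d, hd⟩

/-- The left side contains `v` and is stable under the negative part, so it contains a submodule
through `v`, which is everything. -/
lemma span_sup_eq_top (hv : IsHighestWeight gr lam v) (hg : InnerGraded gr d) :
    Submodule.span ℂ {v} ⊔ ⨆ (j : ℤ) (_ : j < 0), wt V d (lam ⟨d, hg.mem_zero⟩) j = ⊤ := by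
  obtain ⟨N, hSN, hNQ⟩ := hg.exists_lieSubmodule_le (Submodule.span ℂ {v})
    (Submodule.span ℂ {v} ⊔ ⨆ (j : ℤ) (_ : j < 0), wt V d (lam ⟨d, hg.mem_zero⟩) j)
    (fun x hx u hu => by
      obtain ⟨c, rfl⟩ := Submodule.mem_span_singleton.1 hu
      rw [lie_smul, hv.lie_zero ⟨x, hx⟩]
      exact Submodule.smul_mem _ _ (Submodule.smul_mem _ _ (Submodule.mem_span_singleton_self v)))
    (fun j hj x hx u hu => by
      obtain ⟨c, rfl⟩ := Submodule.mem_span_singleton.1 hu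
      rw [lie_smul, hv.lie_pos j hj x hx, smul_zero])
    le_sup_left
    (fun j hj x hx u hu => by
      refine Submodule.mem_sup_right ?_
      obtain ⟨a, ha, b, hb, rfl⟩ := Submodule.mem_sup.1 hu
      rw [lie_add]
      refine Submodule.add_mem _ ?_ ?_
      · obtain ⟨c, rfl⟩ := Submodule.mem_span_singleton.1 ha
        have h := hg.lie_mem_wt hx (Submodule.smul_mem _ c (hv.mem_wt_zero hg.mem_zero))
        rw [add_zero] at h
        exact Submodule.mem_iSup_of_mem j (Submodule.mem_iSup_of_mem hj h)
      · have key : (⨆ (j : ℤ) (_ : j < 0), wt V d (lam ⟨d, hg.mem_zero⟩) j) ≤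
            (⨆ (j : ℤ) (_ : j < 0), wt V d (lam ⟨d, hg.mem_zero⟩) j).comap
              (LieModule.toEnd ℂ L V x) := by
          refine iSup₂_le fun i hi w hw => ?_
          exact Submodule.mem_iSup_of_mem (j + i) (Submodule.mem_iSup_of_mem (by omega)
            (hg.lie_mem_wt hx hw))
        exact key hb)
  have hN := hv.generates N (hSN (Submodule.mem_span_singleton_self v))
  rw [hN] at hNQ
  exact top_le_iff.1 hNQ

lemma iSup_wt_eq_top (hv : IsHighestWeight gr lam v) (hg : InnerGraded gr d) :
    ⨆ j, wt V d (lam ⟨d, hg.mem_zero⟩) j = ⊤ := by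
  refine top_le_iff.1 ?_
  rw [← hv.span_sup_eq_top hg]
  refine sup_le ?_ (iSup₂_le fun j _ => le_iSup (wt V d (lam ⟨d, hg.mem_zero⟩)) j)
  rw [Submodule.span_singleton_le_iff_mem]
  exact Submodule.mem_iSup_of_mem 0 (hv.mem_wt_zero hg.mem_zero)

/-- The family on the right already spans `V` and consists of subspaces of eigenspaces for distinct
eigenvalues, so it exhausts them. -/
lemma wt_eq (hv : IsHighestWeight gr lam v) (hg : InnerGraded gr d) (j : ℤ) :
    wt V d (lam ⟨d, hg.mem_zero⟩) j = if j < 0 then wt V d (lam ⟨d, hg.mem_zero⟩) j else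
      if j = 0 then Submodule.span ℂ {v} else ⊥ := by
  symm
  refine eq_eigenspace_of_iSup_eq_top (LieModule.toEnd ℂ L V d) (lam ⟨d, hg.mem_zero⟩)
    (fun j => if j < 0 then wt V d (lam ⟨d, hg.mem_zero⟩) j else
      if j = 0 then Submodule.span ℂ {v} else ⊥) ?_ ?_ j
  · intro j
    split_ifs with h1 h2
    · exact le_rfl
    · rw [Submodule.span_singleton_le_iff_mem, h2]
      exact hv.mem_wt_zero hg.mem_zero
    · exact bot_le
  · refine top_le_iff.1 ?_
    rw [← hv.span_sup_eq_top hg]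
    refine sup_le (le_iSup_of_le 0 (by simp)) (iSup₂_le fun j hj => le_iSup_of_le j ?_)
    rw [if_pos hj]

lemma wt_zero (hv : IsHighestWeight gr lam v) (hg : InnerGraded gr d) :
    wt V d (lam ⟨d, hg.mem_zero⟩) 0 = Submodule.span ℂ {v} := by
  rw [hv.wt_eq hg]; simp

lemma wt_pos (hv : IsHighestWeight gr lam v) (hg : InnerGraded gr d) {j : ℤ}
    (hj : 0 < j) : wt V d (lam ⟨d, hg.mem_zero⟩) j = ⊥ := by
  rw [hv.wt_eq hg, if_neg (by omega), if_neg (by omega)]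

lemma le_iSup_inf_wt (hv : IsHighestWeight gr lam v) (hg : InnerGraded gr d)
    (N : LieSubmodule ℂ L V) :
    N.toSubmodule ≤ ⨆ j, N.toSubmodule ⊓ wt V d (lam ⟨d, hg.mem_zero⟩) j :=
  le_iSup_inf_of_stable (LieModule.toEnd ℂ L V d) (lam ⟨d, hg.mem_zero⟩) _ (fun _ => le_rfl)
    (hv.iSup_wt_eq_top hg) _ fun _ hu => N.lie_mem hu

/-- A proper submodule has no component in degree zero. -/
lemma le_iSup_ne_zero (hv : IsHighestWeight gr lam v) (hg : InnerGraded gr d)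
    {N : LieSubmodule ℂ L V} (hN : N ≠ ⊤) :
    N.toSubmodule ≤ ⨆ (j : ℤ) (_ : j ≠ 0), wt V d (lam ⟨d, hg.mem_zero⟩) j := by
  refine (hv.le_iSup_inf_wt hg N).trans (iSup_le fun j => ?_)
  by_cases hj : j = 0
  · subst hj
    rintro u ⟨hu1, hu2⟩
    rw [hv.wt_zero hg] at hu2
    obtain ⟨c, rfl⟩ := Submodule.mem_span_singleton.1 hu2
    by_cases hc : c = 0
    · simp [hc]
    · refine absurd (hv.generates N ?_) hN
      have := N.toSubmodule.smul_mem c⁻¹ hu1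
      rwa [smul_smul, inv_mul_cancel₀ hc, one_smul] at this
  · exact inf_le_right.trans (le_iSup₂_of_le j hj le_rfl)

lemma notMem_iSup_ne_zero (hv : IsHighestWeight gr lam v) (hg : InnerGraded gr d) (hv0 : v ≠ 0) :
    v ∉ ⨆ (j : ℤ) (_ : j ≠ 0), wt V d (lam ⟨d, hg.mem_zero⟩) j := fun h => hv0 <| by
  simpa using (wt_iSupIndep (V := V) d (lam ⟨d, hg.mem_zero⟩) 0).le_bot
    ⟨hv.mem_wt_zero hg.mem_zero, h⟩

/-- In an irreducible highest weight module the singular vectors are the multiples of `v`. -/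
lemma mem_span_of_singular (hv : IsHighestWeight gr lam v) (hg : InnerGraded gr d) (hv0 : v ≠ 0)
    [LieModule.IsIrreducible ℂ L V] {u : V}
    (hu : ∀ j : ℤ, 0 < j → ∀ x ∈ gr j, ⁅x, u⁆ = 0) : u ∈ Submodule.span ℂ {v} := by
  set μ := lam ⟨d, hg.mem_zero⟩ with hμ
  let S : Submodule ℂ V :=
    { carrier := {u | ∀ j : ℤ, 0 < j → ∀ x ∈ gr j, ⁅x, u⁆ = 0}
      zero_mem' := fun j _ x _ => by simp
      add_mem' := fun {a b} ha hb j hj x hx => by rw [lie_add, ha j hj x hx, hb j hj x hx, add_zero]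
      smul_mem' := fun c a ha j hj x hx => by rw [lie_smul, ha j hj x hx, smul_zero] }
  have hS0 : ∀ x ∈ gr 0, ∀ u ∈ S, ⁅x, u⁆ ∈ S := by
    intro x hx u hu j hj y hy
    rw [leibniz_lie, hu j hj y hy, _root_.lie_zero, add_zero]
    have := hg.lie_mem j 0 y x hy hx
    rw [add_zero] at this
    exact hu j hj _ this
  have hS := le_iSup_inf_of_stable (LieModule.toEnd ℂ L V d) μ (wt V d μ) (fun _ => le_rfl)
    (hv.iSup_wt_eq_top hg) S (fun u hu => hS0 d hg.mem_zero u hu)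
  -- A singular vector of negative degree would generate a submodule living in negative degrees
  -- only, which misses `v` and is therefore zero.
  have hneg : ∀ j : ℤ, j ≠ 0 → S ⊓ wt V d μ j = ⊥ := by
    intro j hj
    rcases lt_or_gt_of_ne hj with hj | hj
    · obtain ⟨N, hN1, hN2⟩ := hg.exists_lieSubmodule_le (S ⊓ wt V d μ j)
        (⨆ (j : ℤ) (_ : j < 0), wt V d μ j)
        (fun x hx u hu => ⟨hS0 x hx u hu.1, by
          have := hg.lie_mem_wt hx hu.2
          rwa [zero_add] at this⟩)
        (fun j hj x hx u hu => hu.1 j hj x hx)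
        (inf_le_right.trans (le_iSup₂_of_le j hj le_rfl))
        (fun k hk x hx u hu => by
          have key : (⨆ (j : ℤ) (_ : j < 0), wt V d μ j) ≤
              (⨆ (j : ℤ) (_ : j < 0), wt V d μ j).comap (LieModule.toEnd ℂ L V x) := by
            refine iSup₂_le fun i hi w hw => ?_
            exact Submodule.mem_iSup_of_mem (k + i) (Submodule.mem_iSup_of_mem (by omega)
              (hg.lie_mem_wt hx hw))
          exact key hu)
      have hbot : N = ⊥ := by
        by_contra hne
        have htop := (IsSimpleOrder.eq_bot_or_eq_top N).resolve_left hne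
        refine hv.notMem_iSup_ne_zero hg hv0 ?_
        have h1 : v ∈ N.toSubmodule := by rw [htop]; trivial
        exact (iSup₂_mono' fun i hi => ⟨i, hi.ne, le_rfl⟩ : (⨆ (j : ℤ) (_ : j < 0), wt V d μ j) ≤
          ⨆ (j : ℤ) (_ : j ≠ 0), wt V d μ j) (hN2 h1)
      rw [hbot] at hN1
      exact le_bot_iff.1 hN1
    · rw [hμ, hv.wt_pos hg hj, inf_bot_eq]
  have hle : S ≤ wt V d μ 0 := by
    refine hS.trans (iSup_le fun j => ?_)
    by_cases hj : j = 0
    · exact hj ▸ inf_le_right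
    · rw [hneg j hj]; exact bot_le
  have := hle hu
  rwa [hμ, hv.wt_zero hg] at this

end IsHighestWeight

end HighestWeight


/-! ### Induced modules of one-dimensional representations -/

section Induced

attribute [local instance] LieRing.ofAssociativeRing

variable {L : Type*} [LieRing L] [LieAlgebra ℂ L]

local notation "U" => UniversalEnvelopingAlgebra ℂ
local notation "ιU" => UniversalEnvelopingAlgebra.ι ℂ

/-- The universal property gives a homomorphism from `U(L)` to the subalgebra generated by `L`;
composed with the inclusion it is the identity on `L`, hence on `U(L)`, so the inclusion is onto. -/
lemma adjoin_range_ι : Algebra.adjoin ℂ (Set.range (ιU : L → U L)) = ⊤ := by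
  let S : Subalgebra ℂ (U L) := Algebra.adjoin ℂ (Set.range (ιU : L → U L))
  let f : L →ₗ⁅ℂ⁆ S :=
    { toFun := fun x => ⟨ιU x, Algebra.subset_adjoin ⟨x, rfl⟩⟩
      map_add' := fun x y => Subtype.ext (map_add _ x y)
      map_smul' := fun c x => Subtype.ext (map_smul _ c x)
      map_lie' := fun {x y} => Subtype.ext (LieHom.map_lie ιU x y) }
  have h : (Subalgebra.val S).comp (UniversalEnvelopingAlgebra.lift ℂ f) = AlgHom.id ℂ (U L) := by
    refine UniversalEnvelopingAlgebra.hom_ext ℂ (LieHom.ext fun x => ?_)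
    change (UniversalEnvelopingAlgebra.lift ℂ f (ιU x) : U L) = ιU x
    rw [UniversalEnvelopingAlgebra.lift_ι_apply]
    rfl
  refine Algebra.eq_top_iff.2 fun u => ?_
  have hu := congrArg (fun g : U L →ₐ[ℂ] U L => g u) h
  simp only [AlgHom.comp_apply, AlgHom.id_apply] at hu
  rw [← hu]
  exact (UniversalEnvelopingAlgebra.lift ℂ f u).2

/-- A subspace of `U(L)` containing `1` and stable under left multiplication by `L` is everything. -/
lemma eq_top_of_one_mem (P : Submodule ℂ (U L)) (h1 : 1 ∈ P) (hm : ∀ x : L, ∀ t ∈ P, ιU x * t ∈ P) :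
    P = ⊤ := by
  let S : Subalgebra ℂ (U L) :=
    { carrier := {u | ∀ t ∈ P, u * t ∈ P}
      mul_mem' := fun {a b} ha hb t ht => by rw [mul_assoc]; exact ha _ (hb t ht)
      add_mem' := fun {a b} ha hb t ht => by rw [add_mul]; exact P.add_mem (ha t ht) (hb t ht)
      algebraMap_mem' := fun c t ht => by rw [← Algebra.smul_def]; exact P.smul_mem c ht }
  have hS : S = ⊤ := by
    refine top_le_iff.1 ?_
    rw [← adjoin_range_ι]
    refine Algebra.adjoin_le ?_
    rintro _ ⟨x, rfl⟩
    exact hm x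
  refine Submodule.eq_top_iff'.2 fun u => ?_
  have : u ∈ S := hS ▸ Algebra.mem_top
  simpa using this 1 h1

instance : Nontrivial (U L) := by
  refine ⟨1, 0, fun h => ?_⟩
  have := congrArg (UniversalEnvelopingAlgebra.lift ℂ (0 : L →ₗ⁅ℂ⁆ ℂ)) h
  simp at this

variable {n b : LieSubalgebra ℂ L} (hc : IsCompl n.toSubmodule b.toSubmodule)

/-- The component in the first of two complementary subalgebras. -/
def projLeft : L →ₗ[ℂ] n := n.toSubmodule.projectionOnto b.toSubmodule hc

/-- The component in the second of two complementary subalgebras. -/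
def projRight : L →ₗ[ℂ] b := b.toSubmodule.projectionOnto n.toSubmodule hc.symm

lemma projLeft_coe (y : n) : projLeft hc y = y :=
  Submodule.projectionOnto_apply_left hc y

lemma projRight_coe (y : b) : projRight hc y = y :=
  Submodule.projectionOnto_apply_left hc.symm y

lemma projLeft_coe_right (y : b) : projLeft hc y = 0 :=
  Submodule.projectionOnto_apply_right hc y

lemma projRight_coe_left (y : n) : projRight hc y = 0 :=
  Submodule.projectionOnto_apply_right hc.symm y

lemma projLeft_add_projRight (x : L) : (projLeft hc x : L) + projRight hc x = x := by
  obtain ⟨a, ha, c, hc', rfl⟩ := Submodule.mem_sup.1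
    (show x ∈ n.toSubmodule ⊔ b.toSubmodule from hc.sup_eq_top ▸ Submodule.mem_top)
  have h1 := projLeft_coe hc ⟨a, ha⟩
  have h2 := projLeft_coe_right hc ⟨c, hc'⟩
  have h3 := projRight_coe hc ⟨c, hc'⟩
  have h4 := projRight_coe_left hc ⟨a, ha⟩
  simp only at h1 h2 h3 h4
  rw [map_add, map_add, h1, h2, h3, h4]
  simp

/-- The bracket `z ↦ [z, y]` of elements of `b` with an element of `n`. -/
def adRight (y : n) : b →ₗ[ℂ] L where
  toFun z := ⁅(z : L), (y : L)⁆
  map_add' z z' := by simp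
  map_smul' c z := by simp

/-- The operator by which `y ∈ n` acts on `U(n) × Hom(b, U(n))`. -/
def indOp (y : n) : Module.End ℂ (U n × (b →ₗ[ℂ] U n)) where
  toFun p := (ιU y * p.1,
    LinearMap.mulLeft ℂ (ιU y) ∘ₗ p.2 +
    LinearMap.mulRight ℂ p.1 ∘ₗ (ιU : n →ₗ⁅ℂ⁆ U n).toLinearMap ∘ₗ projLeft hc ∘ₗ adRight y +
    p.2 ∘ₗ projRight hc ∘ₗ adRight y)
  map_add' p q := by
    refine Prod.ext (mul_add _ _ _) (LinearMap.ext fun z => ?_)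
    simp [mul_add]
    abel
  map_smul' c p := by
    refine Prod.ext (mul_smul_comm _ _ _) (LinearMap.ext fun z => ?_)
    simp

lemma indOp_fst (y : n) (p : U n × (b →ₗ[ℂ] U n)) : (indOp hc y p).1 = ιU y * p.1 := rfl

lemma indOp_snd (y : n) (p : U n × (b →ₗ[ℂ] U n)) (z : b) :
    (indOp hc y p).2 z = ιU y * p.2 z + ιU (projLeft hc ⁅(z : L), (y : L)⁆) * p.1 +
      p.2 (projRight hc ⁅(z : L), (y : L)⁆) := rfl

lemma projLeft_lie (x : L) (y : n) :
    projLeft hc ⁅x, (y : L)⁆ = ⁅projLeft hc x, y⁆ + projLeft hc ⁅(projRight hc x : L), (y : L)⁆ := by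
  conv_lhs => rw [← projLeft_add_projRight hc x, add_lie, map_add]
  congr 1
  exact projLeft_coe hc ⁅projLeft hc x, y⁆

lemma projRight_lie (x : L) (y : n) :
    projRight hc ⁅x, (y : L)⁆ = projRight hc ⁅(projRight hc x : L), (y : L)⁆ := by
  conv_lhs => rw [← projLeft_add_projRight hc x, add_lie, map_add]
  rw [show projRight hc ⁅(projLeft hc x : L), (y : L)⁆ = 0 from
    projRight_coe_left hc ⁅projLeft hc x, y⁆, zero_add]

lemma ring_identity {A : Type*} [Ring A] (a a' c e e' f f' t p p' q q' : A) :
    (a * a' - a' * a) * c + ((e * a' - a' * e + f) - (e' * a - a * e' + f')) * t + (p - p') =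
      (a * (a' * c + e' * t + q') + e * (a' * t) + (a' * q + f * t + p)) -
        (a' * (a * c + e * t + q) + e' * (a * t) + (a * q' + f' * t + p')) := by
  noncomm_ring

/-- `indOp` encodes the rule `z (y t) = y (z t) + [z, y] t`, with `[z, y]` split into its components
in `n` and `b`; a pair `(t, p)` stands for a vector `t` together with the function `z ↦ z t`. The
Jacobi identity for `z, y, y'` makes this a representation of `n`. It therefore extends to `U(n)`,
and `z t` becomes well defined without any choice of a basis. -/
lemma indOp_lie (y y' : n) : indOp hc ⁅y, y'⁆ = ⁅indOp hc y, indOp hc y'⁆ := by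
  rw [LieRing.of_associative_ring_bracket]
  refine LinearMap.ext fun p => Prod.ext ?_ (LinearMap.ext fun z => ?_)
  · simp only [LinearMap.sub_apply, Module.End.mul_apply, Prod.fst_sub, indOp_fst]
    rw [LieHom.map_lie, LieRing.of_associative_ring_bracket, sub_mul, mul_assoc, mul_assoc]
  · simp only [LinearMap.sub_apply, Module.End.mul_apply, Prod.snd_sub, indOp_snd, indOp_fst]
    have hj : ⁅(z : L), ((⁅y, y'⁆ : n) : L)⁆ = ⁅⁅(z : L), (y : L)⁆, (y' : L)⁆ -
        ⁅⁅(z : L), (y' : L)⁆, (y : L)⁆ := by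
      rw [LieSubalgebra.coe_bracket, leibniz_lie, ← lie_skew (y : L) ⁅(z : L), (y' : L)⁆,
        sub_eq_add_neg]
    rw [hj, map_sub, map_sub, map_sub, map_sub, projLeft_lie hc ⁅(z : L), (y : L)⁆ y',
      projLeft_lie hc ⁅(z : L), (y' : L)⁆ y, projRight_lie hc ⁅(z : L), (y : L)⁆ y',
      projRight_lie hc ⁅(z : L), (y' : L)⁆ y]
    simp only [map_add, LieHom.map_lie, LieRing.of_associative_ring_bracket]
    exact ring_identity (A := U n) _ _ _ _ _ _ _ _ _ _ _ _

/-- The representation of `n` on `U(n) × Hom(b, U(n))`. -/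
def indRep : n →ₗ⁅ℂ⁆ Module.End ℂ (U n × (b →ₗ[ℂ] U n)) where
  toFun := indOp hc
  map_add' y y' := by
    refine LinearMap.ext fun p => Prod.ext ?_ (LinearMap.ext fun z => ?_)
    · simp [indOp_fst, add_mul]
    · simp only [LinearMap.add_apply, Prod.snd_add, indOp_snd]
      rw [show ((y + y' : n) : L) = (y : L) + y' from rfl, lie_add]
      simp only [map_add, add_mul]
      abel
  map_smul' c y := by
    refine LinearMap.ext fun p => Prod.ext ?_ (LinearMap.ext fun z => ?_)
    · simp [indOp_fst]
    · simp only [LinearMap.smul_apply, Prod.smul_snd, indOp_snd, RingHom.id_apply]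
      rw [show ((c • y : n) : L) = c • (y : L) from rfl, lie_smul]
      simp only [map_smul, smul_mul_assoc, smul_add]
  map_lie' {y y'} := indOp_lie hc y y'

variable (χ : b →ₗ[ℂ] ℂ)

/-- The functions `z ↦ z t` on `b`, for `t ∈ U(n)`. -/
def indFun : U n →ₗ[ℂ] (b →ₗ[ℂ] U n) where
  toFun t := (UniversalEnvelopingAlgebra.lift ℂ (indRep hc) t
    (1, (Algebra.linearMap ℂ (U n)) ∘ₗ χ)).2
  map_add' t t' := by simp
  map_smul' c t := by simp

/-- The first coordinate is moved by left multiplication, so the orbit of a pair with first entry 1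
is the graph of a function of `t`; this function is `indFun`. -/
lemma lift_indRep_fst (t : U n) (p : U n × (b →ₗ[ℂ] U n)) :
    (UniversalEnvelopingAlgebra.lift ℂ (indRep hc) t p).1 = t * p.1 := by
  have h : (⊤ : Submodule ℂ (U n)) ≤ LinearMap.eqLocus
      ((LinearMap.fst ℂ (U n) (b →ₗ[ℂ] U n)) ∘ₗ LinearMap.applyₗ p ∘ₗ
        (UniversalEnvelopingAlgebra.lift ℂ (indRep hc)).toLinearMap)
      (LinearMap.mulRight ℂ p.1) := by
    refine (eq_top_of_one_mem _ ?_ ?_).ge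
    · simp
    · intro y t ht
      rw [LinearMap.mem_eqLocus] at ht ⊢
      simp only [LinearMap.comp_apply, AlgHom.toLinearMap_apply, LinearMap.applyₗ_apply_apply,
        LinearMap.fst_apply, LinearMap.mulRight_apply, map_mul, Module.End.mul_apply,
        UniversalEnvelopingAlgebra.lift_ι_apply] at ht ⊢
      rw [mul_assoc, ← ht]
      rfl
  exact h (Submodule.mem_top (x := t))

lemma indFun_one (z : b) : indFun hc χ 1 z = algebraMap ℂ (U n) (χ z) := by
  simp [indFun]

lemma indFun_mul (y : n) (t : U n) (z : b) :
    indFun hc χ (ιU y * t) z = ιU y * indFun hc χ t z +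
      ιU (projLeft hc ⁅(z : L), (y : L)⁆) * t + indFun hc χ t (projRight hc ⁅(z : L), (y : L)⁆) := by
  have h := lift_indRep_fst hc t (1, (Algebra.linearMap ℂ (U n)) ∘ₗ χ)
  simp only [mul_one] at h
  have h2 := indOp_snd hc y (UniversalEnvelopingAlgebra.lift ℂ (indRep hc) t
    (1, (Algebra.linearMap ℂ (U n)) ∘ₗ χ)) z
  rw [h] at h2
  simp only [indFun, LinearMap.coe_mk, AddHom.coe_mk, map_mul, Module.End.mul_apply,
    UniversalEnvelopingAlgebra.lift_ι_apply]
  exact h2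

/-- The action of `L` on `U(n)`, identified with the module induced from the character `χ`. -/
def indAct : L →ₗ[ℂ] Module.End ℂ (U n) where
  toFun x := LinearMap.mulLeft ℂ (ιU (projLeft hc x)) + (indFun hc χ).flip (projRight hc x)
  map_add' x y := by ext t; simp [add_mul]; abel
  map_smul' c x := by ext t; simp

lemma indAct_apply (x : L) (t : U n) :
    indAct hc χ x t = ιU (projLeft hc x) * t + indFun hc χ t (projRight hc x) := rfl

lemma indAct_left (y : n) (t : U n) : indAct hc χ y t = ιU y * t := by
  rw [indAct_apply, projLeft_coe, projRight_coe_left, map_zero, add_zero]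

lemma indAct_right_one (z : b) : indAct hc χ z 1 = algebraMap ℂ (U n) (χ z) := by
  rw [indAct_apply, projLeft_coe_right, projRight_coe, indFun_one]
  simp

lemma indAct_right_mul (z : b) (y : n) (t : U n) :
    indAct hc χ z (ιU y * t) = ιU y * indAct hc χ z t + indAct hc χ ⁅(z : L), (y : L)⁆ t := by
  rw [indAct_apply, indAct_apply, indAct_apply, projLeft_coe_right, projRight_coe, indFun_mul]
  simp [add_assoc]

/-- Induction over `U(n)` by left multiplications from `n`. At `1` both sides vanish because `χ`
kills brackets; the inductive step is the Jacobi identity. -/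
lemma indAct_right_right (hχ : ∀ z z' : b, χ ⁅z, z'⁆ = 0) (t : U n) (z z' : b) :
    indAct hc χ ⁅(z : L), (z' : L)⁆ t =
      indAct hc χ z (indAct hc χ z' t) - indAct hc χ z' (indAct hc χ z t) := by
  let P : Submodule ℂ (U n) :=
    { carrier := {t | ∀ z z' : b, indAct hc χ ⁅(z : L), (z' : L)⁆ t =
        indAct hc χ z (indAct hc χ z' t) - indAct hc χ z' (indAct hc χ z t)}
      zero_mem' := fun z z' => by simp
      add_mem' := fun {a c} ha hc z z' => by rw [map_add, ha, hc]; simp; abel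
      smul_mem' := fun r a ha z z' => by rw [map_smul, ha]; simp [smul_sub] }
  have hP : P = ⊤ := by
    refine eq_top_of_one_mem P (fun z z' => ?_) (fun y t ht z z' => ?_)
    · have := indAct_right_one hc χ ⁅z, z'⁆
      rw [LieSubalgebra.coe_bracket, hχ] at this
      simp only [this, indAct_right_one, Algebra.algebraMap_eq_smul_one, map_smul, smul_smul,
        zero_smul]
      rw [mul_comm, sub_self]
    -- The inductive hypothesis concerns pairs in `b`, but `⁅z', y⁆` may have a component in `n`;
    -- the rule for moving `z` past `n` extends it to all of `L`.
    · have key : ∀ (z : b) (x : L), indAct hc χ ⁅(z : L), x⁆ t =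
          indAct hc χ z (indAct hc χ x t) - indAct hc χ x (indAct hc χ z t) := by
        intro z x
        rw [← projLeft_add_projRight hc x, lie_add, map_add, map_add, LinearMap.add_apply,
          ht z (projRight hc x), LinearMap.add_apply, LinearMap.add_apply, map_add,
          indAct_left, indAct_left, indAct_right_mul]
        abel
      have h := indAct_right_mul hc χ ⁅z, z'⁆ y t
      rw [LieSubalgebra.coe_bracket] at h
      rw [h, ht z z', lie_lie, map_sub, LinearMap.sub_apply, key z ⁅(z' : L), (y : L)⁆,
        key z' ⁅(z : L), (y : L)⁆, indAct_right_mul,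
        indAct_right_mul, map_add, map_add, indAct_right_mul, indAct_right_mul, mul_sub]
      abel
  have : t ∈ P := hP ▸ Submodule.mem_top
  exact this z z'

lemma indAct_lie (hχ : ∀ z z' : b, χ ⁅z, z'⁆ = 0) (t : U n) (x x' : L) :
    indAct hc χ ⁅x, x'⁆ t = indAct hc χ x (indAct hc χ x' t) - indAct hc χ x' (indAct hc χ x t) := by
  have mixed : ∀ (z : b) (y : n) (t : U n), indAct hc χ ⁅(z : L), (y : L)⁆ t =
      indAct hc χ z (indAct hc χ y t) - indAct hc χ y (indAct hc χ z t) := by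
    intro z y t
    rw [indAct_left, indAct_left, indAct_right_mul]
    abel
  have left : ∀ (y y' : n) (t : U n), indAct hc χ ⁅(y : L), (y' : L)⁆ t =
      indAct hc χ y (indAct hc χ y' t) - indAct hc χ y' (indAct hc χ y t) := by
    intro y y' t
    rw [← LieSubalgebra.coe_bracket, indAct_left, indAct_left, indAct_left, indAct_left, indAct_left,
      LieHom.map_lie, LieRing.of_associative_ring_bracket, sub_mul, mul_assoc, mul_assoc]
  rw [← projLeft_add_projRight hc x, ← projLeft_add_projRight hc x']
  generalize projLeft hc x = y
  generalize projRight hc x = z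
  generalize projLeft hc x' = y'
  generalize projRight hc x' = z'
  have h4 := mixed z' y t
  rw [← lie_skew, map_neg, LinearMap.neg_apply] at h4
  simp only [lie_add, add_lie, map_add, LinearMap.add_apply, left, mixed, neg_eq_iff_eq_neg.1 h4,
    indAct_right_right hc χ hχ]
  abel

/-- The left ideal of `U(L)` generated by the kernel of a character of `b` is proper if `b` has
a complementary subalgebra. -/
lemma one_notMem_span (hc : IsCompl n.toSubmodule b.toSubmodule) (χ : b →ₗ[ℂ] ℂ)
    (hχ : ∀ z z' : b, χ ⁅z, z'⁆ = 0) (S : Set (U L))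
    (hS : ∀ u ∈ S, ∃ z : b, u = ιU (z : L) - algebraMap ℂ (U L) (χ z)) :
    (1 : U L) ∉ Submodule.span (U L) S := by
  let ρ : L →ₗ⁅ℂ⁆ Module.End ℂ (U n) :=
    { indAct hc χ with
      map_lie' := fun {x x'} => LinearMap.ext fun t => indAct_lie hc χ hχ t x x' }
  let F := UniversalEnvelopingAlgebra.lift ℂ ρ
  -- The annihilator of the vector `1 ∈ U(n)` is a left ideal containing the given generators,
  -- because `b` acts on that vector by `χ`; it does not contain `1`.
  let I : Submodule (U L) (U L) :=
    { carrier := {u | F u 1 = 0}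
      zero_mem' := by simp
      add_mem' := fun {a c} ha hc => by
        simp only [Set.mem_ofPred_eq, map_add, LinearMap.add_apply] at ha hc ⊢
        rw [ha, hc, add_zero]
      smul_mem' := fun r a ha => by
        simp only [Set.mem_ofPred_eq, smul_eq_mul, map_mul, Module.End.mul_apply] at ha ⊢
        rw [ha, map_zero] }
  intro h
  have hI : Submodule.span (U L) S ≤ I := by
    refine Submodule.span_le.2 fun u hu => ?_
    obtain ⟨z, rfl⟩ := hS u hu
    change F _ 1 = 0
    rw [map_sub, AlgHom.commutes, LinearMap.sub_apply, UniversalEnvelopingAlgebra.lift_ι_apply]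
    change indAct hc χ z 1 - _ = 0
    rw [indAct_right_one, Algebra.algebraMap_eq_smul_one]
    simp
  have := hI h
  change F 1 1 = 0 at this
  simp at this

end Induced


/-! ### Verma modules and irreducible highest weight modules -/

section VermaModules

attribute [local instance] LieRing.ofAssociativeRing

variable {L : Type*} [LieRing L] [LieAlgebra ℂ L] {gr : ℤ → Submodule ℂ L} {d : L}

namespace InnerGraded

lemma lie_mem_of_iSup (J : Set ℤ) (Q : Submodule ℂ L)
    (h : ∀ i ∈ J, ∀ j ∈ J, ∀ x ∈ gr i, ∀ y ∈ gr j, ⁅x, y⁆ ∈ Q) {x y : L}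
    (hx : x ∈ ⨆ j ∈ J, gr j) (hy : y ∈ ⨆ j ∈ J, gr j) : ⁅x, y⁆ ∈ Q := by
  have h1 : ∀ i ∈ J, ∀ x ∈ gr i, (⨆ j ∈ J, gr j) ≤ Q.comap (LieAlgebra.ad ℂ L x) :=
    fun i hi x hx => iSup₂_le fun j hj y hy => h i hi j hj x hx y hy
  have h2 : (⨆ j ∈ J, gr j) ≤ Q.comap (LieAlgebra.ad ℂ L y) :=
    iSup₂_le fun i hi x hx => by
      change ⁅y, x⁆ ∈ Q
      rw [← lie_skew]
      exact Q.neg_mem (h1 i hi x hx hy)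
  have h3 : ⁅y, x⁆ ∈ Q := h2 hx
  rw [← lie_skew]
  exact Q.neg_mem h3

/-- The subalgebra spanned by the components with degrees in an additively closed set. -/
def part (hg : InnerGraded gr d) (J : Set ℤ) (hJ : ∀ i ∈ J, ∀ j ∈ J, i + j ∈ J) :
    LieSubalgebra ℂ L :=
  { (⨆ j ∈ J, gr j : Submodule ℂ L) with
    lie_mem' := fun {_ _} hx hy => lie_mem_of_iSup J _ (fun i hi j hj x hx y hy =>
      Submodule.mem_iSup_of_mem (i + j) (Submodule.mem_iSup_of_mem (hJ i hi j hj)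
        (hg.lie_mem i j x y hx hy))) hx hy }

lemma indep (hg : InnerGraded gr d) : iSupIndep gr :=
  iSupIndep_of_le_eigenspace (LieAlgebra.ad ℂ L d) 0 gr fun j x hx => by
    rw [Module.End.mem_eigenspace_iff, zero_add]
    exact hg.lie_eq j x hx

lemma isCompl (hg : InnerGraded gr d) (J : Set ℤ) :
    IsCompl (⨆ j ∈ J, gr j) (⨆ j ∈ Jᶜ, gr j) := by
  refine ⟨hg.indep.disjoint_biSup_biSup disjoint_compl_right, codisjoint_iff.2 (top_le_iff.1 ?_)⟩
  rw [← hg.iSup_eq_top]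
  refine iSup_le fun j => ?_
  by_cases hj : j ∈ J
  · exact le_sup_of_le_left (le_iSup₂_of_le j hj le_rfl)
  · exact le_sup_of_le_right (le_iSup₂_of_le j hj le_rfl)

/-- The complementary subalgebras are the parts of negative and of non-negative degree. Extended by
zero, `lam` is a character of the latter: a bracket of total degree zero is a bracket in the
commutative part `gr 0`, and brackets of positive degree are killed. -/
lemma one_notMem_vermaIdeal (hg : InnerGraded gr d) (lam : Module.Dual ℂ (gr 0)) :
    1 ∉ vermaIdeal gr lam := by
  let n := hg.part {j | j < 0} (fun i hi j hj => by simp at hi hj ⊢; omega)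
  let b := hg.part {j | j < 0}ᶜ (fun i hi j hj => by simp at hi hj ⊢; omega)
  have hc : IsCompl n.toSubmodule b.toSubmodule := hg.isCompl _
  have hc0 : IsCompl (gr 0) (⨆ j ∈ ({0} : Set ℤ)ᶜ, gr j) := by
    have := hg.isCompl {0}
    simpa using this
  let χ : L →ₗ[ℂ] ℂ := lam ∘ₗ (gr 0).projectionOnto _ hc0
  have hχ : ∀ j : ℤ, j ≠ 0 → ∀ x ∈ gr j, χ x = 0 := by
    intro j hj x hx
    have : x ∈ ⨆ j ∈ ({0} : Set ℤ)ᶜ, gr j :=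
      Submodule.mem_iSup_of_mem j (Submodule.mem_iSup_of_mem hj hx)
    change lam _ = 0
    rw [Submodule.projectionOnto_apply_of_mem_right hc0 this, map_zero]
  have hχ0 : ∀ h : gr 0, χ h = lam h := fun h => by
    simp [χ]
  have hmem : ∀ j : ℤ, 0 ≤ j → ∀ x ∈ gr j, x ∈ b := fun j hj x hx =>
    Submodule.mem_iSup_of_mem j (Submodule.mem_iSup_of_mem (by simpa using hj) hx)
  refine one_notMem_span hc (χ ∘ₗ b.toSubmodule.subtype) ?_ _ ?_
  · intro z z'
    have : ⁅(z : L), (z' : L)⁆ ∈ LinearMap.ker χ := by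
      refine lie_mem_of_iSup {j | j < 0}ᶜ _ ?_ z.2 z'.2
      intro i hi j hj x hx y hy
      rw [LinearMap.mem_ker]
      by_cases h : i + j = 0
      · simp at hi hj
        obtain rfl : i = 0 := by omega
        obtain rfl : j = 0 := by omega
        rw [hg.comm x y hx hy, map_zero]
      · exact hχ _ h _ (hg.lie_mem i j x y hx hy)
    exact this
  · rintro u (⟨j, hj, x, hx, rfl⟩ | ⟨h, rfl⟩)
    · refine ⟨⟨x, hmem j hj.le x hx⟩, ?_⟩
      change _ = _ - algebraMap ℂ (UniversalEnvelopingAlgebra ℂ L) (χ x)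
      rw [hχ j hj.ne' x hx, map_zero, sub_zero]
    · refine ⟨⟨h, hmem 0 le_rfl h h.2⟩, ?_⟩
      change _ = _ - algebraMap ℂ (UniversalEnvelopingAlgebra ℂ L) (χ h)
      rw [hχ0]

end InnerGraded

namespace Verma

variable (gr) (lam : Module.Dual ℂ (gr 0))

/-- The quotient map from the enveloping algebra to the Verma module. -/
def mk : UniversalEnvelopingAlgebra ℂ L →ₗ[ℂ] Verma gr lam :=
  (vermaIdeal gr lam).mkQ.restrictScalars ℂ

lemma mk_surjective : Function.Surjective (mk gr lam) := (vermaIdeal gr lam).mkQ_surjective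

lemma mk_eq_zero {u : UniversalEnvelopingAlgebra ℂ L} : mk gr lam u = 0 ↔ u ∈ vermaIdeal gr lam :=
  Submodule.Quotient.mk_eq_zero _

/-- The highest weight vector of the Verma module. -/
def vec : Verma gr lam := mk gr lam 1

lemma lie_mk (x : L) (u : UniversalEnvelopingAlgebra ℂ L) :
    ⁅x, mk gr lam u⁆ = mk gr lam (UniversalEnvelopingAlgebra.ι ℂ x * u) := rfl

lemma isHighestWeight : IsHighestWeight gr lam (vec gr lam) where
  lie_zero h := by
    rw [vec, lie_mk, ← map_smul, ← sub_eq_zero, ← map_sub, mul_one,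
      ← Algebra.algebraMap_eq_smul_one]
    exact (mk_eq_zero gr lam).2 (Submodule.subset_span (Or.inr ⟨h, rfl⟩))
  lie_pos j hj x hx := by
    rw [vec, lie_mk, mul_one]
    exact (mk_eq_zero gr lam).2 (Submodule.subset_span (Or.inl ⟨j, hj, x, hx, rfl⟩))
  generates N hN := by
    let P : Submodule ℂ (UniversalEnvelopingAlgebra ℂ L) :=
      N.toSubmodule.comap (mk gr lam)
    have hP : P = ⊤ := eq_top_of_one_mem P hN fun x t ht => by
      change mk gr lam (_ * t) ∈ N
      rw [← lie_mk]
      exact N.lie_mem ht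
    refine eq_top_iff.2 fun u _ => ?_
    obtain ⟨t, rfl⟩ := mk_surjective gr lam u
    exact (hP ▸ Submodule.mem_top : t ∈ P)

lemma vec_ne_zero (hg : InnerGraded gr d) : vec gr lam ≠ 0 := fun h =>
  hg.one_notMem_vermaIdeal lam ((mk_eq_zero gr lam).1 h)

lemma lie_mem_grading {i j : ℤ} {x : L} {u : Verma gr lam} (hx : x ∈ gr i)
    (hu : u ∈ grading gr lam j) : ⁅x, u⁆ ∈ grading gr lam (i + j) := by
  have h : grading gr lam j ≤ (grading gr lam (i + j)).comap
      (LieModule.toEnd ℂ L (Verma gr lam) x) := by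
    refine Submodule.span_le.2 ?_
    rintro _ ⟨l, hl, hs, rfl⟩
    refine Submodule.subset_span ⟨(i, x) :: l, ?_, ?_, ?_⟩
    · simpa using ⟨hx, fun a b h => hl (a, b) h⟩
    · simp [hs]
    · rw [List.map_cons, List.prod_cons]
      rfl
  exact h hu

lemma vec_mem_grading : vec gr lam ∈ grading gr lam 0 :=
  Submodule.subset_span ⟨[], by simp, by simp, rfl⟩

lemma iSup_grading (hg : InnerGraded gr d) : ⨆ j, grading gr lam j = ⊤ := by
  let N : LieSubmodule ℂ L (Verma gr lam) :=
    { (⨆ j, grading gr lam j : Submodule ℂ (Verma gr lam)) with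
      lie_mem := fun {x u} hu => by
        refine lie_mem_of_homogeneous hg.iSup_eq_top (⨆ j, grading gr lam j)
          (fun i x hx => ?_) x
        have h : (⨆ j, grading gr lam j) ≤ (⨆ j, grading gr lam j).comap
            (LieModule.toEnd ℂ L (Verma gr lam) x) :=
          iSup_le fun j u hu => Submodule.mem_iSup_of_mem (i + j) (lie_mem_grading gr lam hx hu)
        exact h hu }
  have := (isHighestWeight gr lam).generates N
    (Submodule.mem_iSup_of_mem 0 (vec_mem_grading gr lam))
  exact congrArg LieSubmodule.toSubmodule this

lemma grading_le_wt (hg : InnerGraded gr d) (j : ℤ) :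
    grading gr lam j ≤ wt (Verma gr lam) d (lam ⟨d, hg.mem_zero⟩) j := by
  refine Submodule.span_le.2 ?_
  rintro _ ⟨l, hl, hs, rfl⟩
  induction l generalizing j with
  | nil =>
    simp only [List.map_nil, List.sum_nil] at hs
    subst hs
    exact (isHighestWeight gr lam).mem_wt_zero hg.mem_zero
  | cons p l ih =>
    rw [List.map_cons, List.sum_cons] at hs
    subst hs
    rw [List.map_cons, List.prod_cons]
    exact hg.lie_mem_wt (hl p (by simp)) (ih _ (fun q hq => hl q (by simp [hq])) rfl)

lemma grading_eq_wt (hg : InnerGraded gr d) (j : ℤ) :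
    grading gr lam j = wt (Verma gr lam) d (lam ⟨d, hg.mem_zero⟩) j :=
  eq_eigenspace_of_iSup_eq_top _ _ _ (grading_le_wt gr lam hg) (iSup_grading gr lam hg) j

/-- Since the gradation comes from the action of `d`, every submodule is graded. Thus `maxGraded`
contains all proper submodules, not just those assumed graded. -/
lemma isGraded (hg : InnerGraded gr d) (N : LieSubmodule ℂ L (Verma gr lam)) :
    IsGraded gr lam N := by
  have := (isHighestWeight gr lam).le_iSup_inf_wt hg N
  simp only [← grading_eq_wt gr lam hg] at this
  exact this

lemma le_maxGraded (hg : InnerGraded gr d) {N : LieSubmodule ℂ L (Verma gr lam)} (hN : N ≠ ⊤) :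
    N ≤ maxGraded gr lam :=
  le_sSup ⟨isGraded gr lam hg N, hN⟩

/-- Each proper submodule lies in the span of the components of non-zero degree; so does any sum of
them, whereas the highest weight vector does not. -/
lemma vec_notMem_maxGraded (hg : InnerGraded gr d) : vec gr lam ∉ maxGraded gr lam := by
  intro h
  refine (isHighestWeight gr lam).notMem_iSup_ne_zero hg (vec_ne_zero gr lam hg) ?_
  have hle : (maxGraded gr lam).toSubmodule ≤
      ⨆ (j : ℤ) (_ : j ≠ 0), wt (Verma gr lam) d (lam ⟨d, hg.mem_zero⟩) j := by
    rw [maxGraded, LieSubmodule.sSup_toSubmodule_eq_iSup]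
    exact iSup₂_le fun N hN => (isHighestWeight gr lam).le_iSup_ne_zero hg hN.2
  exact hle h

end Verma

namespace IrrHW

variable (gr) (lam : Module.Dual ℂ (gr 0))

/-- The highest weight vector of the irreducible highest weight module. -/
def vec : IrrHW gr lam := LieSubmodule.Quotient.mk' (Verma.maxGraded gr lam) (Verma.vec gr lam)

lemma vec_ne_zero (hg : InnerGraded gr d) : vec gr lam ≠ 0 := fun h =>
  Verma.vec_notMem_maxGraded gr lam hg ((LieSubmodule.Quotient.mk_eq_zero' ).1 h)

lemma isHighestWeight : IsHighestWeight gr lam (vec gr lam) where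
  lie_zero h := by
    rw [vec, ← LieModuleHom.map_lie, (Verma.isHighestWeight gr lam).lie_zero, map_smul]
  lie_pos j hj x hx := by
    rw [vec, ← LieModuleHom.map_lie, (Verma.isHighestWeight gr lam).lie_pos j hj x hx, map_zero]
  generates N hN := by
    have h := (Verma.isHighestWeight gr lam).generates
      (N.comap (LieSubmodule.Quotient.mk' (Verma.maxGraded gr lam))) hN
    refine eq_top_iff.2 fun u _ => ?_
    obtain ⟨t, rfl⟩ := LieSubmodule.Quotient.surjective_mk' _ u
    have : t ∈ N.comap (LieSubmodule.Quotient.mk' (Verma.maxGraded gr lam)) := by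
      rw [h]; trivial
    exact this

/-- A proper submodule of the quotient has a proper preimage in the Verma module, which is contained
in `maxGraded`; so the submodule is zero. -/
lemma isIrreducible (hg : InnerGraded gr d) : LieModule.IsIrreducible ℂ L (IrrHW gr lam) := by
  have : Nontrivial (IrrHW gr lam) := ⟨vec gr lam, 0, vec_ne_zero gr lam hg⟩
  refine LieModule.IsIrreducible.mk fun N hN => ?_
  by_contra htop
  refine hN ((LieSubmodule.eq_bot_iff N).2 fun u hu => ?_)
  obtain ⟨t, rfl⟩ := LieSubmodule.Quotient.surjective_mk' _ u
  have hne : N.comap (LieSubmodule.Quotient.mk' (Verma.maxGraded gr lam)) ≠ ⊤ := fun h =>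
    htop ((isHighestWeight gr lam).generates N (by
      have : Verma.vec gr lam ∈ N.comap (LieSubmodule.Quotient.mk' (Verma.maxGraded gr lam)) := by
        rw [h]; trivial
      exact this))
  exact (LieSubmodule.Quotient.mk_eq_zero').2 (Verma.le_maxGraded gr lam hg hne hu)

lemma grading_eq_wt (hg : InnerGraded gr d) (j : ℤ) :
    grading gr lam j = wt (IrrHW gr lam) d (lam ⟨d, hg.mem_zero⟩) j := by
  refine eq_eigenspace_of_iSup_eq_top _ _ (grading gr lam) ?_ ?_ j
  · rintro j _ ⟨u, hu, rfl⟩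
    have := Verma.grading_le_wt gr lam hg j hu
    rw [mem_wt] at this
    change _ ∈ wt (IrrHW gr lam) d (lam ⟨d, hg.mem_zero⟩) j
    rw [mem_wt]
    change ⁅d, LieSubmodule.Quotient.mk' (Verma.maxGraded gr lam) u⁆ =
      _ • LieSubmodule.Quotient.mk' (Verma.maxGraded gr lam) u
    rw [← LieModuleHom.map_lie, this, map_smul]
  · simp only [grading]
    rw [← Submodule.map_iSup, Verma.iSup_grading gr lam hg, Submodule.map_top]
    exact LinearMap.range_eq_top.2 (LieSubmodule.Quotient.surjective_mk' _)

lemma quasifiniteWeight_of_finite (hg : InnerGraded gr d)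
    (h : ∀ j, FiniteDimensional ℂ (wt (IrrHW gr lam) d (lam ⟨d, hg.mem_zero⟩) j)) :
    QuasifiniteWeight gr lam := by
  have he : grading gr lam = wt (IrrHW gr lam) d (lam ⟨d, hg.mem_zero⟩) :=
    funext (grading_eq_wt gr lam hg)
  rw [QuasifiniteWeight, he]
  exact ⟨isInternal_of_le_eigenspace _ _ _ (fun _ => le_rfl)
    ((isHighestWeight gr lam).iSup_wt_eq_top hg), fun i j x v hx hv => hg.lie_mem_wt hx hv, h⟩

end IrrHW

/-! ### Uniqueness of the irreducible module with a given highest weight. -/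

section Uniqueness

variable {V : Type*} [AddCommGroup V] [Module ℂ V] [LieRingModule L V] [LieModule ℂ L V]
  {lam : Module.Dual ℂ (gr 0)} {v : V}

/-- The homomorphism from the Verma module given by a highest weight vector. -/
def Verma.lift (hv : IsHighestWeight gr lam v) : Verma gr lam →ₗ⁅ℂ,L⁆ V := by
  let F := UniversalEnvelopingAlgebra.lift ℂ (LieModule.toEnd ℂ L V)
  have hF : ∀ u ∈ vermaIdeal gr lam, F u v = 0 := by
    let I : Submodule (UniversalEnvelopingAlgebra ℂ L) (UniversalEnvelopingAlgebra ℂ L) :=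
      { carrier := {u | F u v = 0}
        zero_mem' := by simp
        add_mem' := fun {a c} ha hc => by
          simp only [Set.mem_ofPred_eq, map_add, LinearMap.add_apply] at ha hc ⊢
          rw [ha, hc, add_zero]
        smul_mem' := fun r a ha => by
          simp only [Set.mem_ofPred_eq, smul_eq_mul, map_mul, Module.End.mul_apply] at ha ⊢
          rw [ha, map_zero] }
    have : vermaIdeal gr lam ≤ I := by
      refine Submodule.span_le.2 ?_
      rintro u (⟨j, hj, x, hx, rfl⟩ | ⟨h, rfl⟩)
      · change F _ v = 0
        rw [UniversalEnvelopingAlgebra.lift_ι_apply]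
        exact hv.lie_pos j hj x hx
      · change F _ v = 0
        rw [map_sub, AlgHom.commutes, LinearMap.sub_apply, UniversalEnvelopingAlgebra.lift_ι_apply,
          LieModule.toEnd_apply_apply, hv.lie_zero h, Module.algebraMap_end_apply, sub_self]
    exact fun u hu => this hu
  let f : UniversalEnvelopingAlgebra ℂ L →ₗ[ℂ] V := LinearMap.applyₗ v ∘ₗ F.toLinearMap
  let g : Verma gr lam →ₗ[ℂ] V :=
    ((vermaIdeal gr lam).restrictScalars ℂ).liftQ f (fun u hu => hF u hu)
  exact
    { g with
      map_lie' := fun {x u} => by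
        obtain ⟨t, rfl⟩ := Verma.mk_surjective gr lam u
        change F (UniversalEnvelopingAlgebra.ι ℂ x * t) v = ⁅x, F t v⁆
        rw [map_mul, UniversalEnvelopingAlgebra.lift_ι_apply]
        rfl }

lemma Verma.lift_vec (hv : IsHighestWeight gr lam v) : Verma.lift hv (Verma.vec gr lam) = v := by
  change UniversalEnvelopingAlgebra.lift ℂ (LieModule.toEnd ℂ L V) 1 v = v
  simp

/-- An irreducible module with a highest weight vector is the irreducible highest weight module. -/
theorem IsHighestWeight.nonempty_equiv (hv : IsHighestWeight gr lam v) (hg : InnerGraded gr d)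
    [LieModule.IsIrreducible ℂ L V] (hv0 : v ≠ 0) : Nonempty (IrrHW gr lam ≃ₗ⁅ℂ,L⁆ V) := by
  have hle : ∀ u : Verma gr lam, Verma.lift hv u = 0 ↔ u ∈ Verma.maxGraded gr lam := by
    have h1 : (Verma.lift hv).ker ≤ Verma.maxGraded gr lam := by
      refine Verma.le_maxGraded gr lam hg fun h => hv0 ?_
      have : Verma.vec gr lam ∈ (Verma.lift hv).ker := by rw [h]; trivial
      rwa [LieModuleHom.mem_ker, Verma.lift_vec] at this
    intro u
    refine ⟨fun h => h1 (LieModuleHom.mem_ker.2 h), fun h => ?_⟩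
    -- If the image of `maxGraded` were everything, `v` would be the image of some `w` in it; the
    -- difference of the Verma vector and `w` lies in the kernel, hence in `maxGraded`, and so would
    -- the Verma vector itself.
    rcases IsSimpleOrder.eq_bot_or_eq_top ((Verma.maxGraded gr lam).map (Verma.lift hv)) with
      hb | ht
    · have : Verma.lift hv u ∈ (Verma.maxGraded gr lam).map (Verma.lift hv) :=
        LieSubmodule.mem_map_of_mem h
      rwa [hb, LieSubmodule.mem_bot] at this
    · exfalso
      have : v ∈ (Verma.maxGraded gr lam).map (Verma.lift hv) := by rw [ht]; trivial
      obtain ⟨w, hw, hwv⟩ := (LieSubmodule.mem_map v).1 this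
      have hk : Verma.vec gr lam - w ∈ (Verma.lift hv).ker := by
        rw [LieModuleHom.mem_ker, map_sub, Verma.lift_vec, hwv, sub_self]
      refine Verma.vec_notMem_maxGraded gr lam hg ?_
      have := (Verma.maxGraded gr lam).toSubmodule.add_mem (h1 hk) hw
      rwa [sub_add_cancel] at this
  let g : IrrHW gr lam →ₗ[ℂ] V :=
    (Verma.maxGraded gr lam).toSubmodule.liftQ (Verma.lift hv).toLinearMap
      (fun u hu => (hle u).2 hu)
  have hg' : ∀ u, g (LieSubmodule.Quotient.mk' (Verma.maxGraded gr lam) u) = Verma.lift hv u :=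
    fun u => rfl
  let G : IrrHW gr lam →ₗ⁅ℂ,L⁆ V :=
    { g with
      map_lie' := fun {x u} => by
        obtain ⟨t, rfl⟩ := LieSubmodule.Quotient.surjective_mk' _ u
        change g ⁅x, _⁆ = ⁅x, g _⁆
        rw [← LieModuleHom.map_lie, hg', hg', LieModuleHom.map_lie] }
  have hinj : Function.Injective G := by
    refine (injective_iff_map_eq_zero G).2 fun u hu => ?_
    obtain ⟨t, rfl⟩ := LieSubmodule.Quotient.surjective_mk' _ u
    exact (LieSubmodule.Quotient.mk_eq_zero').2 ((hle t).1 hu)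
  have hsurj : Function.Surjective G := by
    have h := hv.generates G.range ((LieModuleHom.mem_range _ _).2
      ⟨IrrHW.vec gr lam, Verma.lift_vec hv⟩)
    exact LieModuleHom.range_eq_top _ |>.1 h
  exact ⟨{ G with
    invFun := (LinearEquiv.ofBijective G.toLinearMap ⟨hinj, hsurj⟩).symm
    left_inv := (LinearEquiv.ofBijective G.toLinearMap ⟨hinj, hsurj⟩).left_inv
    right_inv := (LinearEquiv.ofBijective G.toLinearMap ⟨hinj, hsurj⟩).right_inv }⟩

end Uniqueness

end VermaModules


/-! ### The gradations of `W_∞` and of `𝔤_s` -/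

section WGraded

lemma W1Inf.ext' {x y : W1Inf} (h1 : x.op = y.op) (h2 : x.cen = y.cen) : x = y :=
  congrArg₂ W1Inf.mk h1 h2

/-- The element `t^k q(D)` of `W_∞`, for `q` divisible by the variable. -/
def wElt (k : ℤ) (q : ℂ[X]) (hq : X ∣ q) : WInf :=
  ⟨W1Inf.mk (DiffOp.single k q) 0, fun l => by
    change X ∣ (DiffOp.single k q).coeff l
    rw [DiffOp.coeff_single]
    split_ifs
    · exact hq
    · exact dvd_zero _⟩

/-- The central element `C` of `W_∞`. -/
def wCen : WInf := ⟨W1Inf.mk 0 1, fun _ => dvd_zero _⟩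

lemma wElt_op (k : ℤ) (q : ℂ[X]) (hq : X ∣ q) : (wElt k q hq).1.op = DiffOp.single k q := rfl
lemma wElt_cen (k : ℤ) (q : ℂ[X]) (hq : X ∣ q) : (wElt k q hq).1.cen = 0 := rfl

lemma wElt_mem (k : ℤ) (q : ℂ[X]) (hq : X ∣ q) : wElt k q hq ∈ wGrading k :=
  ⟨fun l hl => by rw [wElt_op, DiffOp.coeff_single, if_neg hl.symm], fun _ => rfl⟩

lemma wCen_mem : wCen ∈ wGrading 0 := ⟨fun _ _ => rfl, fun h => absurd rfl h⟩

/-- The degree element `D` of `W_∞`. -/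
def wDeg : WInf := wElt 0 X dvd_rfl

lemma op_eq_single {k : ℤ} {w : WInf} (hw : w ∈ wGrading k) :
    w.1.op = DiffOp.single k (w.1.op.coeff k) := by
  refine DiffOp.ext' fun l => ?_
  rw [DiffOp.coeff_single]
  split_ifs with h
  · rw [h]
  · exact hw.1 l (Ne.symm h)

lemma iSup_wGrading : ⨆ k, wGrading k = ⊤ := by
  refine Submodule.eq_top_iff'.2 fun w => ?_
  have key : ∀ (S : Finset ℤ) (w : WInf), (∀ k ∉ S, w.1.op.coeff k = 0) → w ∈ ⨆ k, wGrading k := by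
    intro S
    induction S using Finset.induction_on with
    | empty =>
      intro w hw
      -- With no coefficients left, the element is a multiple of `C`, which has degree zero.
      exact Submodule.mem_iSup_of_mem 0 ⟨fun l _ => hw l (by simp), fun h => absurd rfl h⟩
    | insert k S hk ih =>
      intro w hw
      have h1 : wElt k (w.1.op.coeff k) (w.2 k) ∈ ⨆ k, wGrading k :=
        Submodule.mem_iSup_of_mem k (wElt_mem k _ _)
      have h2 : w - wElt k (w.1.op.coeff k) (w.2 k) ∈ ⨆ k, wGrading k := by
        refine ih _ fun l hl => ?_
        change w.1.op.coeff l - (DiffOp.single k (w.1.op.coeff k)).coeff l = 0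
        rw [DiffOp.coeff_single]
        split_ifs with h
        · rw [h, sub_self]
        · rw [hw l (by simp [hl, Ne.symm h]), sub_zero]
      have := Submodule.add_mem _ h2 h1
      rwa [sub_add_cancel] at this
  refine key (Finsupp.support (show ℤ →₀ ℂ[X] from w.1.op)) w fun k hk => ?_
  exact Finsupp.notMem_support_iff.1 hk

/-- Moving `D` past `t^j` produces `j t^j`. In degree zero polynomials in `D` commute, and both sums
defining `Ψ` are empty. -/
lemma innerGraded_wGrading : InnerGraded wGrading wDeg where
  iSup_eq_top := iSup_wGrading
  lie_mem i j x y hx hy := by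
    refine ⟨fun l hl => ?_, fun h => ?_⟩
    · change ⁅x.1.op, y.1.op⁆.coeff l = 0
      rw [op_eq_single hx, op_eq_single hy, DiffOp.lie_eq, DiffOp.single_mul_single,
        DiffOp.single_mul_single, DiffOp.coeff_sub, DiffOp.coeff_single, DiffOp.coeff_single,
        if_neg hl.symm, if_neg (by omega), sub_zero]
    · change ⁅x.1, y.1⁆.cen = 0
      rw [W1Inf.lie_cen, op_eq_single hx, op_eq_single hy, DiffOp.cocycle_single, if_neg (by omega)]
  comm x y hx hy := by
    refine Subtype.ext (W1Inf.ext' ?_ ?_)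
    · change ⁅x.1.op, y.1.op⁆ = 0
      rw [op_eq_single hx, op_eq_single hy, DiffOp.lie_eq, DiffOp.single_mul_single,
        DiffOp.single_mul_single, Int.cast_zero, taylor_zero, taylor_zero, mul_comm, sub_self]
    · change ⁅x.1, y.1⁆.cen = 0
      rw [W1Inf.lie_cen, op_eq_single hx, op_eq_single hy, DiffOp.cocycle_single]
      simp [DiffOp.psi]
  mem_zero := wElt_mem 0 _ _
  lie_eq j x hx := by
    refine Subtype.ext (W1Inf.ext' ?_ ?_)
    · change ⁅wDeg.1.op, x.1.op⁆ = (j : ℂ) • x.1.op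
      rw [op_eq_single hx, wDeg, wElt_op, DiffOp.lie_eq, DiffOp.single_mul_single,
        DiffOp.single_mul_single, Int.cast_zero, taylor_zero, taylor_X, zero_add, add_zero,
        ← DiffOp.single_smul]
      refine DiffOp.ext' fun l => ?_
      rw [DiffOp.coeff_sub, DiffOp.coeff_single, DiffOp.coeff_single, DiffOp.coeff_single]
      split_ifs
      · rw [smul_eq_C_mul]; ring
      · simp
    · change ⁅wDeg.1, x.1⁆.cen = (j : ℂ) * x.1.cen
      rw [W1Inf.lie_cen, op_eq_single hx, wDeg, wElt_op, DiffOp.cocycle_single]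
      by_cases hj : j = 0
      · subst hj; simp [DiffOp.psi]
      · rw [if_neg (by omega), hx.2 hj, mul_zero]

end WGraded

/-! ### Homogeneous elements of `𝔤_s` and their brackets. -/

section GsGraded

lemma GlHat.ext' {x y : GlHat} (h1 : x.mat = y.mat) (h2 : x.cen = y.cen) : x = y :=
  congrArg₂ GlHat.mk h1 h2

/-- The matrix entries of elements of `𝔤_s`. -/
def gsEntry (s : ℂ) (i j : ℤ) : gs s →ₗ[ℂ] ℂ where
  toFun x := x.1.mat.1 i j
  map_add' _ _ := rfl
  map_smul' _ _ := rfl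

/-- The coefficient of `C` of elements of `𝔤_s`. -/
def gsCen (s : ℂ) : gs s →ₗ[ℂ] ℂ where
  toFun x := x.1.cen
  map_add' _ _ := rfl
  map_smul' _ _ := rfl

lemma gs_ext {s : ℂ} {x y : gs s} (h1 : ∀ i j, gsEntry s i j x = gsEntry s i j y)
    (h2 : gsCen s x = gsCen s y) : x = y :=
  Subtype.ext (GlHat.ext' (GlInf.ext' h1) h2)

lemma mem_gsGrading {s : ℂ} {k : ℤ} {x : gs s} :
    x ∈ gsGrading s k ↔ (∀ i j, j - i ≠ k → gsEntry s i j x = 0) ∧ (k ≠ 0 → gsCen s x = 0) :=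
  Iff.rfl

lemma gsEntry_eq_zero {s : ℂ} (x : gs s) {i j : ℤ} (h : (i : ℂ) = s ∨ (j : ℂ) = s) :
    gsEntry s i j x = 0 := x.2 i j h

/-- The homogeneous component of degree `k` of an element of `𝔤_s`. -/
def gsComponent (s : ℂ) (k : ℤ) (x : gs s) : gs s :=
  ⟨GlHat.mk ⟨fun i j => if j - i = k then x.1.mat.1 i j else 0, by
      obtain ⟨N, hN⟩ := x.1.mat.2
      exact ⟨N, fun i j h => by simp [hN i j h]⟩⟩ (if k = 0 then x.1.cen else 0), fun i j h => by
    change (if j - i = k then x.1.mat.1 i j else 0) = 0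
    rw [x.2 i j h, ite_self]⟩

lemma gsEntry_gsComponent (s : ℂ) (k : ℤ) (x : gs s) (i j : ℤ) :
    gsEntry s i j (gsComponent s k x) = if j - i = k then gsEntry s i j x else 0 := rfl

lemma gsCen_gsComponent (s : ℂ) (k : ℤ) (x : gs s) :
    gsCen s (gsComponent s k x) = if k = 0 then gsCen s x else 0 := rfl

lemma gsComponent_mem (s : ℂ) (k : ℤ) (x : gs s) : gsComponent s k x ∈ gsGrading s k :=
  ⟨fun _ _ h => if_neg h, fun h => if_neg h⟩

lemma exists_sum_gsComponent (s : ℂ) (x : gs s) : ∃ S : Finset ℤ, x = ∑ k ∈ S, gsComponent s k x := by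
  obtain ⟨N, hN⟩ := x.1.mat.2
  refine ⟨Finset.Icc (-(N : ℤ)) N, gs_ext (fun i j => ?_) ?_⟩
  · rw [map_sum]
    simp only [gsEntry_gsComponent]
    rw [Finset.sum_ite_eq]
    split_ifs with h
    · rfl
    · refine hN i j ?_
      rw [Finset.mem_Icc] at h
      rw [lt_abs]
      omega
  · rw [map_sum]
    simp only [gsCen_gsComponent]
    rw [Finset.sum_ite_eq', if_pos (by simp)]

lemma iSup_gsGrading (s : ℂ) : ⨆ k, gsGrading s k = ⊤ := by
  refine Submodule.eq_top_iff'.2 fun x => ?_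
  obtain ⟨S, hS⟩ := exists_sum_gsComponent s x
  rw [hS]
  exact Submodule.sum_mem _ fun k _ => Submodule.mem_iSup_of_mem k (gsComponent_mem s k x)

lemma gsEntry_lie (s : ℂ) (x y : gs s) (i j : ℤ) : gsEntry s i j ⁅x, y⁆ =
    (∑ᶠ k, gsEntry s i k x * gsEntry s k j y) - ∑ᶠ k, gsEntry s i k y * gsEntry s k j x := rfl

lemma gsCen_lie (s : ℂ) (x y : gs s) : gsCen s ⁅x, y⁆ =
    ∑ᶠ i, ∑ᶠ k, ((if i ≤ 0 then 1 else 0) - (if k ≤ 0 then 1 else 0)) * gsEntry s i k x *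
      gsEntry s k i y := by
  change ⁅x.1, y.1⁆.cen = _
  rw [GlHat.lie_cen, GlInf.cocycle_apply, GlInf.trace]
  refine finsum_congr fun i => ?_
  rw [GlInf.mul_apply]
  refine finsum_congr fun k => ?_
  rw [GlInf.lie_J_apply]
  rfl

lemma gsEntry_lie_homogeneous {s : ℂ} {a b : ℤ} {x y : gs s} (hx : x ∈ gsGrading s a)
    (hy : y ∈ gsGrading s b) (i j : ℤ) : gsEntry s i j ⁅x, y⁆ =
      gsEntry s i (i + a) x * gsEntry s (i + a) j y -
        gsEntry s i (i + b) y * gsEntry s (i + b) j x := by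
  rw [gsEntry_lie, finsum_eq_single _ (i + a), finsum_eq_single _ (i + b)]
  · intro k hk
    rw [hy.1 i k (by omega) |> (show gsEntry s i k y = 0 from ·), zero_mul]
  · intro k hk
    rw [hx.1 i k (by omega) |> (show gsEntry s i k x = 0 from ·), zero_mul]

lemma gsCen_lie_homogeneous {s : ℂ} {a : ℤ} {x y : gs s} (hx : x ∈ gsGrading s a) :
    gsCen s ⁅x, y⁆ = ∑ᶠ i : ℤ, ((if i ≤ 0 then 1 else 0) - (if i + a ≤ 0 then 1 else 0)) *
      gsEntry s i (i + a) x * gsEntry s (i + a) i y := by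
  rw [gsCen_lie]
  refine finsum_congr fun i => ?_
  rw [finsum_eq_single _ (i + a)]
  intro k hk
  rw [show gsEntry s i k x = 0 from hx.1 i k (by omega), mul_zero, zero_mul]

lemma phiHat_entry (s : ℂ) (w : WInf) (i j : ℤ) (hi : (i : ℂ) ≠ s) (hj : (j : ℂ) ≠ s) :
    gsEntry s i j (phiHat s w) = (w.1.op.coeff (j - i)).eval (-j + s) :=
  if_neg (by tauto)

lemma phiHat_cen (s : ℂ) (w : WInf) :
    gsCen s (phiHat s w) = w.1.cen + kappa s (w.1.op.coeff 0) := rfl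

lemma phiHat_mem (s : ℂ) {k : ℤ} {w : WInf} (hw : w ∈ wGrading k) :
    phiHat s w ∈ gsGrading s k := by
  refine mem_gsGrading.2 ⟨fun i j h => ?_, fun h => ?_⟩
  · by_cases hij : (i : ℂ) = s ∨ (j : ℂ) = s
    · exact gsEntry_eq_zero _ hij
    · rw [not_or] at hij
      rw [phiHat_entry s w i j hij.1 hij.2, hw.1 _ h, eval_zero]
  · rw [phiHat_cen, hw.2 h, hw.1 0 h.symm, map_zero, add_zero]

/-- Away from the erased position `φ̂_s(D)` is diagonal with entries `s - j`, so its bracket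
multiplies an `(i, j)` entry by `(s - i) - (s - j) = j - i`. The cocycle of a diagonal matrix with
anything is zero because `J` is diagonal. -/
lemma innerGraded_gsGrading (s : ℂ) : InnerGraded (gsGrading s) (phiHat s wDeg) where
  iSup_eq_top := iSup_gsGrading s
  lie_mem a b x y hx hy := by
    refine mem_gsGrading.2 ⟨fun i j h => ?_, fun h => ?_⟩
    · rw [gsEntry_lie_homogeneous hx hy, show gsEntry s (i + a) j y = 0 from hy.1 _ _ (by omega),
        show gsEntry s (i + b) j x = 0 from hx.1 _ _ (by omega), mul_zero, mul_zero, sub_zero]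
    · rw [gsCen_lie_homogeneous hx]
      refine finsum_eq_zero_of_forall_eq_zero fun i => ?_
      rw [show gsEntry s (i + a) i y = 0 from hy.1 _ _ (by omega), mul_zero]
  comm x y hx hy := by
    refine gs_ext (fun i j => ?_) ?_
    · rw [gsEntry_lie_homogeneous hx hy, add_zero, map_zero]
      by_cases h : j = i
      · subst h; ring
      · rw [show gsEntry s i j x = 0 from hx.1 _ _ (by omega),
          show gsEntry s i j y = 0 from hy.1 _ _ (by omega), mul_zero, mul_zero, sub_zero]
    · rw [gsCen_lie_homogeneous hx, map_zero]
      exact finsum_eq_zero_of_forall_eq_zero fun i => by simp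
  mem_zero := phiHat_mem s (wElt_mem 0 _ _)
  lie_eq a x hx := by
    have hd : phiHat s wDeg ∈ gsGrading s 0 := phiHat_mem s (wElt_mem 0 _ _)
    refine gs_ext (fun i j => ?_) ?_
    · rw [gsEntry_lie_homogeneous hd hx, add_zero, map_smul, smul_eq_mul]
      by_cases h : j - i = a
      · obtain rfl : i + a = j := by omega
        by_cases hij : (i : ℂ) = s ∨ ((i + a : ℤ) : ℂ) = s
        · rw [gsEntry_eq_zero x hij]; ring
        · rw [not_or] at hij
          rw [phiHat_entry s _ _ _ hij.1 hij.1, phiHat_entry s _ _ _ hij.2 hij.2, sub_self, sub_self,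
            wDeg, wElt_op, DiffOp.coeff_single, if_pos rfl, eval_X, eval_X]
          push_cast
          ring
      · rw [show gsEntry s i j x = 0 from hx.1 i j h]
        rw [show gsEntry s (i + a) j (phiHat s wDeg) = 0 from hd.1 _ _ (by omega)]
        ring
    · rw [gsCen_lie_homogeneous hd, map_smul, smul_eq_mul]
      rw [finsum_eq_zero_of_forall_eq_zero fun i => by simp]
      by_cases h : a = 0
      · simp [h]
      · rw [show gsCen s x = 0 from hx.2 h, mul_zero]

/-- The element `p_s(∑_j ξ(j) E_{j-k,j})` of `𝔤_s`. -/
def gsBand (s : ℂ) (k : ℤ) : (ℤ → ℂ) →ₗ[ℂ] gs s where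
  toFun ξ := ⟨GlHat.mk (projGl s ⟨fun i j => if j - i = k then ξ j else 0, k.natAbs, fun i j h => by
    refine if_neg ?_
    rintro rfl
    rw [Int.abs_eq_natAbs] at h
    exact lt_irrefl _ h⟩) 0, fun i j h => if_pos h⟩
  map_add' ξ η := by
    refine gs_ext (fun i j => ?_) ?_
    · change (projGl s _).1 i j = (projGl s _).1 i j + (projGl s _).1 i j
      simp only [projGl_apply, Pi.add_apply]
      split_ifs <;> simp
    · exact (add_zero (0 : ℂ)).symm
  map_smul' c ξ := by
    refine gs_ext (fun i j => ?_) ?_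
    · change (projGl s _).1 i j = c * (projGl s _).1 i j
      simp only [projGl_apply, Pi.smul_apply, smul_eq_mul]
      split_ifs <;> simp
    · exact (mul_zero c).symm

open Classical in
lemma gsEntry_gsBand (s : ℂ) (k : ℤ) (ξ : ℤ → ℂ) (i j : ℤ) : gsEntry s i j (gsBand s k ξ) =
    if (i : ℂ) = s ∨ (j : ℂ) = s then 0 else if j - i = k then ξ j else 0 := rfl

lemma gsCen_gsBand (s : ℂ) (k : ℤ) (ξ : ℤ → ℂ) : gsCen s (gsBand s k ξ) = 0 := rfl

lemma gsBand_mem (s : ℂ) (k : ℤ) (ξ : ℤ → ℂ) : gsBand s k ξ ∈ gsGrading s k := by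
  refine mem_gsGrading.2 ⟨fun i j h => ?_, fun _ => rfl⟩
  rw [gsEntry_gsBand, if_neg h, ite_self]

lemma eq_gsBand {s : ℂ} {k : ℤ} {x : gs s} (hx : x ∈ gsGrading s k) (hc : gsCen s x = 0) :
    x = gsBand s k fun j => gsEntry s (j - k) j x := by
  refine gs_ext (fun i j => ?_) (by rw [hc, gsCen_gsBand])
  rw [gsEntry_gsBand]
  split_ifs with h1 h2
  · exact gsEntry_eq_zero x h1
  · rw [show j - k = i by omega]
  · exact hx.1 i j h2

lemma gsBand_congr {s : ℂ} {k : ℤ} {ξ η : ℤ → ℂ}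
    (h : ∀ j : ℤ, (j : ℂ) ≠ s → ((j - k : ℤ) : ℂ) ≠ s → ξ j = η j) :
    gsBand s k ξ = gsBand s k η := by
  refine gs_ext (fun i j => ?_) rfl
  rw [gsEntry_gsBand, gsEntry_gsBand]
  split_ifs with h1 h2
  · rfl
  · rw [not_or] at h1
    exact h j h1.2 (by rw [show j - k = i by omega]; exact h1.1)
  · rfl

lemma phiHat_wElt (s : ℂ) {k : ℤ} (hk : k ≠ 0) (q : ℂ[X]) (hq : X ∣ q) :
    phiHat s (wElt k q hq) = gsBand s k fun j => q.eval (s - j) := by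
  refine gs_ext (fun i j => ?_) ?_
  · rw [gsEntry_gsBand]
    split_ifs with h1 h2
    · exact gsEntry_eq_zero _ h1
    · rw [not_or] at h1
      rw [phiHat_entry s _ _ _ h1.1 h1.2, wElt_op, DiffOp.coeff_single, if_pos h2.symm]
      congr 1; ring
    · rw [not_or] at h1
      rw [phiHat_entry s _ _ _ h1.1 h1.2, wElt_op, DiffOp.coeff_single, if_neg (Ne.symm h2),
        eval_zero]
  · rw [phiHat_cen, wElt_cen, wElt_op, DiffOp.coeff_single, if_neg hk, map_zero, add_zero,
      gsCen_gsBand]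

/-- Bracketing with a diagonal element multiplies a band by differences of the diagonal. By
`exists_sub_shift_eq` such differences are arbitrary when `k ≠ 0`, so a band can be multiplied by
any sequence. -/
lemma lie_gsBand_zero (s : ℂ) (k : ℤ) (δ ξ : ℤ → ℂ) :
    ⁅gsBand s 0 δ, gsBand s k ξ⁆ = gsBand s k fun j => (δ (j - k) - δ j) * ξ j := by
  refine gs_ext (fun i j => ?_) ?_
  · rw [gsEntry_lie_homogeneous (gsBand_mem s 0 δ) (gsBand_mem s k ξ)]
    simp only [gsEntry_gsBand, add_zero]
    by_cases h2 : j - i = k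
    · obtain rfl : i + k = j := by omega
      by_cases h1 : (i : ℂ) = s ∨ ((i + k : ℤ) : ℂ) = s
      · rw [if_pos h1, if_pos h1, mul_zero, zero_mul, sub_zero]
      · have h1' := not_or.1 h1
        simp only [h1'.1, h1'.2, or_self, if_false, sub_self, if_true, h2]
        rw [show i + k - k = i by ring]
        ring
    · simp only [h2, if_false, ite_self, mul_zero]
      rw [if_neg (show ¬ (j - (i + k) = 0) by omega)]
      simp
  · rw [gsCen_lie_homogeneous (gsBand_mem s 0 δ), gsCen_gsBand]
    exact finsum_eq_zero_of_forall_eq_zero fun i => by simp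

end GsGraded


/-! ### Generation of `𝔤_s` in non-zero degrees -/

/-- The solution `c` of `c(j) - c(j-1) = h(j)`, `c(0) = 0`. -/
def cumSum (h : ℤ → ℂ) (j : ℤ) : ℂ := ∑ i ∈ Finset.Ioc 0 j, h i - ∑ i ∈ Finset.Ioc j 0, h i

lemma cumSum_zero (h : ℤ → ℂ) : cumSum h 0 = 0 := by simp [cumSum]

lemma cumSum_sub (h : ℤ → ℂ) (j : ℤ) : cumSum h j - cumSum h (j - 1) = h j := by
  rw [cumSum, cumSum]
  rcases lt_or_ge 0 j with hj | hj
  · rw [Finset.Ioc_eq_empty (a := j) (by omega), Finset.Ioc_eq_empty (a := j - 1) (by omega),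
      show Finset.Ioc 0 j = insert j (Finset.Ioc 0 (j - 1)) by ext; simp; omega,
      Finset.sum_insert (by simp)]
    simp
  · rw [Finset.Ioc_eq_empty (a := 0) (by omega), Finset.Ioc_eq_empty (b := j - 1) (by omega),
      show Finset.Ioc (j - 1) 0 = insert j (Finset.Ioc j 0) by ext; simp; omega,
      Finset.sum_insert (by simp)]
    simp

lemma exists_sub_shift_eq {k : ℤ} (hk : k ≠ 0) (h : ℤ → ℂ) :
    ∃ δ : ℤ → ℂ, ∀ j, δ (j - k) - δ j = h j := by
  -- The shift by `k` preserves residue classes; on the class of `j % k` it becomes the shift by one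
  -- of the quotient `j / k`, where partial sums solve the equation.
  refine ⟨fun j => -cumSum (fun q => h (k * q + j % k)) (j / k), fun j => ?_⟩
  have h1 : (j - k) / k = j / k - 1 := by
    rw [Int.sub_ediv_of_dvd _ dvd_rfl, Int.ediv_self hk]
  have h2 : (j - k) % k = j % k := by simp
  simp only [h1, h2]
  have := cumSum_sub (fun q => h (k * q + j % k)) (j / k)
  simp only [Int.mul_ediv_add_emod] at this
  linear_combination this

/-- If `c` vanishes next to the erased row and column, the bracket of `p_s(∑ E_{i,i+1})` and
`∑ c(i) E_{i+1,i}` is diagonal with entries `c(i) - c(i-1)` and central coefficient `c(0)`. -/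
lemma lie_up_down (s : ℂ) (c : ℤ → ℂ)
    (hc : ∀ j : ℤ, (j : ℂ) = s ∨ ((j + 1 : ℤ) : ℂ) = s → c j = 0) (x : gs s)
    (hx : x ∈ gsGrading s 0) (hd : ∀ i : ℤ, (i : ℂ) ≠ s → gsEntry s i i x = c i - c (i - 1))
    (hz : gsCen s x = c 0) :
    ⁅gsBand s 1 fun _ => 1, gsBand s (-1) c⁆ = x := by
  have hdown : ∀ i, gsEntry s (i + 1) i (gsBand s (-1) c) = c i := by
    intro i
    rw [gsEntry_gsBand]
    split_ifs with h1 h2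
    · exact (hc i h1.symm).symm
    · rfl
    · omega
  have hup : ∀ i, gsEntry s i (i + 1) (gsBand s 1 fun _ => 1) * c i = c i := by
    intro i
    rw [gsEntry_gsBand]
    split_ifs with h1 h2
    · rw [hc i h1, mul_zero]
    · rw [one_mul]
    · omega
  refine gs_ext (fun i j => ?_) ?_
  · by_cases hij : j = i
    · subst hij
      rw [gsEntry_lie_homogeneous (gsBand_mem _ _ _) (gsBand_mem _ _ _), hdown, hup]
      have h1 := hdown (j - 1)
      have h2 := hup (j - 1)
      rw [sub_add_cancel] at h1 h2
      rw [← sub_eq_add_neg, h1, mul_comm, h2]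
      by_cases hj : (j : ℂ) = s
      · rw [gsEntry_eq_zero x (Or.inl hj), hc j (Or.inl hj), hc (j - 1) (Or.inr (by simpa using hj)),
          sub_zero]
      · rw [hd j hj]
    · have := (innerGraded_gsGrading s).lie_mem 1 (-1) _ _ (gsBand_mem s 1 fun _ => 1)
        (gsBand_mem s (-1) c)
      rw [show gsEntry s i j x = 0 from hx.1 i j (by omega)]
      exact this.1 i j (by omega)
  -- The commutator with `J` keeps only entries joining an index `≤ 0` to an index `> 0`; in degree
  -- one this is the entry `(0, 1)`.
  · rw [gsCen_lie_homogeneous (gsBand_mem _ _ _), finsum_eq_single _ 0]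
    · rw [hdown, mul_assoc, hup, hz]
      simp
    · intro i hi
      have : ((if i ≤ 0 then 1 else 0) - (if i + 1 ≤ 0 then 1 else 0) : ℂ) = 0 := by
        split_ifs <;> first | omega | simp
      rw [this, zero_mul, zero_mul]

/-- The central element `C` of `𝔤_s`. -/
def gsC (s : ℂ) : gs s := ⟨GlHat.mk 0 1, fun _ _ _ => rfl⟩

lemma gsEntry_gsC (s : ℂ) (i j : ℤ) : gsEntry s i j (gsC s) = 0 := rfl
lemma gsCen_gsC (s : ℂ) : gsCen s (gsC s) = 1 := rfl

/-- There is an integer such that no other integer can be equal to `s`. -/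
lemma exists_int_unique (s : ℂ) : ∃ σ : ℤ, ∀ j : ℤ, (j : ℂ) = s → j = σ := by
  by_cases h : ∃ σ : ℤ, (σ : ℂ) = s
  · obtain ⟨σ, rfl⟩ := h
    exact ⟨σ, fun j hj => by exact_mod_cast hj⟩
  · exact ⟨0, fun j hj => absurd ⟨j, hj⟩ h⟩

/-- The band of degree 2 is supported on the indices of parity opposite to `σ`, so it avoids the
erased row and column. Its products with the band of ones in either order agree, since parity is
unchanged by a shift by 2, and the matrix bracket vanishes. In the cocycle only `i = -1, 0`
contribute; exactly one of them has the right parity, which gives 1. -/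
lemma gsC_eq_lie (s : ℂ) : ∃ ξ : ℤ → ℂ, ⁅gsBand s 2 ξ, gsBand s (-2) fun _ => 1⁆ = gsC s := by
  obtain ⟨σ, hσ⟩ := exists_int_unique s
  refine ⟨fun j => if Odd (j - σ) then 1 else 0, ?_⟩
  have hne : ∀ i : ℤ, Odd (i - σ) → (i : ℂ) ≠ s := fun i hi h => by
    rw [hσ i h, sub_self] at hi
    exact absurd hi (by decide)
  have hodd : ∀ i : ℤ, Odd (i + 2 - σ) ↔ Odd (i - σ) := fun i => by
    rw [Int.odd_iff, Int.odd_iff]; omega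
  have hup : ∀ i, gsEntry s i (i + 2) (gsBand s 2 fun j => if Odd (j - σ) then 1 else 0) =
      if Odd (i - σ) then 1 else 0 := by
    intro i
    rw [gsEntry_gsBand]
    by_cases h : Odd (i - σ)
    · rw [if_neg (not_or.2 ⟨hne _ h, hne _ ((hodd i).2 h)⟩), if_pos (by omega), if_pos h,
        if_pos ((hodd i).2 h)]
    · rw [if_neg h, if_neg (fun h' => h ((hodd i).1 h')), ite_self, ite_self]
  have hdown : ∀ i, (if Odd (i - σ) then (1 : ℂ) else 0) *
      gsEntry s (i + 2) i (gsBand s (-2) fun _ => 1) = if Odd (i - σ) then 1 else 0 := by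
    intro i
    by_cases h : Odd (i - σ)
    · rw [gsEntry_gsBand, if_neg (not_or.2 ⟨hne _ ((hodd i).2 h), hne _ h⟩), if_pos h,
        if_pos (by omega), mul_one]
    · rw [if_neg h, zero_mul]
  refine gs_ext (fun i j => ?_) ?_
  · rw [gsEntry_gsC]
    by_cases hij : j = i
    · subst hij
      rw [gsEntry_lie_homogeneous (gsBand_mem _ _ _) (gsBand_mem _ _ _), hup, hdown]
      have h1 := hup (j - 2)
      have h2 := hdown (j - 2)
      rw [sub_add_cancel] at h1 h2
      rw [← sub_eq_add_neg, h1, mul_comm, h2]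
      have := hodd (j - 2)
      rw [sub_add_cancel] at this
      simp [this]
    · have := (innerGraded_gsGrading s).lie_mem 2 (-2) _ _
        (gsBand_mem s 2 fun j => if Odd (j - σ) then 1 else 0) (gsBand_mem s (-2) fun _ => 1)
      exact this.1 i j (by omega)
  · rw [gsCen_lie_homogeneous (gsBand_mem _ _ _), gsCen_gsC,
      finsum_eq_sum_of_support_subset (s := {-1, 0})]
    · rw [Finset.sum_pair (by decide), mul_assoc, mul_assoc, hup, hdown, hup, hdown]
      have : Odd (-1 - σ) ↔ ¬ Odd (0 - σ) := by rw [Int.odd_iff, Int.odd_iff]; omega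
      rw [if_congr this rfl rfl]
      by_cases h : Odd (0 - σ)
      · rw [if_pos h, if_neg (not_not.2 h)]; norm_num
      · rw [if_neg h, if_pos h]; norm_num
    · intro i hi
      rw [Function.mem_support] at hi
      by_contra hcon
      apply hi
      have : ((if i ≤ 0 then 1 else 0) - (if i + 2 ≤ 0 then 1 else 0) : ℂ) = 0 := by
        simp at hcon
        split_ifs <;> first | omega | simp
      rw [this, zero_mul, zero_mul]

/-- The centre is reached by `gsC_eq_lie`, and a diagonal matrix, up to a multiple of `C`, by
`lie_up_down` applied to partial sums of its diagonal. -/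
lemma eq_top_of_gsGrading_le (s : ℂ) (A : LieSubalgebra ℂ (gs s))
    (hA : ∀ k : ℤ, k ≠ 0 → ∀ x ∈ gsGrading s k, x ∈ A) : A = ⊤ := by
  have hC : gsC s ∈ A := by
    obtain ⟨ξ, h⟩ := gsC_eq_lie s
    rw [← h]
    exact A.lie_mem (hA 2 (by decide) _ (gsBand_mem _ _ _))
      (hA (-2) (by decide) _ (gsBand_mem _ _ _))
  have h0 : ∀ x ∈ gsGrading s 0, x ∈ A := by
    intro x hx
    obtain ⟨σ, hσ⟩ := exists_int_unique s
    -- Partial sums are normalized to vanish at `σ`. When `σ = s` the erased diagonal entry is 0, so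
    -- `c (σ - 1) = c σ = 0`, as `lie_up_down` demands.
    let c : ℤ → ℂ := fun j => cumSum (fun i => gsEntry s i i x) j -
      cumSum (fun i => gsEntry s i i x) σ
    have hsub : ∀ j, c j - c (j - 1) = gsEntry s j j x := fun j => by
      have := cumSum_sub (fun i => gsEntry s i i x) j
      simp only [c]
      linear_combination this
    have hc : ∀ j : ℤ, (j : ℂ) = s ∨ ((j + 1 : ℤ) : ℂ) = s → c j = 0 := by
      rintro j (hj | hj)
      · rw [hσ j hj]; simp [c]
      · have h1 := hsub (j + 1)
        rw [gsEntry_eq_zero x (Or.inl hj), hσ (j + 1) hj] at h1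
        have h2 : c σ = 0 := by simp [c]
        rw [h2, zero_sub, neg_eq_zero] at h1
        rw [show j = σ - 1 by have := hσ (j + 1) hj; omega]
        exact h1
    have hlie := lie_up_down s c hc (x - (gsCen s x - c 0) • gsC s)
      (Submodule.sub_mem _ hx (Submodule.smul_mem _ _
        ⟨fun _ _ _ => rfl, fun h => absurd rfl h⟩))
      (fun i _ => by rw [map_sub, map_smul, gsEntry_gsC, smul_zero, sub_zero, hsub])
      (by rw [map_sub, map_smul, gsCen_gsC, smul_eq_mul, mul_one, sub_sub_cancel])
    have hx' : x = ⁅gsBand s 1 fun _ => 1, gsBand s (-1) c⁆ +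
        (gsCen s x - c 0) • gsC s := by rw [hlie, sub_add_cancel]
    rw [hx']
    exact A.add_mem (A.lie_mem (hA 1 (by decide) _ (gsBand_mem _ _ _))
      (hA (-1) (by decide) _ (gsBand_mem _ _ _))) (A.smul_mem _ hC)
  refine eq_top_iff.2 fun x _ => ?_
  have hle : (⨆ k, gsGrading s k) ≤ A.toSubmodule := iSup_le fun k x hx => by
    by_cases hk : k = 0
    · subst hk; exact h0 x hx
    · exact hA k hk x hx
  rw [iSup_gsGrading] at hle
  exact hle Submodule.mem_top

/-! ### Submodules over `W_∞` of quasifinite modules -/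

lemma pi_lie_single {ι : Type*} [DecidableEq ι] (g : ι → Type*) [∀ i, LieRing (g i)] (i : ι)
    (x y : g i) : ⁅(Pi.single i x : ∀ i, g i), (Pi.single i y : ∀ i, g i)⁆ = Pi.single i ⁅x, y⁆ := by
  funext j
  change ⁅(Pi.single i x : ∀ i, g i) j, (Pi.single i y : ∀ i, g i) j⁆ = _
  by_cases hj : j = i
  · subst hj; simp
  · simp [hj]

/-- The elements of the `i`-th summand which lie in a given subalgebra. -/
def comapSingle {ι : Type*} [DecidableEq ι] (g : ι → Type*) [∀ i, LieRing (g i)]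
    [∀ i, LieAlgebra ℂ (g i)] (A : LieSubalgebra ℂ (∀ i, g i)) (i : ι) : LieSubalgebra ℂ (g i) where
  carrier := {y | Pi.single i y ∈ A}
  zero_mem' := by simp
  add_mem' := fun {x y} hx hy => by
    change Pi.single i (x + y) ∈ A
    rw [Pi.single_add]
    exact A.add_mem hx hy
  smul_mem' := fun c x hx => by
    change Pi.single i (c • x) ∈ A
    rw [Pi.single_smul]
    exact A.smul_mem c hx
  lie_mem' := fun {x y} hx hy => by
    change Pi.single i ⁅x, y⁆ ∈ A
    rw [← pi_lie_single]
    exact A.lie_mem hx hy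

section Vec

variable {m : ℕ} (s : Fin m → ℂ)

/-- The element of `𝔤_{s⃗}` with components `p_s(∑_j ξ_i(j) E_{j-k,j})`. -/
def vecBand (k : ℤ) : (Fin m → ℤ → ℂ) →ₗ[ℂ] gsVec s where
  toFun ξ i := gsBand (s i) k (ξ i)
  map_add' _ _ := _root_.funext fun _ => map_add _ _ _
  map_smul' c ξ := _root_.funext fun i => map_smul (gsBand (s i) k) c (ξ i)

lemma vecBand_mem (k : ℤ) (ξ : Fin m → ℤ → ℂ) : vecBand s k ξ ∈ gsVecGrading s k :=
  fun i _ => gsBand_mem (s i) k (ξ i)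

lemma eq_vecBand {k : ℤ} (hk : k ≠ 0) {x : gsVec s} (hx : x ∈ gsVecGrading s k) :
    ∃ ξ, x = vecBand s k ξ :=
  ⟨fun i j => gsEntry (s i) (j - k) j (x i), _root_.funext fun i =>
    eq_gsBand (hx i trivial) ((hx i trivial).2 hk)⟩

lemma phiHatVec_wElt {k : ℤ} (hk : k ≠ 0) (q : ℂ[X]) (hq : X ∣ q) :
    phiHatVec s (wElt k q hq) = vecBand s k fun i j => q.eval (s i - j) :=
  _root_.funext fun i => phiHat_wElt (s i) hk q hq

variable {s} {V : Type*} [AddCommGroup V] [Module ℂ V] [LieRingModule (gsVec s) V]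
  [LieModule ℂ (gsVec s) V] {grV : ℤ → Submodule ℂ V}

/-- On a finite-dimensional homogeneous component, bands of degree `k` multiplied by a suitable
polynomial act as zero. -/
lemma exists_annihilating_polynomial (hV : IsQuasifinite (gsVecGrading s) grV) {k : ℤ} (hk : k ≠ 0)
    (l : ℤ) : ∃ p : ℂ[X], p ≠ 0 ∧ ∀ η : Fin m → ℤ → ℂ, ∀ u ∈ grV l,
      ⁅vecBand s k fun i j => p.eval (s i - j) * η i j, u⁆ = 0 := by
  have := hV.finite l
  have := hV.finite (k + l)
  let ev : ℂ[X] →ₗ[ℂ] (Fin m → ℤ → ℂ) :=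
    { toFun := fun q i j => q.eval (s i - j)
      map_add' := fun p q => by ext; simp
      map_smul' := fun c p => by ext; simp }
  let Φ : ℂ[X] →ₗ[ℂ] (grV l →ₗ[ℂ] grV (k + l)) :=
    { toFun := fun q =>
        { toFun := fun u => ⟨⁅vecBand s k (ev q), (u : V)⁆,
            hV.lie_mem k l _ _ (vecBand_mem s k _) u.2⟩
          map_add' := fun u v => Subtype.ext (lie_add _ _ _)
          map_smul' := fun c u => Subtype.ext (lie_smul _ _ _) }
      map_add' := fun p q => LinearMap.ext fun u => Subtype.ext (by
        change ⁅vecBand s k (ev (p + q)), (u : V)⁆ = ⁅_, (u : V)⁆ + ⁅_, (u : V)⁆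
        rw [map_add, map_add, add_lie])
      map_smul' := fun c p => LinearMap.ext fun u => Subtype.ext (by
        change ⁅vecBand s k (ev (c • p)), (u : V)⁆ = c • ⁅_, (u : V)⁆
        rw [map_smul, map_smul, smul_lie]) }
  -- `ℂ[X]` is infinite-dimensional and the space of maps between two finite-dimensional components
  -- is not.
  have hker : ∃ p, p ≠ 0 ∧ Φ p = 0 := by
    by_contra hcon
    push Not at hcon
    have hinj : Function.Injective Φ := (injective_iff_map_eq_zero Φ).2 fun p hp => by
      by_contra hne
      exact hcon p hne hp
    have : Module.Finite ℂ ℂ[X] := Module.Finite.of_injective Φ hinj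
    exact Polynomial.not_finite this
  obtain ⟨p, hp, hΦ⟩ := hker
  have hp0 : ∀ u ∈ grV l, ⁅vecBand s k (ev p), u⁆ = 0 := fun u hu =>
    congrArg Subtype.val (LinearMap.congr_fun hΦ ⟨u, hu⟩)
  refine ⟨p, hp, fun η u hu => ?_⟩
  -- The factor `η` is produced by a bracket with the diagonal band `δ`. As `δ` has degree zero it
  -- preserves `grV l`, so both terms of the commutator still kill `u`.
  choose δ hδ using fun i => exists_sub_shift_eq hk (η i)
  have hb : (vecBand s k fun i j => p.eval (s i - j) * η i j) =
      ⁅vecBand s 0 δ, vecBand s k (ev p)⁆ := _root_.funext fun i => by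
    change _ = ⁅gsBand (s i) 0 (δ i), gsBand (s i) k (ev p i)⁆
    rw [lie_gsBand_zero]
    simp only [hδ]
    change gsBand (s i) k _ = _
    congr 1
    funext j
    exact mul_comm _ _
  have h0 := hV.lie_mem 0 l _ _ (vecBand_mem s 0 δ) hu
  rw [zero_add] at h0
  rw [hb, lie_lie, hp0 u hu, lie_zero, hp0 _ h0, sub_zero]

/-- For a fixed `u` there is a polynomial `P ≠ 0` such that every band divisible by the sequences
`P(s_i - j)` kills `u`. It thus suffices to match `ξ` with a polynomial at the zeros of `P`, a
finite interpolation problem. The element `w` depends on `u`, which is harmless for testing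
stability of a subspace. -/
lemma exists_phiHatVec_lie_eq (hs : Admissible s) (hV : IsQuasifinite (gsVecGrading s) grV) {k : ℤ}
    (hk : k ≠ 0) {x : gsVec s} (hx : x ∈ gsVecGrading s k) (u : V) :
    ∃ w : WInf, ⁅phiHatVec s w, u⁆ = ⁅x, u⁆ := by
  classical
  obtain ⟨ξ, rfl⟩ := eq_vecBand s hk hx
  choose p hp0 hp using fun l => exists_annihilating_polynomial hV hk l
  have hu : u ∈ ⨆ l, grV l := by
    rw [hV.internal.submodule_iSup_eq_top]; trivial
  obtain ⟨f, hf, hfu⟩ := (Submodule.mem_iSup_iff_exists_finsupp _ _).1 hu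
  let P : ℂ[X] := ∏ l ∈ f.support, p l
  have hP0 : P ≠ 0 := Finset.prod_ne_zero_iff.2 fun l _ => hp0 l
  have hP : ∀ η : Fin m → ℤ → ℂ, ⁅vecBand s k fun i j => P.eval (s i - j) * η i j, u⁆ = 0 := by
    intro η
    rw [← hfu, Finsupp.sum, lie_sum]
    refine Finset.sum_eq_zero fun l hl => ?_
    have := hp l (fun i j => (∏ l' ∈ f.support.erase l, p l').eval (s i - j) * η i j) (f l) (hf l)
    have he : P = p l * ∏ l' ∈ f.support.erase l, p l' := (Finset.mul_prod_erase _ _ hl).symm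
    simpa only [he, eval_mul, mul_assoc] using this
  -- The prescribed value at `z = s_i - j` is `ξ i j`. The point `z = 0` corresponds to an erased
  -- column, so the value 0 may be imposed there; it makes the interpolating polynomial divisible by
  -- `X`, as membership in `W_∞` requires.
  let r : ℂ → ℂ := fun z =>
    if h : z ≠ 0 ∧ ∃ ij : Fin m × ℤ, s ij.1 - ij.2 = z then ξ h.2.choose.1 h.2.choose.2 else 0
  have hr0 : r 0 = 0 := dif_neg (by simp)
  have hr : ∀ (i : Fin m) (j : ℤ), (j : ℂ) ≠ s i → r (s i - j) = ξ i j := by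
    intro i j hij
    have h : s i - j ≠ 0 ∧ ∃ ij : Fin m × ℤ, s ij.1 - ij.2 = s i - j :=
      ⟨sub_ne_zero.2 hij.symm, (i, j), rfl⟩
    have hc := h.2.choose_spec
    simp only [r]
    rw [dif_pos h]
    -- Admissibility enters here: a point cannot have the form `s_i - j` for two different `i`.
    have h1 : h.2.choose.1 = i := by
      by_contra hne
      refine hs.1 _ _ hne (h.2.choose.2 - j) ?_
      push_cast
      linear_combination hc
    rw [h1] at hc ⊢
    have h2 : h.2.choose.2 = j := by
      have : (h.2.choose.2 : ℂ) = j := by linear_combination -hc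
      exact_mod_cast this
    rw [h2]
  let S : Finset ℂ := insert 0 P.roots.toFinset
  let q : ℂ[X] := Lagrange.interpolate S id r
  have hq : ∀ z ∈ S, q.eval z = r z := fun z hz =>
    Lagrange.eval_interpolate_at_node r (Function.injective_id.injOn) hz
  have hqX : X ∣ q := by
    rw [X_dvd_iff, coeff_zero_eq_eval_zero, hq 0 (by simp [S]), hr0]
  refine ⟨wElt k q hqX, ?_⟩
  rw [phiHatVec_wElt s hk]
  -- Where `P(s_i - j) = 0` the two sequences agree, outside the erased column; elsewhere one may
  -- divide by `P(s_i - j)`.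
  have hdiff : vecBand s k ξ - (vecBand s k fun i j => q.eval (s i - j)) =
      vecBand s k fun i j => P.eval (s i - j) *
        ((ξ i j - q.eval (s i - j)) / P.eval (s i - j)) := by
    rw [← map_sub]
    funext i
    refine gsBand_congr fun j hj _ => ?_
    change ξ i j - q.eval (s i - j) = P.eval (s i - j) * _
    by_cases hz : P.eval (s i - j) = 0
    · rw [hz, zero_mul]
      have : s i - j ∈ S := by simp [S, hP0, hz]
      simp [hq _ this, hr i j hj]
    · rw [mul_div_cancel₀ _ hz]
  have := hP fun i j => (ξ i j - q.eval (s i - j)) / P.eval (s i - j)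
  rw [← hdiff, sub_lie, sub_eq_zero] at this
  exact this.symm

/-- A `W_∞`-submodule of a quasifinite `𝔤_{s⃗}`-module is a `𝔤_{s⃗}`-submodule. -/
theorem exists_lieSubmodule_of_restrict (hs : Admissible s)
    (hV : IsQuasifinite (gsVecGrading s) grV)
    (N : LieSubmodule ℂ WInf (Restrict (phiHatVec s) V)) :
    ∃ N' : LieSubmodule ℂ (gsVec s) V, ∀ v : V, v ∈ N' ↔ Restrict.of (phiHatVec s) V v ∈ N := by
  let P : Submodule ℂ V := N.toSubmodule.comap (Restrict.of (phiHatVec s) V).toLinearMap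
  have hW : ∀ (w : WInf) (u : V), u ∈ P → ⁅phiHatVec s w, u⁆ ∈ P := fun w u hu =>
    N.lie_mem (x := w) hu
  -- The stabilizer of `P` is a subalgebra. It contains all elements of non-zero degree of each
  -- summand, which generate that summand.
  let A : LieSubalgebra ℂ (gsVec s) :=
    { carrier := {x | ∀ u ∈ P, ⁅x, u⁆ ∈ P}
      zero_mem' := fun u _ => by simp
      add_mem' := fun {x y} hx hy u hu => by rw [add_lie]; exact P.add_mem (hx u hu) (hy u hu)
      smul_mem' := fun c x hx u hu => by rw [smul_lie]; exact P.smul_mem c (hx u hu)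
      lie_mem' := fun {x y} hx hy u hu => by
        rw [lie_lie]; exact P.sub_mem (hx _ (hy u hu)) (hy _ (hx u hu)) }
  have hA : ∀ k : ℤ, k ≠ 0 → ∀ x ∈ gsVecGrading s k, x ∈ A := by
    intro k hk x hx u hu
    obtain ⟨w, hw⟩ := exists_phiHatVec_lie_eq hs hV hk hx u
    rw [← hw]
    exact hW w u hu
  have hsingle : ∀ (i : Fin m) (y : gs (s i)), Pi.single i y ∈ A := by
    intro i
    have hB : comapSingle (fun i => gs (s i)) A i = ⊤ :=
      eq_top_of_gsGrading_le (s i) _ fun k hk x hx => by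
      refine hA k hk _ fun j _ => ?_
      by_cases hj : j = i
      · subst hj; simpa using hx
      · rw [Pi.single_eq_of_ne hj]; exact Submodule.zero_mem _
    intro y
    have : y ∈ comapSingle (fun i => gs (s i)) A i := by rw [hB]; trivial
    exact this
  refine ⟨{ P with lie_mem := fun {x u} hu => ?_ }, fun v => Iff.rfl⟩
  have hx : x ∈ A := by
    rw [← Finset.univ_sum_single x]
    exact A.toSubmodule.sum_mem fun i _ => hsingle i (x i)
  exact hx u hu

end Vec


/-! ### Tensor products of highest weight modules -/

section TensorModules

open scoped TensorProduct

/-! ### Tensor products of graded vector spaces and contractions. -/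

section Linear

variable {ι : Type*} {V : ι → Type*} [∀ i, AddCommGroup (V i)] [∀ i, Module ℂ (V i)]

lemma eq_top_of_tprod_mem (P : Submodule ℂ (⨂[ℂ] i, V i))
    (hP : ∀ w : ∀ i, V i, PiTensorProduct.tprod ℂ w ∈ P) : P = ⊤ := by
  refine top_le_iff.1 ?_
  rw [← PiTensorProduct.span_tprod_eq_top]
  refine Submodule.span_le.2 ?_
  rintro _ ⟨w, rfl⟩
  exact hP w

lemma slot_tprod [DecidableEq ι] (i : ι) (a : Module.End ℂ (V i)) (w : ∀ i, V i) :
    slot V i a (PiTensorProduct.tprod ℂ w) =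
      PiTensorProduct.tprod ℂ (Function.update w i (a (w i))) := by
  change PiTensorProduct.map _ _ = _
  rw [PiTensorProduct.map_tprod]
  congr 1
  funext j
  by_cases h : j = i
  · subst h; simp
  · simp [h]

variable [Fintype ι]

lemma tprod_ne_zero (v : ∀ i, V i) (hv : ∀ i, v i ≠ 0) : PiTensorProduct.tprod ℂ v ≠ 0 := by
  intro h
  have hex : ∀ i, ∃ f : Module.Dual ℂ (V i), f (v i) ≠ 0 := fun i => by
    by_contra hcon
    push Not at hcon
    exact hv i ((Module.forall_dual_apply_eq_zero_iff ℂ (v i)).1 hcon)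
  choose f hf using hex
  have := congrArg (PiTensorProduct.lift ((MultilinearMap.mkPiAlgebra ℂ ι ℂ).compLinearMap f)) h
  rw [PiTensorProduct.lift.tprod, map_zero] at this
  simp only [MultilinearMap.compLinearMap_apply, MultilinearMap.mkPiAlgebra_apply] at this
  exact Finset.prod_ne_zero_iff.2 (fun i _ => hf i) this

/-- The total degree `j` part of a tensor product of graded spaces. -/
def tensorGrading (F : ∀ i, ℤ → Submodule ℂ (V i)) (j : ℤ) : Submodule ℂ (⨂[ℂ] i, V i) :=
  Submodule.span ℂ {t | ∃ (e : ι → ℤ) (w : ∀ i, V i), (∀ i, w i ∈ F i (e i)) ∧ ∑ i, e i = j ∧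
    t = PiTensorProduct.tprod ℂ w}

/-- A positive total degree forces a positive degree in some slot, where the factor is zero. -/
lemma tensorGrading_pos (F : ∀ i, ℤ → Submodule ℂ (V i)) (hF : ∀ i j, 0 < j → F i j = ⊥) {j : ℤ}
    (hj : 0 < j) : tensorGrading F j = ⊥ := by
  refine le_bot_iff.1 (Submodule.span_le.2 ?_)
  rintro _ ⟨e, w, hw, he, rfl⟩
  rw [← he] at hj
  obtain ⟨i, -, hi⟩ := Finset.exists_lt_of_sum_lt (f := fun _ : ι => (0 : ℤ)) (by simpa using hj)
  have h := hw i
  rw [hF i _ hi] at h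
  exact (PiTensorProduct.tprod ℂ).map_coord_zero i ((Submodule.mem_bot ℂ).1 h)

variable [hι : DecidableEq ι]

/-- Induction on the set of slots in which arbitrary vectors are allowed, using linearity in one
slot at a time. -/
lemma tprod_mem_of_span (S : ∀ i, Set (V i)) (hS : ∀ i, Submodule.span ℂ (S i) = ⊤)
    (P : Submodule ℂ (⨂[ℂ] i, V i))
    (hP : ∀ w : ∀ i, V i, (∀ i, w i ∈ S i) → PiTensorProduct.tprod ℂ w ∈ P) (w : ∀ i, V i) :
    PiTensorProduct.tprod ℂ w ∈ P := by
  have key : ∀ (T : Finset ι) (w : ∀ i, V i), (∀ i ∉ T, w i ∈ S i) →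
      PiTensorProduct.tprod ℂ w ∈ P := by
    intro T
    induction T using Finset.induction_on with
    | empty => exact fun w hw => hP w fun i => hw i (by simp)
    | insert a T ha ih =>
      intro w hw
      let Q : Submodule ℂ (V a) := P.comap ((PiTensorProduct.tprod ℂ).toLinearMap w a)
      have hQ : Q = ⊤ := by
        refine top_le_iff.1 ?_
        rw [← hS a]
        refine Submodule.span_le.2 fun z hz => ?_
        change PiTensorProduct.tprod ℂ (Function.update w a z) ∈ P
        refine ih _ fun i hi => ?_
        by_cases hia : i = a
        · subst hia; simpa using hz
        · rw [Function.update_of_ne hia]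
          exact hw i (by simp [hi, hia])
      have h : w a ∈ Q := hQ ▸ Submodule.mem_top
      change PiTensorProduct.tprod ℂ (Function.update w a (w a)) ∈ P at h
      rwa [Function.update_eq_self] at h
  exact key Finset.univ w (by simp)

lemma iSup_tensorGrading (F : ∀ i, ℤ → Submodule ℂ (V i)) (hF : ∀ i, ⨆ j, F i j = ⊤) :
    ⨆ j, tensorGrading F j = ⊤ := by
  refine eq_top_of_tprod_mem _ (tprod_mem_of_span (fun i => ⋃ j, (F i j : Set (V i))) (fun i => ?_)
    _ fun w hw => ?_)
  · rw [Submodule.span_iUnion]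
    simpa using hF i
  · choose e he using fun i => Set.mem_iUnion.1 (hw i)
    exact Submodule.mem_iSup_of_mem (∑ i, e i) (Submodule.subset_span ⟨e, w, he, rfl, rfl⟩)

/-- Non-positive degrees with sum `j` all lie between `j` and 0, so finitely many tuples of degrees
occur, each giving the image of a tensor product of finite-dimensional spaces. -/
lemma finiteDimensional_tensorGrading (F : ∀ i, ℤ → Submodule ℂ (V i))
    (hF : ∀ i j, 0 < j → F i j = ⊥) (hfin : ∀ i j, FiniteDimensional ℂ (F i j)) (j : ℤ) :
    FiniteDimensional ℂ (tensorGrading F j) := by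
  let E : Finset (ι → ℤ) := Fintype.piFinset fun _ => Finset.Icc j 0
  let R : (ι → ℤ) → Submodule ℂ (⨂[ℂ] i, V i) := fun e =>
    LinearMap.range (PiTensorProduct.map fun i => (F i (e i)).subtype)
  have hle : tensorGrading F j ≤ E.sup R := by
    refine Submodule.span_le.2 ?_
    rintro _ ⟨e, w, hw, he, rfl⟩
    by_cases h : ∀ i, e i ≤ 0
    · have hE : e ∈ E := by
        refine Fintype.mem_piFinset.2 fun i => Finset.mem_Icc.2 ⟨?_, h i⟩
        rw [← he, ← Finset.add_sum_erase _ _ (Finset.mem_univ i)]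
        have := Finset.sum_nonpos (s := Finset.univ.erase i) fun k _ => h k
        omega
      refine (Finset.le_sup (f := R) hE) ⟨PiTensorProduct.tprod ℂ fun i => ⟨w i, hw i⟩, ?_⟩
      rw [PiTensorProduct.map_tprod]
      rfl
    · push Not at h
      obtain ⟨i, hi⟩ := h
      have h := hw i
      rw [hF i _ hi] at h
      rw [(PiTensorProduct.tprod ℂ).map_coord_zero i ((Submodule.mem_bot ℂ).1 h)]
      exact Submodule.zero_mem _
  have : ∀ e, FiniteDimensional ℂ (R e) := fun e => inferInstance
  have : FiniteDimensional ℂ (E.sup R : Submodule ℂ (⨂[ℂ] i, V i)) :=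
    Submodule.finiteDimensional_finset_sup E R
  exact Submodule.finiteDimensional_of_le hle

/-- The contraction of all slots but the `i`-th one with linear functionals. -/
def contraction (i : ι) (f : ∀ j, Module.Dual ℂ (V j)) : (⨂[ℂ] i, V i) →ₗ[ℂ] V i :=
  PiTensorProduct.lift
    { toFun := fun w => (∏ j ∈ Finset.univ.erase i, f j (w j)) • w i
      map_update_add' := fun {inst} w k x y => by
        obtain rfl : inst = hι := Subsingleton.elim _ _
        by_cases hk : k = i
        · subst hk
          simp only [Function.update_self, smul_add]
          congr 2 <;> exact Finset.prod_congr rfl fun j hj => by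
            rw [Function.update_of_ne (Finset.ne_of_mem_erase hj),
              Function.update_of_ne (Finset.ne_of_mem_erase hj)]
        · have hmem : k ∈ Finset.univ.erase i := Finset.mem_erase.2 ⟨hk, Finset.mem_univ k⟩
          have hp : ∀ z : V k, ∏ j ∈ Finset.univ.erase i, f j (Function.update w k z j) =
              f k z * ∏ j ∈ (Finset.univ.erase i).erase k, f j (w j) := fun z => by
            rw [← Finset.mul_prod_erase _ _ hmem, Function.update_self]
            congr 1
            exact Finset.prod_congr rfl fun j hj => by
              rw [Function.update_of_ne (Finset.ne_of_mem_erase hj)]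
          simp only [hp, Function.update_of_ne (Ne.symm hk), map_add, add_mul, add_smul]
      map_update_smul' := fun {inst} w k c x => by
        obtain rfl : inst = hι := Subsingleton.elim _ _
        by_cases hk : k = i
        · subst hk
          simp only [Function.update_self]
          rw [smul_comm]
          congr 2
          exact Finset.prod_congr rfl fun j hj => by
            rw [Function.update_of_ne (Finset.ne_of_mem_erase hj),
              Function.update_of_ne (Finset.ne_of_mem_erase hj)]
        · have hmem : k ∈ Finset.univ.erase i := Finset.mem_erase.2 ⟨hk, Finset.mem_univ k⟩
          have hp : ∀ z : V k, ∏ j ∈ Finset.univ.erase i, f j (Function.update w k z j) =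
              f k z * ∏ j ∈ (Finset.univ.erase i).erase k, f j (w j) := fun z => by
            rw [← Finset.mul_prod_erase _ _ hmem, Function.update_self]
            congr 1
            exact Finset.prod_congr rfl fun j hj => by
              rw [Function.update_of_ne (Finset.ne_of_mem_erase hj)]
          simp only [hp, Function.update_of_ne (Ne.symm hk), map_smul, smul_eq_mul, mul_assoc,
            mul_smul] }

lemma contraction_tprod (i : ι) (f : ∀ j, Module.Dual ℂ (V j)) (w : ∀ i, V i) :
    contraction i f (PiTensorProduct.tprod ℂ w) =
      (∏ j ∈ Finset.univ.erase i, f j (w j)) • w i := by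
  rw [contraction, PiTensorProduct.lift.tprod]
  rfl

/-- Contraction onto slot `i` commutes with operators in that slot, so a tensor killed by such an
operator has all its contractions killed by it. -/
lemma contraction_slot (i : ι) (f : ∀ j, Module.Dual ℂ (V j)) (a : Module.End ℂ (V i))
    (u : ⨂[ℂ] i, V i) : contraction i f (slot V i a u) = a (contraction i f u) := by
  have h : contraction i f ∘ₗ slot V i a = a ∘ₗ contraction i f := by
    refine PiTensorProduct.ext (MultilinearMap.ext fun w => ?_)
    simp only [LinearMap.compMultilinearMap_apply, LinearMap.comp_apply]
    rw [slot_tprod, contraction_tprod, contraction_tprod, map_smul, Function.update_self]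
    congr 1
    exact Finset.prod_congr rfl fun j hj => by
      rw [Function.update_of_ne (Finset.ne_of_mem_erase hj)]
  exact LinearMap.congr_fun h u

/-- A tensor all of whose contractions to the `i`-th slot are multiples of `v_i`, for every `i`, is
a multiple of the tensor product of the `v_i`. -/
lemma mem_span_tprod (v : ∀ i, V i) (hv : ∀ i, v i ≠ 0) (u : ⨂[ℂ] i, V i)
    (hu : ∀ i f, contraction i f u ∈ Submodule.span ℂ {v i}) :
    u ∈ Submodule.span ℂ {PiTensorProduct.tprod ℂ v} := by
  have hli : ∀ i, LinearIndepOn ℂ id ({v i} : Set (V i)) := fun i =>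
    LinearIndepOn.singleton (by simpa using hv i)
  let b := fun i => Module.Basis.extend (hli i)
  have hvmem : ∀ i, v i ∈ (hli i).extend (Set.subset_univ _) := fun i =>
    Module.Basis.subset_extend (hli i) rfl
  let o : ∀ i, (hli i).extend (Set.subset_univ _) := fun i => ⟨v i, hvmem i⟩
  have hbo : ∀ i, b i (o i) = v i := fun i => Module.Basis.extend_apply_self (hli i) (o i)
  let B := Basis.piTensorProduct b
  have hcoord : ∀ (p : ∀ i, (hli i).extend (Set.subset_univ _)) (i : ι) (u : ⨂[ℂ] i, V i),
      B.repr u p = (b i).repr (contraction i (fun j => (b j).coord (p j)) u) (p i) := by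
    intro p i u
    have h : (B.coord p) = (b i).coord (p i) ∘ₗ contraction i (fun j => (b j).coord (p j)) := by
      refine PiTensorProduct.ext (MultilinearMap.ext fun w => ?_)
      simp only [LinearMap.compMultilinearMap_apply, LinearMap.comp_apply]
      rw [contraction_tprod, map_smul, Module.Basis.coord_apply,
        Basis.piTensorProduct_repr_tprod_apply, smul_eq_mul, mul_comm,
        ← Finset.mul_prod_erase _ _ (Finset.mem_univ i)]
      rfl
    exact LinearMap.congr_fun h u
  -- If `p` differs from the index `o` of the tensor of the `v_i` in slot `i`, the coefficient is a
  -- coordinate other than that of `v i` of a contraction, which is a multiple of `v i`.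
  have hzero : ∀ p, p ≠ o → B.repr u p = 0 := by
    intro p hp
    obtain ⟨i, hi⟩ := Function.ne_iff.1 hp
    rw [hcoord p i]
    obtain ⟨c, hc⟩ := Submodule.mem_span_singleton.1 (hu i fun j => (b j).coord (p j))
    have hr : (b i).repr (v i) = Finsupp.single (o i) 1 := by
      have := (b i).repr_self (o i)
      rwa [hbo] at this
    rw [← hc, map_smul, hr, Finsupp.smul_apply, Finsupp.single_eq_of_ne hi, smul_zero]
  have hrepr : B.repr u = Finsupp.single o (B.repr u o) := by
    ext p
    by_cases hp : p = o
    · rw [hp, Finsupp.single_eq_same]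
    · rw [hzero p hp, Finsupp.single_eq_of_ne hp]
  have hBo : B o = PiTensorProduct.tprod ℂ v := by
    rw [Basis.piTensorProduct_apply]
    simp only [hbo]
  refine Submodule.mem_span_singleton.2 ⟨B.repr u o, ?_⟩
  rw [← hBo]
  conv_rhs => rw [← B.repr.symm_apply_apply u, hrepr, Module.Basis.repr_symm_single]

end Linear

/-! ### Outer tensor products of highest weight modules. -/

section Lie

variable {ι : Type*} [Fintype ι] [DecidableEq ι] {g : ι → Type*} [∀ i, LieRing (g i)]
  [∀ i, LieAlgebra ℂ (g i)] {V : ι → Type*} [∀ i, AddCommGroup (V i)] [∀ i, Module ℂ (V i)]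
  [∀ i, LieRingModule (g i) (V i)] [∀ i, LieModule ℂ (g i) (V i)]

lemma tensor_lie_eq (x : ∀ i, g i) (u : ⨂[ℂ] i, V i) :
    ⁅x, u⁆ = ∑ i, slot V i (LieModule.toEnd ℂ (g i) (V i) (x i)) u := by
  change tensorAction g V x u = _
  rw [tensorAction_apply, LinearMap.sum_apply]

lemma tensor_lie_tprod (x : ∀ i, g i) (w : ∀ i, V i) :
    ⁅x, PiTensorProduct.tprod ℂ w⁆ =
      ∑ i, PiTensorProduct.tprod ℂ (Function.update w i ⁅x i, w i⁆) := by
  rw [tensor_lie_eq]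
  exact Finset.sum_congr rfl fun i _ => slot_tprod i _ w

lemma tensor_single_lie (i : ι) (y : g i) (u : ⨂[ℂ] i, V i) :
    ⁅(Pi.single i y : ∀ i, g i), u⁆ = slot V i (LieModule.toEnd ℂ (g i) (V i) y) u := by
  rw [tensor_lie_eq, Finset.sum_eq_single i]
  · rw [Pi.single_eq_same]
  · intro j _ hj
    rw [Pi.single_eq_of_ne hj, map_zero, map_zero, LinearMap.zero_apply]
  · simp

lemma tensor_lie_tprod_eigen (x : ∀ i, g i) (w : ∀ i, V i) (c : ι → ℂ)
    (h : ∀ i, ⁅x i, w i⁆ = c i • w i) :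
    ⁅x, PiTensorProduct.tprod ℂ w⁆ = (∑ i, c i) • PiTensorProduct.tprod ℂ w := by
  rw [tensor_lie_tprod, Finset.sum_smul]
  refine Finset.sum_congr rfl fun i _ => ?_
  rw [h i, MultilinearMap.map_update_smul, Function.update_eq_self]

lemma lie_mem_tensorGrading (gr : ∀ i, ℤ → Submodule ℂ (g i)) (F : ∀ i, ℤ → Submodule ℂ (V i))
    (hF : ∀ i k j x u, x ∈ gr i k → u ∈ F i j → ⁅x, u⁆ ∈ F i (k + j)) {k j : ℤ} {x : ∀ i, g i}
    (hx : ∀ i, x i ∈ gr i k) {u : ⨂[ℂ] i, V i} (hu : u ∈ tensorGrading F j) :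
    ⁅x, u⁆ ∈ tensorGrading F (k + j) := by
  have h : tensorGrading F j ≤ (tensorGrading F (k + j)).comap (tensorAction g V x) := by
    refine Submodule.span_le.2 ?_
    rintro _ ⟨e, w, hw, he, rfl⟩
    change ⁅x, PiTensorProduct.tprod ℂ w⁆ ∈ tensorGrading F (k + j)
    rw [tensor_lie_tprod]
    refine Submodule.sum_mem _ fun i _ => Submodule.subset_span
      ⟨Function.update e i (k + e i), _, fun a => ?_, ?_, rfl⟩
    · by_cases ha : a = i
      · subst ha
        simp only [Function.update_self]
        exact hF _ _ _ _ _ (hx _) (hw _)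
      · simp only [Function.update_of_ne ha]
        exact hw a
    · rw [Finset.sum_update_of_mem (Finset.mem_univ i), ← he, add_assoc,
        ← Finset.add_sum_erase _ _ (Finset.mem_univ i), Finset.sdiff_singleton_eq_erase]
  exact h hu

variable {gr : ∀ i, ℤ → Submodule ℂ (g i)} {d : ∀ i, g i} {lam : ∀ i, Module.Dual ℂ (gr i 0)}
  {v : ∀ i, V i}

lemma tensorGrading_le_wt (hg : ∀ i, InnerGraded (gr i) (d i)) (j : ℤ) :
    tensorGrading (fun i => wt (V i) (d i) (lam i ⟨d i, (hg i).mem_zero⟩)) j ≤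
      wt (⨂[ℂ] i, V i) d (∑ i, lam i ⟨d i, (hg i).mem_zero⟩) j := by
  refine Submodule.span_le.2 ?_
  rintro _ ⟨e, w, hw, he, rfl⟩
  refine mem_wt.2 ?_
  rw [tensor_lie_tprod_eigen d w _ fun i => mem_wt.1 (hw i), Finset.sum_add_distrib, ← he]
  push_cast
  rfl

/-- With the other factors fixed, the vectors that can be put into slot `a` without leaving `N` form
a submodule of `V a`. It contains `v a`, so it is everything; the slots are freed one by one. -/
lemma tensor_eq_top_of_tprod_mem (hv : ∀ i, IsHighestWeight (gr i) (lam i) (v i))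
    (N : LieSubmodule ℂ (∀ i, g i) (⨂[ℂ] i, V i)) (h : PiTensorProduct.tprod ℂ v ∈ N) : N = ⊤ := by
  have key : ∀ (T : Finset ι) (w : ∀ i, V i), (∀ i ∉ T, w i = v i) →
      PiTensorProduct.tprod ℂ w ∈ N := by
    intro T
    induction T using Finset.induction_on with
    | empty =>
      intro w hw
      obtain rfl : w = v := funext fun i => hw i (by simp)
      exact h
    | insert a T ha ih =>
      intro w hw
      let Q : LieSubmodule ℂ (g a) (V a) :=
        { N.toSubmodule.comap ((PiTensorProduct.tprod ℂ).toLinearMap w a) with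
          lie_mem := fun {y z} hz => by
            change PiTensorProduct.tprod ℂ (Function.update w a ⁅y, z⁆) ∈ N
            have h1 : ⁅(Pi.single a y : ∀ i, g i),
                PiTensorProduct.tprod ℂ (Function.update w a z)⁆ ∈ N := N.lie_mem hz
            rw [tensor_single_lie, slot_tprod, Function.update_idem, Function.update_self] at h1
            exact h1 }
      have hQ : Q = ⊤ := (hv a).generates Q (ih _ fun i hi => by
        by_cases hia : i = a
        · subst hia; simp
        · rw [Function.update_of_ne hia]
          exact hw i (by simp [hi, hia]))
      have h' : w a ∈ Q := by rw [hQ]; trivial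
      change PiTensorProduct.tprod ℂ (Function.update w a (w a)) ∈ N at h'
      rwa [Function.update_eq_self] at h'
  have : N.toSubmodule = ⊤ := eq_top_of_tprod_mem _ fun w => key Finset.univ w (by simp)
  exact (LieSubmodule.toSubmodule_eq_top N).1 this

/-- The outer tensor product of irreducible highest weight modules is irreducible. -/
theorem tensor_isIrreducible (hg : ∀ i, InnerGraded (gr i) (d i))
    (hv : ∀ i, IsHighestWeight (gr i) (lam i) (v i)) (hv0 : ∀ i, v i ≠ 0)
    (hirr : ∀ i, LieModule.IsIrreducible ℂ (g i) (V i)) :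
    LieModule.IsIrreducible ℂ (∀ i, g i) (⨂[ℂ] i, V i) := by
  have : Nontrivial (⨂[ℂ] i, V i) := ⟨_, 0, tprod_ne_zero v hv0⟩
  refine LieModule.IsIrreducible.mk fun N hN => ?_
  set F : ∀ i, ℤ → Submodule ℂ (V i) := fun i => wt (V i) (d i) (lam i ⟨d i, (hg i).mem_zero⟩)
  have hgraded := le_iSup_inf_of_stable (LieModule.toEnd ℂ (∀ i, g i) (⨂[ℂ] i, V i) d)
    (∑ i, lam i ⟨d i, (hg i).mem_zero⟩) (tensorGrading F) (tensorGrading_le_wt hg)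
    (iSup_tensorGrading F fun i => (hv i).iSup_wt_eq_top (hg i)) N.toSubmodule
    (fun u hu => N.lie_mem hu)
  have hex : ∃ j, N.toSubmodule ⊓ tensorGrading F j ≠ ⊥ := by
    by_contra hcon
    push Not at hcon
    simp only [hcon, iSup_bot] at hgraded
    exact hN ((LieSubmodule.toSubmodule_eq_bot N).1 (le_bot_iff.1 hgraded))
  -- Degrees in the tensor product are bounded by 0, so there is a largest degree in which `N` is
  -- non-zero. Elements of positive degree in any slot kill the vectors of `N` there, whose
  -- contractions are then singular in the irreducible factors.
  obtain ⟨j, hj, hmax⟩ := Int.exists_greatest_of_bdd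
    (P := fun j => N.toSubmodule ⊓ tensorGrading F j ≠ ⊥) ⟨0, fun j hj => by
      by_contra hlt
      exact hj (by rw [tensorGrading_pos F (fun i j hj => (hv i).wt_pos (hg i) hj) (not_le.1 hlt),
        inf_bot_eq])⟩ hex
  obtain ⟨u, hu, hu0⟩ := Submodule.exists_mem_ne_zero_of_ne_bot hj
  have hsing : u ∈ Submodule.span ℂ {PiTensorProduct.tprod ℂ v} := by
    refine mem_span_tprod v hv0 u fun i f => ?_
    have := hirr i
    refine (hv i).mem_span_of_singular (hg i) (hv0 i) fun k hk x hx => ?_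
    have hzero : ⁅(Pi.single i x : ∀ i, g i), u⁆ = 0 := by
      have h1 : ⁅(Pi.single i x : ∀ i, g i), u⁆ ∈ N.toSubmodule ⊓ tensorGrading F (k + j) := by
        refine ⟨N.lie_mem hu.1, lie_mem_tensorGrading gr F
          (fun i k j x u hx hu => (hg i).lie_mem_wt hx hu) (fun a => ?_) hu.2⟩
        by_cases ha : a = i
        · subst ha; simpa using hx
        · rw [Pi.single_eq_of_ne ha]; exact Submodule.zero_mem _
      by_contra hne
      have := hmax (k + j) fun hbot => hne (by rw [hbot] at h1; exact h1)
      omega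
    rw [tensor_single_lie] at hzero
    have := contraction_slot i f (LieModule.toEnd ℂ (g i) (V i) x) u
    rw [hzero, map_zero] at this
    exact this.symm
  obtain ⟨c, hc⟩ := Submodule.mem_span_singleton.1 hsing
  have hc0 : c ≠ 0 := by rintro rfl; exact hu0 (by rw [← hc, zero_smul])
  refine tensor_eq_top_of_tprod_mem hv N ?_
  have := N.toSubmodule.smul_mem c⁻¹ hu.1
  rwa [← hc, smul_smul, inv_mul_cancel₀ hc0, one_smul] at this

end Lie

end TensorModules


/-! ### The tensor product modules over `W_∞` -/

section TensorHWModules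

variable {m : ℕ} (s : Fin m → ℂ) (lam : ∀ i, Module.Dual ℂ (gsGrading (s i) 0))

/-- The gradation of the tensor product of irreducible highest weight modules. -/
def tensorHWGrading : ℤ → Submodule ℂ (TensorHW s lam) :=
  tensorGrading fun i => wt (IrrHW (gsGrading (s i)) (lam i)) (phiHat (s i) wDeg)
    (lam i ⟨phiHat (s i) wDeg, (innerGraded_gsGrading (s i)).mem_zero⟩)

lemma tensorHWGrading_le_wt (j : ℤ) : tensorHWGrading s lam j ≤ wt (TensorHW s lam)
    (phiHatVec s wDeg) (∑ i, lam i ⟨phiHat (s i) wDeg, (innerGraded_gsGrading (s i)).mem_zero⟩) j :=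
  tensorGrading_le_wt (fun i => innerGraded_gsGrading (s i)) j

lemma iSup_tensorHWGrading : ⨆ j, tensorHWGrading s lam j = ⊤ :=
  iSup_tensorGrading _ fun i =>
    (IrrHW.isHighestWeight _ (lam i)).iSup_wt_eq_top (innerGraded_gsGrading (s i))

variable {s lam}

lemma isQuasifinite_tensorHWGrading (hq : ∀ i, QuasifiniteWeight (gsGrading (s i)) (lam i)) :
    IsQuasifinite (gsVecGrading s) (tensorHWGrading s lam) where
  internal := isInternal_of_le_eigenspace _ _ _ (tensorHWGrading_le_wt s lam)
    (iSup_tensorHWGrading s lam)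
  lie_mem k j x u hx hu := lie_mem_tensorGrading (fun i => gsGrading (s i)) _
    (fun i _ _ _ _ hx hu => (innerGraded_gsGrading (s i)).lie_mem_wt hx hu)
    (fun i => hx i trivial) hu
  finite j := finiteDimensional_tensorGrading _
    (fun i _ hj => (IrrHW.isHighestWeight _ (lam i)).wt_pos (innerGraded_gsGrading (s i)) hj)
    (fun i j => by
      rw [← IrrHW.grading_eq_wt _ (lam i) (innerGraded_gsGrading (s i)) j]
      exact (hq i).finite j) j

/-- A tensor product of quasifinite irreducible modules is irreducible over `W_∞`. -/
theorem restrict_tensorHW_isIrreducible (hs : Admissible s)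
    (hq : ∀ i, QuasifiniteWeight (gsGrading (s i)) (lam i)) :
    LieModule.IsIrreducible ℂ WInf (Restrict (phiHatVec s) (TensorHW s lam)) := by
  have hirr : LieModule.IsIrreducible ℂ (gsVec s) (TensorHW s lam) :=
    tensor_isIrreducible (fun i => innerGraded_gsGrading (s i))
      (fun i => IrrHW.isHighestWeight _ (lam i))
      (fun i => IrrHW.vec_ne_zero _ (lam i) (innerGraded_gsGrading (s i)))
      (fun i => IrrHW.isIrreducible _ (lam i) (innerGraded_gsGrading (s i)))
  have hnt : Nontrivial (TensorHW s lam) := LieModule.nontrivial_of_isIrreducible ℂ (gsVec s) _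
  have : Nontrivial (Restrict (phiHatVec s) (TensorHW s lam)) := hnt
  refine LieModule.IsIrreducible.mk fun N hN => ?_
  obtain ⟨N', hN'⟩ := exists_lieSubmodule_of_restrict hs (isQuasifinite_tensorHWGrading hq) N
  have h : N' = ⊤ := by
    refine (eq_bot_or_eq_top N').resolve_left fun h => hN ?_
    rw [LieSubmodule.eq_bot_iff] at h ⊢
    exact fun u hu => h u ((hN' u).2 hu)
  refine eq_top_iff.2 fun u _ => (hN' u).1 ?_
  rw [h]; trivial

variable (s lam) in
/-- The highest weight of the tensor product as a `W_∞`-module. -/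
def pullbackWeight : Module.Dual ℂ (wGrading 0) :=
  ∑ i, lam i ∘ₗ (phiHat (s i)).toLinearMap.restrict fun _ hw => phiHat_mem (s i) hw

lemma pullbackWeight_apply (h : wGrading 0) :
    pullbackWeight s lam h = ∑ i, lam i ⟨phiHat (s i) h, phiHat_mem (s i) h.2⟩ := by
  rw [pullbackWeight, LinearMap.sum_apply]
  rfl

/-- The tensor product of the highest weight vectors is a highest weight vector for `W_∞` because
each `φ̂_{s_i}` preserves degrees; that it generates is part of the irreducibility over `W_∞`. -/
theorem nonempty_equiv_restrict (hs : Admissible s)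
    (hq : ∀ i, QuasifiniteWeight (gsGrading (s i)) (lam i)) :
    Nonempty (IrrHW wGrading (pullbackWeight s lam) ≃ₗ⁅ℂ,WInf⁆
      Restrict (phiHatVec s) (TensorHW s lam)) := by
  have hirr := restrict_tensorHW_isIrreducible hs hq
  let v : ∀ i, IrrHW (gsGrading (s i)) (lam i) := fun i => IrrHW.vec _ (lam i)
  have hv : ∀ i, IsHighestWeight (gsGrading (s i)) (lam i) (v i) :=
    fun i => IrrHW.isHighestWeight _ (lam i)
  have hv0 : PiTensorProduct.tprod ℂ v ≠ 0 := tprod_ne_zero v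
    fun i => IrrHW.vec_ne_zero _ (lam i) (innerGraded_gsGrading (s i))
  have hw : IsHighestWeight wGrading (pullbackWeight s lam)
      (Restrict.of (phiHatVec s) (TensorHW s lam) (PiTensorProduct.tprod ℂ v)) := by
    refine ⟨fun h => ?_, fun j hj x hx => ?_, fun N hN => ?_⟩
    · rw [Restrict.lie_of, pullbackWeight_apply, ← map_smul]
      exact congrArg _ (tensor_lie_tprod_eigen (phiHatVec s h) v _ fun i =>
        (hv i).lie_zero ⟨phiHat (s i) h, phiHat_mem (s i) h.2⟩)
    · have h := tensor_lie_tprod_eigen (phiHatVec s x) v (fun _ => 0) fun i => by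
        rw [zero_smul]
        exact (hv i).lie_pos j hj _ (phiHat_mem (s i) hx)
      rw [Finset.sum_const_zero, zero_smul] at h
      rw [Restrict.lie_of, h, map_zero]
    · refine (eq_bot_or_eq_top N).resolve_left fun h => hv0 ?_
      rw [h, LieSubmodule.mem_bot] at hN
      exact hN
  exact hw.nonempty_equiv innerGraded_wGrading hv0

/-- The isomorphism commutes with `D`, so it embeds each eigenspace of `D` into the corresponding
component of the tensor product, which is finite-dimensional. -/
theorem quasifiniteWeight_pullbackWeight (hs : Admissible s)
    (hq : ∀ i, QuasifiniteWeight (gsGrading (s i)) (lam i)) :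
    QuasifiniteWeight wGrading (pullbackWeight s lam) := by
  obtain ⟨e⟩ := nonempty_equiv_restrict hs hq
  refine IrrHW.quasifiniteWeight_of_finite _ _ innerGraded_wGrading fun j => ?_
  have hfin := (isQuasifinite_tensorHWGrading hq).finite j
  have hmem : ∀ u ∈ wt (IrrHW wGrading (pullbackWeight s lam)) wDeg
      (pullbackWeight s lam ⟨wDeg, innerGraded_wGrading.mem_zero⟩) j,
      (e u : TensorHW s lam) ∈ tensorHWGrading s lam j := by
    intro u hu
    rw [eq_eigenspace_of_iSup_eq_top _ _ _ (tensorHWGrading_le_wt s lam)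
      (iSup_tensorHWGrading s lam) j]
    refine (mem_wt (V := TensorHW s lam) (d := phiHatVec s wDeg)).2 ?_
    have h := congrArg e (mem_wt.1 hu)
    rw [pullbackWeight_apply] at h
    exact (LieModuleHom.map_lie e.toLieModuleHom wDeg u).symm.trans
      (h.trans (map_smul e.toLieModuleHom _ u))
  let f : wt (IrrHW wGrading (pullbackWeight s lam)) wDeg
      (pullbackWeight s lam ⟨wDeg, innerGraded_wGrading.mem_zero⟩) j →ₗ[ℂ]
      tensorHWGrading s lam j :=
    { toFun := fun u => ⟨e u.1, hmem u.1 u.2⟩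
      map_add' := fun u w => Subtype.ext (map_add e.toLieModuleHom u.1 w.1)
      map_smul' := fun c u => Subtype.ext (map_smul e.toLieModuleHom c u.1) }
  refine Module.Finite.of_injective f fun a b hab => Subtype.ext (e.injective ?_)
  exact congrArg Subtype.val hab

end TensorHWModules


/-! ### Weights with exponential generating series -/

section GeneratingSeries

lemma divX_mul (F G : PowerSeries ℂ) (hG : PowerSeries.constantCoeff G = 0) :
    divX (F * G) = F * divX G := by
  have h : PowerSeries.X * divX (F * G) = PowerSeries.X * (F * divX G) := by
    rw [X_mul_divX _ (by rw [map_mul, hG, mul_zero]), mul_left_comm, X_mul_divX _ hG]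
  exact mul_left_cancel₀ PowerSeries.X_ne_zero h

lemma divExpSubOne_mul_exp_sub_one (F : PowerSeries ℂ) :
    divExpSubOne (F * (PowerSeries.exp ℂ - 1)) = F := by
  have h : PowerSeries.constantCoeff (divX (PowerSeries.exp ℂ - 1)) ≠ 0 := by
    simp [divX, ← PowerSeries.coeff_zero_eq_constantCoeff_apply, PowerSeries.coeff_exp,
      PowerSeries.coeff_one]
  rw [divExpSubOne, divX_mul _ _ (by simp), mul_assoc, PowerSeries.mul_inv_cancel _ h, mul_one]

lemma divExpSubOne_sub (F G : PowerSeries ℂ) :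
    divExpSubOne (F - G) = divExpSubOne F - divExpSubOne G := by
  rw [divExpSubOne, divExpSubOne, divExpSubOne, ← sub_mul]
  congr 1

lemma divExpSubOne_one : divExpSubOne 1 = 0 := by
  have h : divX 1 = 0 := by
    ext n
    simp [divX, PowerSeries.coeff_one]
  rw [divExpSubOne, h, zero_mul]

lemma divExpSubOne_sum_smul {α : Type*} (T : Finset α) (n : α → ℂ) (F : α → PowerSeries ℂ) :
    divExpSubOne (∑ a ∈ T, n a • F a) = ∑ a ∈ T, n a • divExpSubOne (F a) := by
  simp only [divExpSubOne, ← smul_mul_assoc, ← Finset.sum_mul]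
  congr 1
  ext k
  simp [divX]

lemma genFunctional_sum_smul {α : Type*} (T : Finset α) (n : α → ℂ) (F : α → PowerSeries ℂ)
    (q : ℂ[X]) :
    genFunctional (∑ a ∈ T, n a • F a) q = ∑ a ∈ T, n a * genFunctional (F a) q := by
  induction q using Polynomial.induction_on' with
  | add p q hp hq => simp only [map_add, hp, hq, mul_add, Finset.sum_add_distrib]
  | monomial k c =>
    simp only [genFunctional_monomial, map_sum, map_smul, smul_eq_mul, Finset.mul_sum]
    exact Finset.sum_congr rfl fun a _ => by ring

lemma constantCoeff_expSeries (r : ℂ) : PowerSeries.constantCoeff (expSeries r) = 1 := by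
  rw [← PowerSeries.coeff_zero_eq_constantCoeff_apply, expSeries, PowerSeries.coeff_rescale]
  simp

lemma expSeries_zero : expSeries 0 = 1 := by simp [expSeries]

lemma expSeries_add_one (r : ℂ) : expSeries (r + 1) = expSeries r * PowerSeries.exp ℂ := by
  have h := PowerSeries.exp_mul_exp_eq_exp_add (A := ℂ) r 1
  rw [PowerSeries.rescale_one] at h
  exact h.symm

lemma kappa_eq (r : ℂ) : kappa r = -genFunctional (divExpSubOne (expSeries r)) := by
  rw [kappa, divExpSubOne_sub, divExpSubOne_one, sub_zero]

lemma kappa_zero : kappa 0 = 0 := by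
  refine LinearMap.ext fun q => ?_
  rw [kappa_eq, expSeries_zero, divExpSubOne_one, LinearMap.neg_apply]
  have := genFunctional_sub 0 0 q
  rw [sub_zero, sub_self] at this
  rw [this, neg_zero, LinearMap.zero_apply]

/-- This is `e^{(r+1)x} - e^{rx} = e^{rx}(e^x - 1)` divided by `e^x - 1`. It makes `i ↦ κ_{s-i}(q)`
a discrete antiderivative of the diagonal entries `q(s - i)` of `φ̂_s(q(D))`. -/
lemma kappa_sub_kappa_add_one (r : ℂ) (q : ℂ[X]) : kappa r q - kappa (r + 1) q = q.eval r := by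
  rw [kappa_eq, kappa_eq, LinearMap.neg_apply, LinearMap.neg_apply, sub_neg_eq_add, neg_add_eq_sub,
    ← genFunctional_sub, ← divExpSubOne_sub, expSeries_add_one]
  rw [show expSeries r * PowerSeries.exp ℂ - expSeries r =
    expSeries r * (PowerSeries.exp ℂ - 1) by ring, divExpSubOne_mul_exp_sub_one, genFunctional_exp]

lemma kappa_one {q : ℂ[X]} (hq : X ∣ q) : kappa 1 q = 0 := by
  have h := kappa_sub_kappa_add_one 0 q
  rw [kappa_zero, zero_add, ← coeff_zero_eq_eval_zero, X_dvd_iff.1 hq, LinearMap.zero_apply,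
    zero_sub, neg_eq_zero] at h
  exact h

/-- The map `f ↦ f(D) D`. -/
def wDiag : ℂ[X] →ₗ[ℂ] wGrading 0 where
  toFun f := ⟨wElt 0 (f * X) (dvd_mul_left _ _), wElt_mem 0 _ _⟩
  map_add' f g := Subtype.ext (Subtype.ext (W1Inf.ext' (by
    change DiffOp.single 0 ((f + g) * X) = DiffOp.single 0 (f * X) + DiffOp.single 0 (g * X)
    rw [add_mul, DiffOp.single_add]) (add_zero (0 : ℂ)).symm))
  map_smul' c f := Subtype.ext (Subtype.ext (W1Inf.ext' (by
    change DiffOp.single 0 ((c • f) * X) = c • DiffOp.single 0 (f * X)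
    rw [smul_mul_assoc, DiffOp.single_smul]) (mul_zero c).symm))

lemma wDiag_X_pow (l : ℕ) : wDiag (X ^ l) = diagElt l := rfl

lemma genFunctional_X_pow_mul_X (F : PowerSeries ℂ) (l : ℕ) : genFunctional F (X ^ l * X) =
    (l.factorial : ℂ) * PowerSeries.coeff l (PowerSeries.derivative ℂ F) := by
  rw [← pow_succ, ← monomial_one_right_eq_X_pow, genFunctional_monomial,
    PowerSeries.coeff_derivative, Nat.factorial_succ]
  push_cast
  ring

/-- The extra factor `D` in the labels corresponds to the derivative: `l!` times the `l`-th
coefficient of `F'` is the value of the functional of `F` at `w^{l+1}`. The constant term of `F`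
plays no role on either side. -/
lemma deltaSeries_eq_derivative_iff (lam : Module.Dual ℂ (wGrading 0)) (F : PowerSeries ℂ) :
    deltaSeries lam = PowerSeries.derivative ℂ F ↔
      ∀ (q : ℂ[X]) (hq : X ∣ q), lam ⟨wElt 0 q hq, wElt_mem 0 q hq⟩ = -genFunctional F q := by
  have hfac : ∀ l : ℕ, (l.factorial : ℂ) ≠ 0 := fun l => by exact_mod_cast l.factorial_ne_zero
  constructor
  · intro h q hq
    have hf : ∀ f, lam (wDiag f) = -genFunctional F (f * X) := by
      intro f
      induction f using Polynomial.induction_on' with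
      | add f g hf hg => rw [map_add, map_add, hf, hg, add_mul, map_add, neg_add]
      | monomial l c =>
        rw [← mul_one c, ← smul_eq_mul, ← smul_monomial, monomial_one_right_eq_X_pow, map_smul,
          map_smul, smul_mul_assoc, map_smul, wDiag_X_pow, genFunctional_X_pow_mul_X, ← h,
          deltaSeries, PowerSeries.coeff_mk, mul_div_cancel₀ _ (hfac l), smul_neg, neg_neg]
    obtain ⟨f, rfl⟩ := hq
    simp only [mul_comm X f]
    exact hf f
  · intro h
    ext l
    have := h (X ^ l * X) (dvd_mul_left _ _)
    rw [genFunctional_X_pow_mul_X] at this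
    rw [deltaSeries, PowerSeries.coeff_mk, div_eq_iff (hfac l), ← wDiag_X_pow]
    refine (congrArg Neg.neg this).trans ?_
    ring

lemma neg_genFunctional_sum {α : Type*} (T : Finset α) (n r : α → ℂ) (q : ℂ[X]) :
    -genFunctional (divExpSubOne (∑ a ∈ T, n a • expSeries (r a))) q =
      ∑ a ∈ T, n a * kappa (r a) q := by
  rw [divExpSubOne_sum_smul, genFunctional_sum_smul, ← Finset.sum_neg_distrib]
  refine Finset.sum_congr rfl fun a _ => ?_
  rw [kappa_eq, LinearMap.neg_apply, mul_neg]

lemma HasExponentialPhi.exists_kappa {lam : Module.Dual ℂ (wGrading 0)}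
    (h : HasExponentialPhi lam) : ∃ (p : ℕ) (n r : Fin p → ℂ), ∀ (q : ℂ[X]) (hq : X ∣ q),
      lam ⟨wElt 0 q hq, wElt_mem 0 q hq⟩ = ∑ i, n i * kappa (r i) q := by
  obtain ⟨p, n, r, -, h⟩ := h
  refine ⟨p, n, r, fun q hq => ?_⟩
  rw [(deltaSeries_eq_derivative_iff _ _).1 h, neg_genFunctional_sum]

lemma hasExponentialPhi_of_kappa {lam : Module.Dual ℂ (wGrading 0)} {α : Type*} [Fintype α]
    (n r : α → ℂ) (h : ∀ (q : ℂ[X]) (hq : X ∣ q),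
      lam ⟨wElt 0 q hq, wElt_mem 0 q hq⟩ = ∑ a, n a * kappa (r a) q) : HasExponentialPhi lam := by
  let e := Fintype.equivFin (Option α)
  -- An additional exponent 0 enforces `φ(0) = 0`; it does not change the weight since `κ_0 = 0`.
  let n' : Option α → ℂ := fun a => a.elim (-∑ a, n a) n
  let r' : Option α → ℂ := fun a => a.elim 0 r
  refine ⟨_, n' ∘ e.symm, r' ∘ e.symm, ?_⟩
  have hsum : ∑ i, (n' ∘ e.symm) i • expSeries ((r' ∘ e.symm) i) =
      ∑ a, n' a • expSeries (r' a) :=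
    Equiv.sum_comp e.symm fun a => n' a • expSeries (r' a)
  rw [hsum]
  refine ⟨?_, (deltaSeries_eq_derivative_iff _ _).2 fun q hq => ?_⟩
  · rw [map_sum, Fintype.sum_option]
    simp [n', PowerSeries.smul_eq_C_mul, constantCoeff_expSeries]
  · rw [neg_genFunctional_sum, Fintype.sum_option, h q hq]
    simp [n', r', kappa_zero]

end GeneratingSeries

/-! ### Quasifinite weights of `𝔤_s` -/

section Quasifinite

variable {s : ℂ} {lam : Module.Dual ℂ (gsGrading s 0)}

/-- If `L(𝔤_s, λ)` is quasifinite, all lower bands supported off a finite set kill the highest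
weight vector. -/
lemma QuasifiniteWeight.exists_finset (hq : QuasifiniteWeight (gsGrading s) lam) :
    ∃ T : Finset ℤ, ∀ ξ : ℤ → ℂ, (∀ j ∈ T, ξ j = 0) →
      ⁅gsBand s (-1) ξ, IrrHW.vec (gsGrading s) lam⁆ = 0 := by
  classical
  have hg := innerGraded_gsGrading s
  set v := IrrHW.vec (gsGrading s) lam
  have hv : IsHighestWeight (gsGrading s) lam v := IrrHW.isHighestWeight _ lam
  have hfin := hq.finite (-1)
  rw [IrrHW.grading_eq_wt _ lam hg] at hfin
  let Φ : ℂ[X] →ₗ[ℂ] wt (IrrHW (gsGrading s) lam) (phiHat s wDeg)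
      (lam ⟨phiHat s wDeg, hg.mem_zero⟩) (-1) :=
    { toFun := fun q => ⟨⁅gsBand s (-1) fun j => q.eval (s - j), v⁆, by
        have := hg.lie_mem_wt (gsBand_mem s (-1) fun j => q.eval (s - j))
          (hv.mem_wt_zero hg.mem_zero)
        rwa [add_zero] at this⟩
      map_add' := fun p q => Subtype.ext (by
        change ⁅gsBand s (-1) _, v⁆ = ⁅_, v⁆ + ⁅_, v⁆
        rw [← add_lie, ← map_add]
        simp only [eval_add]
        rfl)
      map_smul' := fun c p => Subtype.ext (by
        change ⁅gsBand s (-1) _, v⁆ = c • ⁅_, v⁆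
        rw [← smul_lie, ← map_smul]
        simp only [eval_smul]
        rfl) }
  have hker : ∃ p, p ≠ 0 ∧ Φ p = 0 := by
    by_contra hcon
    push Not at hcon
    have hinj : Function.Injective Φ := (injective_iff_map_eq_zero Φ).2 fun p hp => by
      by_contra hne
      exact hcon p hne hp
    have : Module.Finite ℂ ℂ[X] := Module.Finite.of_injective Φ hinj
    exact Polynomial.not_finite this
  obtain ⟨p, hp, hΦ⟩ := hker
  have hp0 : ⁅gsBand s (-1) fun j => p.eval (s - j), v⁆ = 0 := congrArg Subtype.val hΦ
  have hT : {j : ℤ | p.eval (s - j) = 0}.Finite := by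
    refine Set.Finite.of_finite_image ((Polynomial.finite_setOfPred_isRoot hp).subset ?_)
      (f := fun j : ℤ => s - j) fun a _ b _ h => by simpa using h
    rintro _ ⟨j, hj, rfl⟩
    exact hj
  refine ⟨hT.toFinset, fun ξ hξ => ?_⟩
  -- A band vanishing at the zeros of `p(s - j)` is a multiple of the annihilating band, obtained by
  -- bracketing with a diagonal element; the latter acts on `v` by a scalar.
  obtain ⟨δ, hδ⟩ := exists_sub_shift_eq (k := -1) (by decide) fun j => ξ j / p.eval (s - j)
  have hb : gsBand s (-1) ξ = ⁅gsBand s 0 δ, gsBand s (-1) fun j => p.eval (s - j)⁆ := by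
    rw [lie_gsBand_zero]
    congr 1
    funext j
    rw [hδ]
    by_cases h : p.eval (s - j) = 0
    · rw [h, mul_zero, hξ j (by simpa using h)]
    · rw [div_mul_cancel₀ _ h]
  rw [hb, lie_lie, hp0, lie_zero, hv.lie_zero ⟨_, gsBand_mem s 0 δ⟩, lie_smul, hp0, smul_zero,
    sub_zero]

/-- The weights of quasifinite modules are finite combinations of the functionals `κ_{s-i}`. -/
lemma QuasifiniteWeight.exists_kappa (hq : QuasifiniteWeight (gsGrading s) lam) :
    ∃ (T : Finset ℤ) (n : ℤ → ℂ), ∀ (q : ℂ[X]) (hq : X ∣ q),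
      lam ⟨phiHat s (wElt 0 q hq), phiHat_mem s (wElt_mem 0 q hq)⟩ =
        ∑ i ∈ T, n i * kappa (s - i) q := by
  classical
  obtain ⟨T, hT⟩ := hq.exists_finset
  have hg := innerGraded_gsGrading s
  set v := IrrHW.vec (gsGrading s) lam
  have hv : IsHighestWeight (gsGrading s) lam v := IrrHW.isHighestWeight _ lam
  have hv0 : v ≠ 0 := IrrHW.vec_ne_zero _ lam hg
  -- Lowering by a single entry and raising again returns to the one-dimensional top component; the
  -- resulting scalars are the coefficients sought.
  have hn : ∀ i : ℤ, ∃ n : ℂ, n • v =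
      ⁅gsBand s 1 fun _ => 1, ⁅gsBand s (-1) (Pi.single i 1), v⁆⁆ := fun i => by
    have := hg.lie_mem_wt (gsBand_mem s 1 fun _ => 1)
      (hg.lie_mem_wt (gsBand_mem s (-1) (Pi.single i 1)) (hv.mem_wt_zero hg.mem_zero))
    rw [add_zero, add_neg_cancel, hv.wt_zero hg] at this
    exact Submodule.mem_span_singleton.1 this
  choose n hn using hn
  refine ⟨T, n, fun q hX => ?_⟩
  -- This antiderivative of the diagonal has `c 0 = κ_s(q)`, precisely the central coefficient of
  -- `φ̂_s(q(D))`. The vanishing next to the erased row is `κ_0 = 0` and `κ_1(q) = 0` for `X ∣ q`.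
  let c : ℤ → ℂ := fun i => kappa (s - i) q
  have hx := lie_up_down s c
    (by
      rintro j (hj | hj)
      · simp only [c]; rw [hj, sub_self, kappa_zero, LinearMap.zero_apply]
      · simp only [c]
        rw [show s - j = 1 by rw [← hj]; push_cast; ring, kappa_one hX])
    (phiHat s (wElt 0 q hX)) (phiHat_mem s (wElt_mem 0 q hX))
    (fun i hi => by
      rw [phiHat_entry s _ i i hi hi, wElt_op, sub_self, DiffOp.coeff_single, if_pos rfl,
        neg_add_eq_sub, ← kappa_sub_kappa_add_one]
      simp only [c]
      push_cast
      rw [show s - i + 1 = s - (i - 1) by ring])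
    (by
      rw [phiHat_cen, wElt_cen, wElt_op, DiffOp.coeff_single, if_pos rfl, zero_add]
      simp [c])
  -- Removing the entries in `T` leaves a band that kills `v`, so only finitely many `κ_{s-i}(q)`
  -- survive.
  have hc : ⁅gsBand s (-1) c, v⁆ = ∑ i ∈ T, c i • ⁅gsBand s (-1) (Pi.single i 1), v⁆ := by
    have h0 := hT (c - ∑ i ∈ T, c i • (Pi.single i (1 : ℂ) : ℤ → ℂ)) fun j hj => by
      rw [Pi.sub_apply, Finset.sum_apply, Finset.sum_eq_single j]
      · simp
      · intro i _ hij
        simp [hij.symm]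
      · exact fun h => absurd hj h
    rw [map_sub, sub_lie, sub_eq_zero] at h0
    rw [h0, map_sum, sum_lie]
    exact Finset.sum_congr rfl fun i _ => by rw [map_smul, smul_lie]
  have hl : ⁅phiHat s (wElt 0 q hX), v⁆ = (∑ i ∈ T, c i * n i) • v := by
    rw [← hx, lie_lie, hv.lie_pos 1 one_pos _ (gsBand_mem s 1 _), lie_zero, sub_zero, hc, lie_sum]
    simp only [lie_smul, ← hn, ← mul_smul, ← Finset.sum_smul]
  rw [hv.lie_zero ⟨phiHat s (wElt 0 q hX), phiHat_mem s (wElt_mem 0 q hX)⟩] at hl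
  exact (smul_left_injective ℂ hv0 hl).trans (Finset.sum_congr rfl fun i _ => mul_comm _ _)

end Quasifinite

theorem hasExponentialPhi_pullbackWeight {m : ℕ} {s : Fin m → ℂ}
    {lam : ∀ i, Module.Dual ℂ (gsGrading (s i) 0)}
    (hq : ∀ i, QuasifiniteWeight (gsGrading (s i)) (lam i)) :
    HasExponentialPhi (pullbackWeight s lam) := by
  choose T n hn using fun i => (hq i).exists_kappa
  refine hasExponentialPhi_of_kappa (α := Σ i, T i) (fun a => n a.1 a.2)
    (fun a => s a.1 - (a.2 : ℤ)) fun q hX => ?_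
  rw [pullbackWeight_apply, Fintype.sum_sigma]
  refine Finset.sum_congr rfl fun i _ => ?_
  rw [hn i q hX, ← Finset.sum_coe_sort]


/-! ### A criterion for quasifiniteness -/

section Spanning

variable {L : Type*} [LieRing L] [LieAlgebra ℂ L] {V : Type*} [AddCommGroup V] [Module ℂ V]
  [LieRingModule L V] [LieModule ℂ L V] {gr : ℤ → Submodule ℂ L} {d : L}
  {lam : Module.Dual ℂ (gr 0)} {v : V}

/-- The components of negative degree of a highest weight module are spanned by the images of the
higher components under elements of negative degree. -/
lemma IsHighestWeight.wt_neg (hv : IsHighestWeight gr lam v) (hg : InnerGraded gr d) {j : ℤ}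
    (hj : j < 0) : wt V d (lam ⟨d, hg.mem_zero⟩) j =
      Submodule.span ℂ {w | ∃ a < 0, ∃ x ∈ gr a, ∃ u ∈ wt V d (lam ⟨d, hg.mem_zero⟩) (j - a),
        w = ⁅x, u⁆} := by
  set μ := lam ⟨d, hg.mem_zero⟩
  let Q : ℤ → Submodule ℂ V := fun j => Submodule.span ℂ
    {w | ∃ a < 0, ∃ x ∈ gr a, ∃ u ∈ wt V d μ (j - a), w = ⁅x, u⁆}
  have hQ : ∀ j, Q j ≤ wt V d μ j := fun j => by
    refine Submodule.span_le.2 ?_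
    rintro _ ⟨a, -, x, hx, u, hu, rfl⟩
    have := hg.lie_mem_wt hx hu
    rwa [add_sub_cancel] at this
  -- The total span of this family contains `v` and is stable under the negative part, so it is `V`;
  -- hence its members are the full eigenspaces.
  let e : ℤ → Submodule ℂ V := fun j =>
    if j < 0 then Q j else if j = 0 then Submodule.span ℂ {v} else ⊥
  have he : ∀ j, e j ≤ wt V d μ j := fun j => by
    simp only [e]
    split_ifs with h1 h2
    · exact hQ j
    · rw [h2, Submodule.span_singleton_le_iff_mem]
      exact hv.mem_wt_zero hg.mem_zero
    · exact bot_le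
  have hepos : ∀ j, 0 < j → e j = ⊥ := fun j hj => by
    simp only [e]
    rw [if_neg (by omega), if_neg (by omega)]
  have hS : Submodule.span ℂ {v} ≤ ⨆ j, e j := by
    refine le_trans (le_of_eq ?_) (le_iSup e 0)
    simp [e]
  obtain ⟨N, hSN, hNQ⟩ := hg.exists_lieSubmodule_le (Submodule.span ℂ {v}) (⨆ j, e j)
    (fun x hx u hu => by
      obtain ⟨c, rfl⟩ := Submodule.mem_span_singleton.1 hu
      rw [lie_smul, hv.lie_zero ⟨x, hx⟩]
      exact Submodule.smul_mem _ _ (Submodule.smul_mem _ _ (Submodule.mem_span_singleton_self v)))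
    (fun j hj x hx u hu => by
      obtain ⟨c, rfl⟩ := Submodule.mem_span_singleton.1 hu
      rw [lie_smul, hv.lie_pos j hj x hx, smul_zero])
    hS
    (fun a ha x hx u hu => by
      induction hu using Submodule.iSup_induction' with
      | mem j u hu =>
        rcases lt_or_ge 0 j with h | h
        · rw [hepos j h, Submodule.mem_bot] at hu
          rw [hu, _root_.lie_zero]
          exact Submodule.zero_mem _
        · refine Submodule.mem_iSup_of_mem (a + j) ?_
          simp only [e]
          rw [if_pos (by omega)]
          refine Submodule.subset_span ⟨a, ha, x, hx, u, ?_, rfl⟩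
          rw [add_sub_cancel_left]
          exact he j hu
      | zero => rw [_root_.lie_zero]; exact Submodule.zero_mem _
      | add u w _ _ hu hw => rw [lie_add]; exact Submodule.add_mem _ hu hw)
  have hN : N = ⊤ := hv.generates N (hSN (Submodule.mem_span_singleton_self v))
  have htop : ⨆ j, e j = ⊤ := top_le_iff.1 (by rw [hN] at hNQ; exact hNQ)
  have h := eq_eigenspace_of_iSup_eq_top (LieModule.toEnd ℂ L V d) μ e he htop j
  change e j = wt V d μ j at h
  rw [← h]
  simp only [e]
  rw [if_pos hj]

/-- If every homogeneous component of negative degree maps every vector into a finite-dimensional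
space, all the components of a highest weight module are finite-dimensional. -/
lemma IsHighestWeight.finiteDimensional_wt (hv : IsHighestWeight gr lam v) (hg : InnerGraded gr d)
    (hfin : ∀ a < 0, ∀ u : V, ∃ S : Submodule ℂ V, FiniteDimensional ℂ S ∧ ∀ x ∈ gr a, ⁅x, u⁆ ∈ S)
    (j : ℤ) : FiniteDimensional ℂ (wt V d (lam ⟨d, hg.mem_zero⟩) j) := by
  classical
  suffices h : ∀ (k : ℕ) (j : ℤ), -j ≤ k →
      FiniteDimensional ℂ (wt V d (lam ⟨d, hg.mem_zero⟩) j) from h (-j).toNat j (by omega)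
  intro k
  have hnonneg : ∀ j : ℤ, 0 ≤ j → FiniteDimensional ℂ (wt V d (lam ⟨d, hg.mem_zero⟩) j) := by
    intro j hj
    rcases hj.lt_or_eq with h | h
    · rw [hv.wt_pos hg h]; infer_instance
    · rw [← h, hv.wt_zero hg]; infer_instance
  induction k with
  | zero => exact fun j hj => hnonneg j (by omega)
  | succ k ih =>
    intro j hj
    rcases le_or_gt 0 j with h0 | h0
    · exact hnonneg j h0
    choose! S hS hmem using hfin
    have hB : ∀ a : ℤ, a < 0 → ∃ B : Finset V,
        Submodule.span ℂ (B : Set V) = wt V d (lam ⟨d, hg.mem_zero⟩) (j - a) := fun a ha =>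
      have := ih (j - a) (by omega)
      (Submodule.fg_iff_finiteDimensional _).2 this
    choose! B hB using hB
    -- Terms with `a < j` vanish since `j - a` is positive; for the others a finite spanning set of
    -- the component `j - a` suffices.
    have hle : wt V d (lam ⟨d, hg.mem_zero⟩) j ≤
        (Finset.Ico j 0).sup fun a => (B a).sup fun u => S a u := by
      rw [hv.wt_neg hg h0]
      refine Submodule.span_le.2 ?_
      rintro _ ⟨a, ha, x, hx, u, hu, rfl⟩
      rcases lt_or_ge a j with h | h
      · rw [hv.wt_pos hg (by omega), Submodule.mem_bot] at hu
        rw [hu, _root_.lie_zero]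
        exact Submodule.zero_mem _
      · refine Finset.le_sup (f := fun a => (B a).sup fun u => S a u) (Finset.mem_Ico.2 ⟨h, ha⟩) ?_
        rw [← hB a ha] at hu
        induction hu using Submodule.span_induction with
        | mem u hu => exact Finset.le_sup (f := fun u => S a u) hu (hmem a ha u x hx)
        | zero => rw [_root_.lie_zero]; exact Submodule.zero_mem _
        | add u w _ _ hu hw => rw [lie_add]; exact Submodule.add_mem _ hu hw
        | smul c u _ hu => rw [lie_smul]; exact Submodule.smul_mem _ _ hu
    have hfd : FiniteDimensional ℂ
        ((Finset.Ico j 0).sup fun a => (B a).sup fun u => S a u : Submodule ℂ V) := by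
      have h1 : ∀ a ∈ Finset.Ico j 0, ((B a).sup fun u => S a u).FG := fun a ha =>
        Submodule.fg_finset_sup _ _ fun u _ =>
          (Submodule.fg_iff_finiteDimensional _).2 (hS a (Finset.mem_Ico.1 ha).2 u)
      exact (Submodule.fg_iff_finiteDimensional _).1 (Submodule.fg_finset_sup _ _ h1)
    exact Submodule.finiteDimensional_of_le hle

end Spanning

/-! ### Elements of `𝔤_s` supported away from the origin, and weights vanishing on them. -/

/-- The elements of `𝔤_s` without central part and with vanishing entries in the rows and columns
`i`, `|i| ≤ R`. -/
def gsOff (s : ℂ) (R : ℤ) : Submodule ℂ (gs s) where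
  carrier := {x | gsCen s x = 0 ∧ ∀ i j, |i| ≤ R ∨ |j| ≤ R → gsEntry s i j x = 0}
  zero_mem' := ⟨map_zero _, fun _ _ _ => map_zero _⟩
  add_mem' := fun {x y} hx hy => ⟨by rw [map_add, hx.1, hy.1, add_zero], fun i j h => by
    rw [map_add, hx.2 i j h, hy.2 i j h, add_zero]⟩
  smul_mem' := fun c x hx => ⟨by rw [map_smul, hx.1, smul_zero], fun i j h => by
    rw [map_smul, hx.2 i j h, smul_zero]⟩

lemma gsOff_anti (s : ℂ) {R R' : ℤ} (h : R ≤ R') : gsOff s R' ≤ gsOff s R := fun _ hx =>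
  ⟨hx.1, fun i j hij => hx.2 i j (hij.imp (fun h' => h'.trans h) fun h' => h'.trans h)⟩

/-- A factor of degree `b` moves indices by `|b|`, so the zero window shrinks by at most that. No
central term arises: it involves only entries `(i, i + a)` crossing from `≤ 0` to `> 0` or back, so
`|i| ≤ |a| ≤ R`, where `x` vanishes. -/
lemma lie_mem_gsOff {s : ℂ} {a b R R' : ℤ} {x y : gs s} (hx : x ∈ gsGrading s a)
    (hy : y ∈ gsGrading s b) (hxR : x ∈ gsOff s R) (ha : |a| ≤ R) (hb : R' + |b| ≤ R) :
    ⁅x, y⁆ ∈ gsOff s R' := by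
  refine ⟨?_, fun i j hij => ?_⟩
  · rw [gsCen_lie_homogeneous hx]
    refine finsum_eq_zero_of_forall_eq_zero fun i => ?_
    by_cases h : |i| ≤ R
    · rw [hxR.2 _ _ (Or.inl h), mul_zero, zero_mul]
    · have : ((if i ≤ 0 then 1 else 0) - (if i + a ≤ 0 then 1 else 0) : ℂ) = 0 := by
        rw [abs_le] at h ha
        split_ifs <;> first | omega | simp
      rw [this, zero_mul, zero_mul]
  · by_cases hd : j = i + a + b
    · subst hd
      have h1 : |i| ≤ R ∨ |i + a| ≤ R := by
        have := abs_le.1 (le_refl |b|)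
        simp only [abs_le] at hij ⊢
        omega
      have h2 : |i + b| ≤ R ∨ |i + a + b| ≤ R := by
        have := abs_le.1 (le_refl |b|)
        simp only [abs_le] at hij ⊢
        omega
      rw [gsEntry_lie_homogeneous hx hy, hxR.2 _ _ h1, hxR.2 _ _ h2, zero_mul, mul_zero, sub_zero]
    · exact ((innerGraded_gsGrading s).lie_mem a b x y hx hy).1 i j (by omega)

section Criterion

variable {s : ℂ} {lam : Module.Dual ℂ (gsGrading s 0)} {V : Type*} [AddCommGroup V] [Module ℂ V]
  [LieRingModule (gs s) V] [LieModule ℂ (gs s) V] {v : V}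

/-- Strong induction on the depth `k`. Applying `y` of degree `j > 0` to `⁅x, v⁆` leaves the bracket
of `x` and `y`, of depth `k - j` and with window shrunk by `j`, which matches the window `M + k`;
for `j > k` it has positive degree. So `⁅x, v⁆` is singular, hence a multiple of `v`, and being of
degree `-k ≠ 0` it vanishes. -/
lemma IsHighestWeight.lie_eq_zero_of_mem_gsOff (hv : IsHighestWeight (gsGrading s) lam v)
    (hv0 : v ≠ 0) [LieModule.IsIrreducible ℂ (gs s) V] (M : ℕ)
    (hM : ∀ h : gsGrading s 0, (h : gs s) ∈ gsOff s M → lam h = 0) (k : ℕ) :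
    ∀ x ∈ gsGrading s (-k), x ∈ gsOff s (M + k) → ⁅x, v⁆ = 0 := by
  have hg := innerGraded_gsGrading s
  induction k using Nat.strong_induction_on with
  | _ k ih =>
    intro x hx hxR
    rcases Nat.eq_zero_or_pos k with rfl | hk
    · rw [Nat.cast_zero, neg_zero] at hx
      rw [Nat.cast_zero, add_zero] at hxR
      rw [hv.lie_zero ⟨x, hx⟩, hM ⟨x, hx⟩ hxR, zero_smul]
    have hsing : ∀ j : ℤ, 0 < j → ∀ y ∈ gsGrading s j, ⁅y, ⁅x, v⁆⁆ = 0 := by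
      intro j hj y hy
      have hxy := hg.lie_mem _ _ x y hx hy
      rw [leibniz_lie, hv.lie_pos j hj y hy, _root_.lie_zero, add_zero, ← lie_skew, neg_lie,
        neg_eq_zero]
      rcases lt_or_ge (k : ℤ) j with h | h
      · exact hv.lie_pos _ (by omega) _ hxy
      · have hoff := lie_mem_gsOff (R' := M + ((k - j.toNat : ℕ) : ℤ)) hx hy hxR
          (by rw [abs_neg, Nat.abs_cast]; omega) (by rw [abs_of_pos hj]; omega)
        refine ih (k - j.toNat) (by omega) _ ?_ hoff
        rwa [show -((k - j.toNat : ℕ) : ℤ) = -(k : ℤ) + j by omega]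
    obtain ⟨c, hc⟩ := Submodule.mem_span_singleton.1 (hv.mem_span_of_singular hg hv0 hsing)
    have hwt := hg.lie_mem_wt hx (hv.mem_wt_zero hg.mem_zero)
    rw [← hc, mem_wt, lie_smul, hv.lie_zero ⟨_, hg.mem_zero⟩, ← mul_smul, ← mul_smul] at hwt
    have h := smul_left_injective ℂ hv0 hwt
    have hc0 : (k : ℂ) * c = 0 := by
      push_cast at h
      linear_combination h
    rcases mul_eq_zero.1 hc0 with h' | h'
    · exact absurd (Nat.cast_eq_zero.1 h') hk.ne'
    · rw [← hc, h', zero_smul]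

/-- The vectors killed, in each degree, by all elements with a sufficiently large zero window form a
submodule: moving past an element of degree `b` costs `|b|` in the window. It contains `v`. -/
lemma IsHighestWeight.exists_gsOff_lie_eq_zero (hv : IsHighestWeight (gsGrading s) lam v)
    (hv0 : v ≠ 0) [LieModule.IsIrreducible ℂ (gs s) V] (M : ℕ)
    (hM : ∀ h : gsGrading s 0, (h : gs s) ∈ gsOff s M → lam h = 0) (u : V) (j : ℤ) :
    ∃ R : ℤ, ∀ x ∈ gsGrading s j, x ∈ gsOff s R → ⁅x, u⁆ = 0 := by
  have hg := innerGraded_gsGrading s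
  let K : Submodule ℂ V :=
    { carrier := {u | ∀ j, ∃ R : ℤ, ∀ x ∈ gsGrading s j, x ∈ gsOff s R → ⁅x, u⁆ = 0}
      zero_mem' := fun j => ⟨0, fun x _ _ => _root_.lie_zero x⟩
      add_mem' := fun {u w} hu hw j => by
        obtain ⟨R, hR⟩ := hu j
        obtain ⟨R', hR'⟩ := hw j
        refine ⟨max R R', fun x hx hxR => ?_⟩
        rw [lie_add, hR x hx (gsOff_anti s (le_max_left _ _) hxR),
          hR' x hx (gsOff_anti s (le_max_right _ _) hxR), add_zero]
      smul_mem' := fun c u hu j => by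
        obtain ⟨R, hR⟩ := hu j
        exact ⟨R, fun x hx hxR => by rw [lie_smul, hR x hx hxR, smul_zero]⟩ }
  have hK : ∀ u ∈ K, ∀ b, ∀ y ∈ gsGrading s b, ⁅y, u⁆ ∈ K := by
    intro u hu b y hy j
    obtain ⟨R, hR⟩ := hu j
    obtain ⟨R', hR'⟩ := hu (j + b)
    refine ⟨max R (max (R' + |b|) |j|), fun x hx hxR => ?_⟩
    rw [leibniz_lie, hR x hx (gsOff_anti s (le_max_left _ _) hxR), _root_.lie_zero, add_zero]
    exact hR' _ (hg.lie_mem j b x y hx hy) (lie_mem_gsOff hx hy hxR (by simp) (by simp))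
  let N : LieSubmodule ℂ (gs s) V :=
    { K with lie_mem := fun {x u} hu => lie_mem_of_homogeneous hg.iSup_eq_top K (hK u hu) x }
  have hvN : v ∈ N := fun j => by
    rcases lt_or_ge 0 j with h | h
    · exact ⟨0, fun x hx _ => hv.lie_pos j h x hx⟩
    · refine ⟨M + (-j).toNat, fun x hx hxR => ?_⟩
      refine hv.lie_eq_zero_of_mem_gsOff hv0 M hM (-j).toNat x ?_ hxR
      rwa [show -((-j).toNat : ℤ) = j by omega]
  have hN := hv.generates N hvN
  have hu : u ∈ N := by rw [hN]; trivial
  exact hu j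

/-- A weight of `𝔤_s` which only depends on finitely many diagonal entries and on the central
coefficient is quasifinite. -/
theorem quasifiniteWeight_of_gsOff (M : ℕ)
    (hM : ∀ h : gsGrading s 0, (h : gs s) ∈ gsOff s M → lam h = 0) :
    QuasifiniteWeight (gsGrading s) lam := by
  classical
  have hg := innerGraded_gsGrading s
  have hv := IrrHW.isHighestWeight (gsGrading s) lam
  have hv0 := IrrHW.vec_ne_zero (gsGrading s) lam hg
  have := IrrHW.isIrreducible (gsGrading s) lam hg
  refine IrrHW.quasifiniteWeight_of_finite _ lam hg (hv.finiteDimensional_wt hg fun a ha u => ?_)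
  obtain ⟨R, hR⟩ := hv.exists_gsOff_lie_eq_zero hv0 M hM u a
  -- `T` contains every column `j` whose entry `(j - a, j)` has an index in the window of radius
  -- `R`; deleting these entries leaves a band that kills `u`.
  let T : Finset ℤ := Finset.Icc (-R + a) (R - a)
  refine ⟨Submodule.span ℂ (T.image fun i => ⁅gsBand s a (Pi.single i 1), u⁆ : Finset _),
    FiniteDimensional.span_finset ℂ _, fun x hx => ?_⟩
  have hx' := eq_gsBand hx (hx.2 ha.ne)
  set ξ : ℤ → ℂ := fun j => gsEntry s (j - a) j x
  have hoff : gsBand s a (ξ - ∑ i ∈ T, ξ i • (Pi.single i (1 : ℂ) : ℤ → ℂ)) ∈ gsOff s R := by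
    refine ⟨gsCen_gsBand _ _ _, fun i j hij => ?_⟩
    rw [gsEntry_gsBand]
    split_ifs with h1 h2
    · rfl
    · have hj : j ∈ T := by
        simp only [abs_le] at hij
        simp only [T, Finset.mem_Icc]
        omega
      rw [Pi.sub_apply, Finset.sum_apply, Finset.sum_eq_single j]
      · simp
      · intro i _ hij
        simp [hij.symm]
      · exact fun h => absurd hj h
    · rfl
  have h0 := hR _ (gsBand_mem s a _) hoff
  rw [map_sub, sub_lie, sub_eq_zero, ← hx', map_sum, sum_lie] at h0
  rw [h0]
  refine Submodule.sum_mem _ fun i hi => ?_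
  rw [map_smul, smul_lie]
  exact Submodule.smul_mem _ _ (Submodule.subset_span (Finset.mem_coe.2
    (Finset.mem_image_of_mem _ hi)))

end Criterion

/-! ### Realization of the weights with exponential generating series -/

/-- The weight of `𝔤_s` which takes the value `κ_{s-j}(q)` on `φ̂_s(q(D))`, and `1` on `C`. -/
def gsChi (s : ℂ) (j : ℤ) : Module.Dual ℂ (gsGrading s 0) :=
  (gsCen s + (∑ i ∈ Finset.Ioc 0 j, gsEntry s i i - ∑ i ∈ Finset.Ioc j 0, gsEntry s i i)) ∘ₗ
    (gsGrading s 0).subtype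

lemma gsChi_apply (s : ℂ) (j : ℤ) (h : gsGrading s 0) :
    gsChi s j h = gsCen s h + cumSum (fun i => gsEntry s i i h) j := by
  simp [gsChi, cumSum]

/-- Both sides agree at `j = 0`, where they are the central coefficient `κ_s(q)`, and have the same
increments `q(s - i)`. This is consistent with the erased entry because `q(0) = 0`. -/
lemma gsChi_wElt (s : ℂ) (j : ℤ) (q : ℂ[X]) (hq : X ∣ q) :
    gsChi s j ⟨phiHat s (wElt 0 q hq), phiHat_mem s (wElt_mem 0 q hq)⟩ = kappa (s - j) q := by
  rw [gsChi_apply]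
  have hentry : ∀ i : ℤ, gsEntry s i i (phiHat s (wElt 0 q hq)) =
      kappa (s - i) q - kappa (s - (i - 1 : ℤ)) q := by
    intro i
    push_cast
    rw [show s - (i - 1) = s - i + 1 by ring, kappa_sub_kappa_add_one]
    by_cases hi : (i : ℂ) = s
    · rw [gsEntry_eq_zero _ (Or.inl hi), hi, sub_self, ← coeff_zero_eq_eval_zero, X_dvd_iff.1 hq]
    · rw [phiHat_entry s _ i i hi hi, wElt_op, sub_self, DiffOp.coeff_single, if_pos rfl,
        neg_add_eq_sub]
  have hcen : gsCen s (phiHat s (wElt 0 q hq)) = kappa s q := by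
    rw [phiHat_cen, wElt_cen, wElt_op, DiffOp.coeff_single, if_pos rfl, zero_add]
  simp only [hcen]
  have hstep := fun i => cumSum_sub (fun i => gsEntry s i i (phiHat s (wElt 0 q hq))) i
  simp only [hentry] at hstep ⊢
  induction j using Int.induction_on with
  | zero => simp [cumSum_zero]
  | succ j ih =>
    have := hstep (j + 1)
    rw [add_sub_cancel_right] at this
    linear_combination ih + this
  | pred j ih =>
    have := hstep (-j)
    linear_combination ih - this

lemma gsChi_wCen (s : ℂ) (j : ℤ) : gsChi s j ⟨phiHat s wCen, phiHat_mem s wCen_mem⟩ = 1 := by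
  have hentry : ∀ i : ℤ, gsEntry s i i (phiHat s wCen) = 0 := by
    intro i
    by_cases hi : (i : ℂ) = s
    · exact gsEntry_eq_zero _ (Or.inl hi)
    · rw [phiHat_entry s _ i i hi hi]
      exact eval_zero
  have hcen : gsCen s (phiHat s wCen) = 1 := by
    rw [phiHat_cen]
    change 1 + kappa s 0 = 1
    rw [map_zero, add_zero]
  rw [gsChi_apply]
  simp [hentry, hcen, cumSum]

lemma gsChi_eq_zero {s : ℂ} {j R : ℤ} (hj : |j| ≤ R) {h : gsGrading s 0}
    (hh : (h : gs s) ∈ gsOff s R) :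
    gsChi s j h = 0 := by
  rw [gsChi_apply, hh.1, zero_add, cumSum, Finset.sum_eq_zero, Finset.sum_eq_zero, sub_zero]
  · intro i hi
    rw [Finset.mem_Ioc] at hi
    refine hh.2 i i (Or.inl ?_)
    rw [abs_le] at hj ⊢
    omega
  · intro i hi
    rw [Finset.mem_Ioc] at hi
    refine hh.2 i i (Or.inl ?_)
    rw [abs_le] at hj ⊢
    omega

lemma quasifiniteWeight_sum_gsChi (s : ℂ) {α : Type*} (T : Finset α) (n : α → ℂ) (j : α → ℤ) :
    QuasifiniteWeight (gsGrading s) (∑ a ∈ T, n a • gsChi s (j a)) := by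
  refine quasifiniteWeight_of_gsOff (∑ a ∈ T, (j a).natAbs) fun h hh => ?_
  rw [LinearMap.sum_apply]
  refine Finset.sum_eq_zero fun a ha => ?_
  rw [LinearMap.smul_apply, gsChi_eq_zero _ hh, smul_zero]
  rw [Int.abs_eq_natAbs]
  exact_mod_cast Finset.single_le_sum (f := fun a => (j a).natAbs) (fun _ _ => Nat.zero_le _) ha

lemma wGrading_zero_ext {lam lam' : Module.Dual ℂ (wGrading 0)}
    (h : ∀ (q : ℂ[X]) (hq : X ∣ q), lam ⟨wElt 0 q hq, wElt_mem 0 q hq⟩ =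
      lam' ⟨wElt 0 q hq, wElt_mem 0 q hq⟩)
    (hC : lam ⟨wCen, wCen_mem⟩ = lam' ⟨wCen, wCen_mem⟩) : lam = lam' := by
  refine LinearMap.ext fun x => ?_
  have hx : x = (⟨wElt 0 (x.1.1.op.coeff 0) (x.1.2 0), wElt_mem 0 _ _⟩ : wGrading 0) +
      x.1.1.cen • (⟨wCen, wCen_mem⟩ : wGrading 0) := by
    refine Subtype.ext (Subtype.ext (W1Inf.ext' ?_ ?_))
    · change _ = DiffOp.single 0 (x.1.1.op.coeff 0) + x.1.1.cen • (0 : DiffOp)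
      rw [smul_zero, add_zero]
      exact op_eq_single x.2
    · change _ = 0 + x.1.1.cen * 1
      rw [zero_add, mul_one]
  rw [hx, map_add, map_add, map_smul, map_smul, h, hC]

/-- Every weight of `W_∞` with exponential generating series is the pullback of quasifinite weights
of some `𝔤_{s⃗}`. -/
theorem HasExponentialPhi.exists_pullbackWeight {Lam : Module.Dual ℂ (wGrading 0)}
    (h : HasExponentialPhi Lam) :
    ∃ (m : ℕ) (s : Fin m → ℂ) (lam : ∀ i, Module.Dual ℂ (gsGrading (s i) 0)), Admissible s ∧
      (∀ i, QuasifiniteWeight (gsGrading (s i)) (lam i)) ∧ pullbackWeight s lam = Lam := by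
  classical
  obtain ⟨p, n₀, r₀, h₀⟩ := h.exists_kappa
  -- The additional exponent 0 contributes nothing on the operators, as `κ_0 = 0`, and its
  -- coefficient corrects the value on `C`, on which every `gsChi` is 1.
  let n : Option (Fin p) → ℂ := fun a => a.elim (Lam ⟨wCen, wCen_mem⟩ - ∑ i, n₀ i) n₀
  let r : Option (Fin p) → ℂ := fun a => a.elim 0 r₀
  -- Each exponent is written as `r = s - j` with `0 ≤ Re s < 1`; `T` collects the distinct `s`, so
  -- exponents congruent modulo `ℤ` share one slot.
  let j : Option (Fin p) → ℤ := fun a => -⌊(r a).re⌋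
  let T : Finset ℂ := Finset.univ.image fun a => r a + j a
  let s : Fin T.card → ℂ := fun i => T.equivFin.symm i
  have hsmem : ∀ i, ∃ a, r a + j a = s i := fun i => by
    have := (T.equivFin.symm i).2
    rw [Finset.mem_image] at this
    obtain ⟨a, -, ha⟩ := this
    exact ⟨a, ha⟩
  let b : Option (Fin p) → Fin T.card := fun a =>
    T.equivFin ⟨r a + j a, Finset.mem_image_of_mem _ (Finset.mem_univ a)⟩
  have hb : ∀ a, s (b a) = r a + j a := fun a => by simp [s, b]
  have hre : ∀ i, 0 ≤ (s i).re ∧ (s i).re < 1 := fun i => by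
    obtain ⟨a, ha⟩ := hsmem i
    rw [← ha]
    have h1 := Int.floor_le (r a).re
    have h2 := Int.lt_floor_add_one (r a).re
    simp only [j, Complex.add_re, Complex.intCast_re]
    push_cast
    constructor <;> linarith
  let lam : ∀ i, Module.Dual ℂ (gsGrading (s i) 0) := fun i =>
    ∑ a ∈ Finset.univ.filter fun a => b a = i, n a • gsChi (s i) (j a)
  refine ⟨T.card, s, lam, ⟨fun i i' hii k hk => hii ?_, hre⟩,
    fun i => quasifiniteWeight_sum_gsChi (s i) _ n j, wGrading_zero_ext (fun q hq => ?_) ?_⟩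
  -- Two numbers with real parts in `[0, 1)` that differ by an integer are equal, and the elements
  -- of `T` are listed without repetition.
  · have hk' := congrArg Complex.re hk
    rw [Complex.sub_re, Complex.intCast_re] at hk'
    have h1 := hre i
    have h2 := hre i'
    have hk1 : (k : ℝ) < 1 := by linarith
    have hk2 : (-1 : ℝ) < k := by linarith
    have hk0 : k = 0 := by
      have h3 : k < 1 := by exact_mod_cast hk1
      have h4 : -1 < k := by exact_mod_cast hk2
      omega
    rw [hk0, Int.cast_zero, sub_eq_zero] at hk
    exact T.equivFin.symm.injective (Subtype.ext hk)
  · have hi : ∀ i, lam i ⟨phiHat (s i) (wElt 0 q hq), phiHat_mem (s i) (wElt_mem 0 q hq)⟩ =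
        ∑ a ∈ Finset.univ.filter fun a => b a = i, n a * kappa (r a) q := fun i => by
      simp only [lam, LinearMap.sum_apply, LinearMap.smul_apply, gsChi_wElt, smul_eq_mul]
      refine Finset.sum_congr rfl fun a ha => ?_
      rw [← (Finset.mem_filter.1 ha).2, hb, add_sub_cancel_right]
    rw [pullbackWeight_apply, h₀]
    simp only [hi]
    rw [Finset.sum_fiberwise, Fintype.sum_option]
    simp [n, r, kappa_zero]
  · have hi : ∀ i, lam i ⟨phiHat (s i) wCen, phiHat_mem (s i) wCen_mem⟩ =
        ∑ a ∈ Finset.univ.filter fun a => b a = i, n a := fun i => by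
      simp only [lam, LinearMap.sum_apply, LinearMap.smul_apply, gsChi_wCen, smul_eq_mul, mul_one]
    rw [pullbackWeight_apply]
    simp only [hi]
    rw [Finset.sum_fiberwise, Fintype.sum_option]
    simp [n]

end WInfty

end

/-! ### Assembly of the three statements. -/

theorem theorem6p7 :
    (∀ (m : ℕ) (s : Fin m → ℂ), Admissible s →
      (∀ (V : Type*) [AddCommGroup V] [Module ℂ V] [LieRingModule (gsVec s) V]
        [LieModule ℂ (gsVec s) V] (grV : ℤ → Submodule ℂ V),
        IsQuasifinite (gsVecGrading s) grV →
        ∀ N : LieSubmodule ℂ WInf (Restrict (phiHatVec s) V),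
          ∃ N' : LieSubmodule ℂ (gsVec s) V,
            ∀ v : V, v ∈ N' ↔ Restrict.of (phiHatVec s) V v ∈ N) ∧
      (∀ lam : ∀ i, Module.Dual ℂ (gsGrading (s i) 0),
        (∀ i, QuasifiniteWeight (gsGrading (s i)) (lam i)) →
        LieModule.IsIrreducible ℂ WInf (Restrict (phiHatVec s) (TensorHW s lam)) ∧
        ∃ Lam : Module.Dual ℂ (wGrading 0),
          QuasifiniteWeight wGrading Lam ∧ HasExponentialPhi Lam ∧
          Nonempty (IrrHW wGrading Lam ≃ₗ⁅ℂ,WInf⁆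
            Restrict (phiHatVec s) (TensorHW s lam)))) ∧
    (∀ Lam : Module.Dual ℂ (wGrading 0),
      QuasifiniteWeight wGrading Lam → HasExponentialPhi Lam →
      ∃ (m : ℕ) (s : Fin m → ℂ) (lam : ∀ i, Module.Dual ℂ (gsGrading (s i) 0)),
        Admissible s ∧ (∀ i, QuasifiniteWeight (gsGrading (s i)) (lam i)) ∧
        Nonempty (IrrHW wGrading Lam ≃ₗ⁅ℂ,WInf⁆
          Restrict (phiHatVec s) (TensorHW s lam))) := by
  refine ⟨fun m s hs => ⟨fun V _ _ _ _ grV hV N => exists_lieSubmodule_of_restrict hs hV N,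
    fun lam hq => ⟨restrict_tensorHW_isIrreducible hs hq, pullbackWeight s lam,
      quasifiniteWeight_pullbackWeight hs hq, hasExponentialPhi_pullbackWeight hq,
      nonempty_equiv_restrict hs hq⟩⟩, fun Lam _ hphi => ?_⟩
  obtain ⟨m, s, lam, hs, hq, rfl⟩ := hphi.exists_pullbackWeight
  exact ⟨m, s, lam, hs, hq, nonempty_equiv_restrict hs hq⟩
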